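/- All algorithms are deterministic, running times are worst-case numbers of steps on a word RAM (unit-cost random-access machine whose words have $O(\log(\text{input size}+\text{running time}))$ bits). ST-Max-Flow: given a directed graph $G=(V,E)$ and two sets $S,T\subseteq V$, output for every pair $s\in S$, $t\in T$ (with $s\neq t$) the maximum amount of flow that can be shipped in $G$ from $s$ to $t$. The graph is called uncapacitated if all edge capacities equal $1$. MAX-CNF-SAT: given a CNF formula, output the maximum number of its clauses that can be satisfied simultaneously by an assignment. SETH (the Strong Exponential Time Hypothesis) states that for every $\varepsilon'>0$ there is an integer $k\ge 3$ such that $k$-SAT on $n'$ variables and $m'$ clauses cannot be solved in time $2^{(1-\varepsilon')n'}\cdot\mathrm{poly}(m')$. We write $x=\tilde\Theta(f)$ if $f/(A(1+\log f)^{d})\le x\le A(1+\log f)^{d} f$ for some constants $A,d$. **Theorem.** For every $\varepsilon>0$ there is $\delta=\delta(\varepsilon)>0$ such that the following holds for all constants $c_1,c_2\in[0,1]$. Suppose that ST-Max-Flow on uncapacitated directed graphs with $n\ge 1$ nodes, $|S|=\tilde\Theta(n^{c_1})$, $|T|=\tilde\Theta(n^{c_2})$ and $|E|=O((|S|+|T|)n)$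 edges can be solved in time $O((|S||T|n)^{1-\varepsilon})$ (for every choice of the constants hidden in these restrictions on $|S|$, $|T|$ and $|E|$ there is such an algorithm). Then MAX-CNF-SAT on $n'$ variables and $O(n')$ clauses can be solved in time $O(2^{(1-\delta)n'})$ (for every choice of the constant in the bound on the number of clauses, with the same $\delta$), and in particular SETH is false. -/

import Mathlib

namespace FlowHardness

/-! ### The machine model: a unit-cost RAM with words of logarithmic length -/

/-- A configuration of the machine: registers and a random-access memory. -/
structure State where
  reg : ℕ → ℕ
  mem : ℕ → ℕ

/-- `r_i := v` -/
def State.setReg (s : State) (i v : ℕ) : State :=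
  { s with reg := Function.update s.reg i v }

/-- `M[a] := v` -/
def State.setMem (s : State) (a v : ℕ) : State :=
  { s with mem := Function.update s.mem a v }

/-- Binary word operations. -/
inductive Op
  | add | sub | mul | div | mod | and | or | xor | shl | shr

/-- The value of a word operation (`sub` is truncated; `div` by zero gives zero). -/
def Op.eval : Op → ℕ → ℕ → ℕ
  | .add, x, y => x + y
  | .sub, x, y => x - y
  | .mul, x, y => x * y
  | .div, x, y => x / y
  | .mod, x, y => x % y
  | .and, x, y => x &&& y
  | .or, x, y => x ||| y
  | .xor, x, y => x ^^^ y
  | .shl, x, y => x <<< y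
  | .shr, x, y => x >>> y

/-- RAM programs, in structured form (branching and loops instead of jumps, which changes
running times by at most a constant factor). A program is a fixed finite object, so it
mentions only finitely many registers. -/
inductive Prog
  /-- `r_i := c` -/
  | const (i c : ℕ)
  /-- `r_i := r_j o r_k` -/
  | op (o : Op) (i j k : ℕ)
  /-- `r_i := M[r_j]` -/
  | load (i j : ℕ)
  /-- `M[r_i] := r_j` -/
  | store (i j : ℕ)
  /-- first `p`, then `q` -/
  | seq (p q : Prog)
  /-- if `r_i ≠ 0` then `p` else `q` -/
  | cond (i : ℕ) (p q : Prog)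
  /-- while `r_i ≠ 0` do `p` -/
  | loop (i : ℕ) (p : Prog)

/-- `Exec B p s t k`: on a machine whose words hold the numbers `0, …, B`, the program `p`
started in configuration `s` halts in configuration `t` after exactly `k` steps, and no
value computed or loaded on the way exceeds `B`. Every instruction and every test costs one
step. -/
inductive Exec (B : ℕ) : Prog → State → State → ℕ → Prop
  | const (i c : ℕ) (s : State) (h : c ≤ B) :
      Exec B (.const i c) s (s.setReg i c) 1
  | op (o : Op) (i j k : ℕ) (s : State) (h : o.eval (s.reg j) (s.reg k) ≤ B) :
      Exec B (.op o i j k) s (s.setReg i (o.eval (s.reg j) (s.reg k))) 1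
  | load (i j : ℕ) (s : State) (h : s.mem (s.reg j) ≤ B) :
      Exec B (.load i j) s (s.setReg i (s.mem (s.reg j))) 1
  | store (i j : ℕ) (s : State) :
      Exec B (.store i j) s (s.setMem (s.reg i) (s.reg j)) 1
  | seq {p q : Prog} {s t u : State} {a b : ℕ} (hp : Exec B p s t a) (hq : Exec B q t u b) :
      Exec B (.seq p q) s u (a + b)
  | cond_true {i : ℕ} {p q : Prog} {s t : State} {a : ℕ} (h : s.reg i ≠ 0)
      (hp : Exec B p s t a) : Exec B (.cond i p q) s t (a + 1)
  | cond_false {i : ℕ} {p q : Prog} {s t : State} {a : ℕ} (h : s.reg i = 0)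
      (hq : Exec B q s t a) : Exec B (.cond i p q) s t (a + 1)
  | loop_done {i : ℕ} {p : Prog} {s : State} (h : s.reg i = 0) :
      Exec B (.loop i p) s s 1
  | loop_step {i : ℕ} {p : Prog} {s t u : State} {a b : ℕ} (h : s.reg i ≠ 0)
      (hp : Exec B p s t a) (hl : Exec B (.loop i p) t u b) :
      Exec B (.loop i p) s u (a + b + 1)

/-- The initial configuration: the input stands at the beginning of the memory; everything
else is zero. -/
def initState (l : List ℕ) : State where
  reg := fun _ => 0
  mem := fun a => l.getD a 0

/-- A computational problem: instances, their encoding as a sequence of words, a size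
parameter, and the final configurations that carry a correct answer. -/
structure Problem where
  Inst : Type
  input : Inst → List ℕ
  size : Inst → ℕ
  Correct : Inst → State → Prop

/-- The problem `P`, on the instances in `dom`, can be solved in (deterministic, worst-case)
time `O(T)` on the RAM with words of `O(log (size + T))` bits: one program and one constant
serve all instances. -/
def Problem.SolvableInTime (P : Problem) (dom : P.Inst → Prop) (T : P.Inst → ℝ) : Prop :=
  ∃ (p : Prog) (K : ℕ), ∀ x : P.Inst, dom x →
    ∃ (B k : ℕ) (t : State), (B : ℝ) ≤ K * ((P.size x : ℝ) + T x) ^ K ∧ (k : ℝ) ≤ K * T x ∧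
      Exec B p (initState (P.input x)) t k ∧ P.Correct x t

/-! ### Maximum flow between all pairs of sources and sinks, unit capacities -/

/-- An instance: an uncapacitated directed graph on the nodes `0, …, n - 1`, given by the list
of its edges, with a set of sources and a set of sinks, given as lists. -/
structure STInst where
  n : ℕ
  edges : List (Fin n × Fin n)
  sources : List (Fin n)
  sinks : List (Fin n)
  edges_nodup : edges.Nodup
  sources_nodup : sources.Nodup
  sinks_nodup : sinks.Nodup

/-- `f` is a feasible flow from `s` to `t` when every edge has capacity one. -/
structure STInst.IsFlow (G : STInst) (s t : Fin G.n) (f : Fin G.n → Fin G.n → ℝ) : Prop where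
  nonneg : ∀ u v, 0 ≤ f u v
  le_one : ∀ u v, f u v ≤ 1
  support : ∀ u v, (u, v) ∉ G.edges → f u v = 0
  conservation : ∀ v, v ≠ s → v ≠ t → ∑ u, f u v = ∑ u, f v u

/-- The amount of flow shipped out of `s`. -/
def STInst.flowValue (G : STInst) (s : Fin G.n) (f : Fin G.n → Fin G.n → ℝ) : ℝ :=
  ∑ v, f s v - ∑ v, f v s

/-- `x` is the maximum amount of flow that can be shipped from `s` to `t`. -/
def STInst.IsMaxFlowValue (G : STInst) (s t : Fin G.n) (x : ℝ) : Prop :=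
  IsGreatest {y : ℝ | ∃ f, G.IsFlow s t f ∧ y = G.flowValue s f} x

/-- ST-Max-Flow. The input is `n, |E|, |S|, |T|`, then `S`, then `T`, then the edges. The
answer is a table of `|S|` rows and `|T|` columns that starts at the address in register `0`;
the entry for a source `s` and a sink `t ≠ s` is the maximum `st`-flow value (entries with
`s = t` are meaningless and not looked at). -/
def STMaxFlow : Problem where
  Inst := STInst
  input := fun G =>
    [G.n, G.edges.length, G.sources.length, G.sinks.length]
      ++ G.sources.map (fun v => v.val) ++ G.sinks.map (fun v => v.val)
      ++ G.edges.flatMap (fun e => [e.1.val, e.2.val])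
  size := fun G => G.n + G.edges.length
  Correct := fun G st =>
    ∀ (i : Fin G.sources.length) (j : Fin G.sinks.length),
      G.sources.get i ≠ G.sinks.get j →
        G.IsMaxFlowValue (G.sources.get i) (G.sinks.get j)
          (st.mem (st.reg 0 + i.val * G.sinks.length + j.val) : ℝ)

/-- `x` equals `f` up to a factor `A * (log f) ^ d`; for constants `A, d` this is
`x = Θ̃(f)`. (The `1 +` keeps the factor positive when `f = 1`.) -/
def WithinPolylog (A d : ℕ) (f x : ℝ) : Prop :=
  f ≤ A * (1 + Real.log f) ^ d * x ∧ x ≤ A * (1 + Real.log f) ^ d * f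

/-- ST-Max-Flow on uncapacitated graphs with `n` nodes, `|S| = Θ̃(n ^ c₁)`, `|T| = Θ̃(n ^ c₂)`
and `O((|S| + |T|) n)` edges can be solved in time `O((|S| |T| n) ^ (1 - ε))`, whatever the
constants hidden in the restrictions on the instances are. -/
def STMaxFlowFast (ε c₁ c₂ : ℝ) : Prop :=
  ∀ A d : ℕ, STMaxFlow.SolvableInTime
    (fun G : STInst => 1 ≤ G.n ∧
      WithinPolylog A d ((G.n : ℝ) ^ c₁) (G.sources.length : ℝ) ∧
      WithinPolylog A d ((G.n : ℝ) ^ c₂) (G.sinks.length : ℝ) ∧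
      G.edges.length ≤ A * ((G.sources.length + G.sinks.length) * G.n))
    (fun G : STInst =>
      ((G.sources.length : ℝ) * (G.sinks.length : ℝ) * (G.n : ℝ)) ^ (1 - ε))

/-! ### Satisfiability problems -/

/-- A CNF formula on the variables `0, …, numVars - 1`: a list of clauses. A clause is a set
of literals, given as a list without repetitions; the literal `(v, b)` is true under an
assignment `a` if `a v = b`. -/
structure CNF where
  numVars : ℕ
  clauses : List (List (Fin numVars × Bool))
  clauses_nodup : ∀ c ∈ clauses, c.Nodup

/-- Does the assignment satisfy the clause? -/
def satisfies {n : ℕ} (a : Fin n → Bool) (c : List (Fin n × Bool)) : Bool :=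
  c.any fun l => a l.1 == l.2

/-- The number of clauses that an assignment satisfies. -/
def CNF.numSat (F : CNF) (a : Fin F.numVars → Bool) : ℕ :=
  F.clauses.countP (satisfies a)

/-- The input word sequence of a formula: the number of variables, the number of clauses, then
every clause as the number of its literals followed by their codes (`2 v + 1` for the variable
`v`, `2 v` for its negation). -/
def CNF.encode (F : CNF) : List ℕ :=
  [F.numVars, F.clauses.length]
    ++ F.clauses.flatMap (fun c => c.length :: c.map (fun l => 2 * l.1.val + l.2.toNat))

/-- MAX-CNF-SAT: compute the maximum number of clauses that can be satisfied. -/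
def MaxCNFSAT : Problem where
  Inst := CNF
  input := CNF.encode
  size := fun F => F.numVars + F.clauses.length
  Correct := fun F st => IsGreatest (Set.range F.numSat) (st.reg 0)

/-- CNF-SAT: decide whether all clauses can be satisfied at once. -/
def CNFSAT : Problem where
  Inst := CNF
  input := CNF.encode
  size := fun F => F.numVars + F.clauses.length
  Correct := fun F st =>
    st.reg 0 ≠ 0 ↔ ∃ a : Fin F.numVars → Bool, ∀ c ∈ F.clauses, satisfies a c = true

/-- MAX-CNF-SAT on `n` variables and `O(n)` clauses can be solved in time
`O(2 ^ ((1 - δ) n))`, whatever the constant in the bound on the number of clauses is. -/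
def MaxCNFSATFast (δ : ℝ) : Prop :=
  ∀ A : ℕ, MaxCNFSAT.SolvableInTime
    (fun F : CNF => F.clauses.length ≤ A * F.numVars)
    (fun F : CNF => (2 : ℝ) ^ ((1 - δ) * (F.numVars : ℝ)))

/-- The Strong Exponential Time Hypothesis: for every `ε > 0` there is a `k ≥ 3` such that
`k`-SAT on `n` variables and `m` clauses cannot be solved in time
`2 ^ ((1 - ε) n) * poly(m)`. -/
def SETH : Prop :=
  ∀ ε : ℝ, 0 < ε → ∃ k : ℕ, 3 ≤ k ∧ ∀ e : ℕ, ¬ CNFSAT.SolvableInTime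
    (fun F : CNF => ∀ c ∈ F.clauses, c.length ≤ k)
    (fun F : CNF =>
      (2 : ℝ) ^ ((1 - ε) * (F.numVars : ℝ)) * ((F.clauses.length : ℝ) + 1) ^ e)

end FlowHardness

/-! The reduction splits the variables of a formula into `a` source variables, `b` sink variables
and the remaining middle variables. Sources are the `2 ^ a` partial assignments `α`, sinks the `2 ^
b` partial assignments `β`. A middle assignment `γ` and a clause `i` form a slot `x = γ * m + i`.
Every source sends one edge to each slot, so at most `X` units (the number of slots) can leave it.
The edge ends in one of two copies of the slot node, depending on whether `α` and `γ` falsify the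
source and middle literals of the clause. From the falsified copy there is a direct edge to each
sink `β` that falsifies the clause as well. Both copies also lead to a hub of the block `γ`, and the
hub has `m - (thr + 1)` useful outlets, from which every sink can be reached. In block `γ` all `m`
units get through if and only if at least `thr + 1` of them can take direct edges. Hence the maximum
flow from `α` to `β` is less than `X` exactly when for some `γ` the assignment `(α, β, γ)` leaves at
most `thr` clauses unsatisfied (`Ctx.maxFlow_lt_iff`: a cut in one direction, an explicit flow in
the other).

With `N = 2 ^ (H - (a + b))` and `8 N` nodes the product `|S| |T| n` is `2 ^ (H + 3)` for every
split, where `H = n + O(log m)`. So the assumed algorithm takes about `2 ^ ((1 - ε) n)` steps, up to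
factors polynomial in `m`. Writing the instance down may cost more than this: it has `X (|S| + 2 |T|
+ 3)` edges. The flow program is therefore simulated on a virtual memory. An input word is computed
when it is first read, in time linear in the formula (`fetch_spec`), and words that were written
carry the number of the current call as a stamp, so nothing has to be erased between calls
(`sim_spec`). Dummy nodes make the edge list a full rectangle of rows and slots, so that an edge can
be found from its index.

The constants `c₁` and `c₂` need not be computable, hence the program tries all pairs `(a, b)`. For
a wrong pair nothing is known about the simulated program; a clock and a bound on values force it to
stop. Its answers are never trusted: they only guide a bit-by-bit search for an assignment, whose
satisfied clauses are then counted. The result is thus never too large, and the pair that fits `c₁`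
and `c₂` (`exists_split`, `exists_valid_allAnswered`) makes it optimal.

With `q ≥ 3` and `1 / q ≤ ε` the total time is `2 ^ ((1 - 1 / q) n)` times a polynomial in `n` and
`m` (`exists_maxSat_prog`). Taking `δ = 1 / (2 q)` spends half of the saving on the polynomial in
`n`. Since the bound holds for any number of clauses, comparing the optimum with `m` also decides
CNF-SAT for clauses of every width, and SETH fails. -/

namespace FlowHardness

/-! ### Structured programs with expressions

A program variable `x` lives in register `2 x`; odd registers hold intermediate values. -/

/-- The variables and the memory of a configuration. -/
def view (σ : State) : State := ⟨fun i => σ.reg (2 * i), σ.mem⟩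

/-- All variables and memory words are at most `V`. -/
structure Bounded (V : ℕ) (s : State) : Prop where
  eight_le : 8 ≤ V
  reg : ∀ x, s.reg x ≤ V
  mem : ∀ a, s.mem a ≤ V

/-- Arithmetic expressions over variables and memory. -/
inductive Exp
  | const (c : ℕ)
  | var (x : ℕ)
  | bin (o : Op) (e f : Exp)
  | load (e : Exp)

namespace Exp

instance : Add Exp := ⟨bin .add⟩
instance : Sub Exp := ⟨bin .sub⟩
instance : Mul Exp := ⟨bin .mul⟩
instance : Div Exp := ⟨bin .div⟩
instance : Mod Exp := ⟨bin .mod⟩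
instance (n : ℕ) : OfNat Exp n := ⟨const n⟩

/-- The value of an expression. -/
def eval (s : State) : Exp → ℕ
  | const c => c
  | var x => s.reg x
  | bin o e f => o.eval (e.eval s) (f.eval s)
  | load e => s.mem (e.eval s)

/-- The number of leaves. -/
def leaves : Exp → ℕ
  | const _ => 1
  | var _ => 1
  | bin _ e f => e.leaves + f.leaves
  | load e => e.leaves

/-- The number of nodes. -/
def size : Exp → ℕ
  | const _ => 1
  | var _ => 1
  | bin _ e f => e.size + f.size + 1
  | load e => e.size + 1

/-- No left shifts, and small constants. -/
def tame : Exp → Bool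
  | const c => decide (c ≤ 8)
  | var _ => true
  | bin .shl _ _ => false
  | bin _ e f => e.tame && f.tame
  | load e => e.tame

/-- The program that puts the value of an expression into register `2 d + 1`. -/
def code : Exp → ℕ → Prog
  | const c, d => .const (2 * d + 1) c
  | var x, d => .op .and (2 * d + 1) (2 * x) (2 * x)
  | bin o e f, d => .seq (e.code d) (.seq (f.code (d + 1)) (.op o (2 * d + 1) (2 * d + 1) (2 * d + 3)))
  | load e, d => .seq (e.code d) (.load (2 * d + 1) (2 * d + 1))

variable (s : State) (e f : Exp)

@[simp] theorem eval_const (c : ℕ) : (const c).eval s = c := rfl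
@[simp] theorem eval_ofNat (c : ℕ) : (ofNat(c) : Exp).eval s = c := rfl
@[simp] theorem eval_zero : (0 : Exp).eval s = 0 := rfl
@[simp] theorem eval_one : (1 : Exp).eval s = 1 := rfl
@[simp] theorem eval_var (x : ℕ) : (var x).eval s = s.reg x := rfl
@[simp] theorem eval_add : (e + f).eval s = e.eval s + f.eval s := rfl
@[simp] theorem eval_sub : (e - f).eval s = e.eval s - f.eval s := rfl
@[simp] theorem eval_mul : (e * f).eval s = e.eval s * f.eval s := rfl
@[simp] theorem eval_div : (e / f).eval s = e.eval s / f.eval s := rfl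
@[simp] theorem eval_mod : (e % f).eval s = e.eval s % f.eval s := rfl
@[simp] theorem eval_shr : (bin .shr e f).eval s = e.eval s >>> f.eval s := rfl
@[simp] theorem eval_xor : (bin .xor e f).eval s = e.eval s ^^^ f.eval s := rfl
@[simp] theorem eval_load : (load e).eval s = s.mem (e.eval s) := rfl

theorem one_le_leaves : 1 ≤ e.leaves := by
  induction e with
  | const | var => exact le_rfl
  | bin o e f he hf => exact le_add_right he
  | load e he => exact he

theorem or_le_add (x y : ℕ) : x ||| y ≤ x + y := by
  induction x using Nat.strong_induction_on generalizing y with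
  | _ x ih =>
    rcases Nat.eq_zero_or_pos x with rfl | hx
    · simp
    · have h1 := ih (x / 2) (by omega) (y / 2)
      have h2 : (x ||| y) / 2 = x / 2 ||| y / 2 := Nat.or_div_two
      have h3 : (x ||| y) % 2 = 1 ↔ x % 2 = 1 ∨ y % 2 = 1 := Nat.or_mod_two_eq_one
      omega

theorem xor_le_add (x y : ℕ) : x ^^^ y ≤ x + y := by
  induction x using Nat.strong_induction_on generalizing y with
  | _ x ih =>
    rcases Nat.eq_zero_or_pos x with rfl | hx
    · simp
    · have h1 := ih (x / 2) (by omega) (y / 2)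
      have h2 : (x ^^^ y) / 2 = x / 2 ^^^ y / 2 := Nat.xor_div_two
      have h3 : (x ^^^ y) % 2 = (x + y) % 2 := Nat.xor_mod_two_eq
      omega

/-- A sum is at most the product once both bounds are at least two, and every operation except the
left shift is bounded by the sum or the product. Bounds on subexpressions therefore multiply, which
gives `V ^ leaves` for a whole expression. -/
theorem Op_eval_le {o : Op} (ho : o ≠ .shl) {x y X Y : ℕ} (hx : x ≤ X) (hy : y ≤ Y) (hX : 2 ≤ X)
    (hY : 2 ≤ Y) : o.eval x y ≤ X * Y := by
  have hXY : x + y ≤ X * Y := by nlinarith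
  cases o with
  | add => exact hXY
  | sub => exact (Nat.sub_le _ _).trans ((Nat.le_add_right _ _).trans hXY)
  | mul => exact Nat.mul_le_mul hx hy
  | div => exact (Nat.div_le_self _ _).trans ((Nat.le_add_right _ _).trans hXY)
  | mod => exact (Nat.mod_le _ _).trans ((Nat.le_add_right _ _).trans hXY)
  | and => exact Nat.and_le_left.trans ((Nat.le_add_right _ _).trans hXY)
  | or => exact (or_le_add x y).trans hXY
  | xor => exact (xor_le_add x y).trans hXY
  | shl => exact absurd rfl ho
  | shr => exact (Nat.shiftRight_le _ _).trans ((Nat.le_add_right _ _).trans hXY)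

variable {s e f}

theorem two_le_pow_leaves {V : ℕ} (hV : 8 ≤ V) (e : Exp) : 2 ≤ V ^ e.leaves :=
  le_trans (by omega) (Nat.le_self_pow (by have := e.one_le_leaves; omega) V)

theorem eval_le {V : ℕ} (hs : Bounded V s) (he : e.tame = true) : e.eval s ≤ V ^ e.leaves := by
  induction e with
  | const c =>
    have : c ≤ 8 := by simpa [tame] using he
    simpa [leaves] using this.trans hs.eight_le
  | var x => simpa [leaves] using hs.reg x
  | bin o e f ihe ihf =>
    have ho : o ≠ .shl := by rintro rfl; simp [tame] at he
    have hef : e.tame = true ∧ f.tame = true := by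
      cases o <;> simp_all [tame]
    rw [leaves, pow_add]
    exact Op_eval_le ho (ihe hef.1) (ihf hef.2) (two_le_pow_leaves hs.eight_le _)
      (two_le_pow_leaves hs.eight_le _)
  | load e ih =>
    exact (hs.mem _).trans (Nat.le_self_pow (by have := e.one_le_leaves; simp [leaves]; omega) V)

end Exp

/-- The word bound that goes with the bound `V` on variables. -/
def wordBound (V : ℕ) : ℕ := V ^ 32

theorem le_wordBound (V : ℕ) : V ≤ wordBound V := Nat.le_self_pow (by norm_num) V

/-- Evaluation at depth `d` writes only to odd registers `2 j + 1` with `j ≥ d`. Variables live in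
even registers and pending operands at smaller depths, so both survive. -/
theorem Exp.code_exec {V : ℕ} {e : Exp} (he : e.tame = true) (hl : e.leaves ≤ 32) (d : ℕ) (σ : State)
    (hs : Bounded V (view σ)) :
    ∃ σ', Exec (wordBound V) (e.code d) σ σ' e.size ∧ σ'.reg (2 * d + 1) = e.eval (view σ) ∧
      view σ' = view σ ∧ ∀ j < d, σ'.reg (2 * j + 1) = σ.reg (2 * j + 1) := by
  have hpow : ∀ e : Exp, e.tame = true → e.leaves ≤ 32 → e.eval (view σ) ≤ wordBound V :=
    fun e he hl => (Exp.eval_le hs he).trans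
      (Nat.pow_le_pow_right (by have := hs.eight_le; omega) hl)
  have hview : ∀ (σ : State) (v : ℕ), view (σ.setReg (2 * d + 1) v) = view σ := by
    intro σ v
    simp only [view, State.setReg]
    congr 1
    funext i
    rw [Function.update_of_ne (by omega)]
  have hpres : ∀ (σ : State) (v : ℕ), ∀ j < d,
      (σ.setReg (2 * d + 1) v).reg (2 * j + 1) = σ.reg (2 * j + 1) := by
    intro σ v j hj
    simp only [State.setReg]
    rw [Function.update_of_ne (by omega)]
  induction e generalizing d σ with
  | const c => exact ⟨_, .const _ _ _ (hpow (.const c) he hl), by simp [State.setReg], hview _ _, hpres _ _⟩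
  | var x =>
    refine ⟨_, .op _ _ _ _ _ ?_, ?_, hview _ _, hpres _ _⟩
    · simpa [Op.eval, view] using hpow (.var x) he hl
    · simp [State.setReg, Op.eval, view]
  | bin o e f ihe ihf =>
    have hef : e.tame = true ∧ f.tame = true := by
      cases o <;> simp_all [tame]
    have hl' : e.leaves + f.leaves ≤ 32 := hl
    obtain ⟨σ₁, h₁, hv₁, hw₁, hp₁⟩ := ihe hef.1 (by omega) d σ hs hpow hview hpres
    obtain ⟨σ₂, h₂, hv₂, hw₂, hp₂⟩ := ihf hef.2 (by omega) (d + 1) σ₁ (by rwa [hw₁])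
      (by rwa [hw₁]) (by
        intro σ v
        simp only [view, State.setReg]
        congr 1
        funext i
        rw [Function.update_of_ne (by omega)]) (by
        intro σ v j hj
        simp only [State.setReg]
        rw [Function.update_of_ne (by omega)])
    -- The left operand waits in register `2 d + 1` while the right one is computed at depth `d +
    -- 1`.
    have hval : o.eval (σ₂.reg (2 * d + 1)) (σ₂.reg (2 * d + 3)) = (bin o e f).eval (view σ) := by
      rw [hp₂ d (by omega), hv₁, show 2 * d + 3 = 2 * (d + 1) + 1 by ring, hv₂, hw₁]
      rfl
    refine ⟨σ₂.setReg (2 * d + 1) (o.eval (σ₂.reg (2 * d + 1)) (σ₂.reg (2 * d + 3))), ?_, ?_, ?_, ?_⟩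
    · rw [size, add_assoc]
      refine .seq h₁ (.seq h₂ (.op _ _ _ _ _ ?_))
      rw [hval]; exact hpow _ he hl
    · simp [State.setReg, hval]
    · rw [hview, hw₂, hw₁]
    · intro j hj
      rw [hpres _ _ j hj, hp₂ j (by omega), hp₁ j hj]
  | load e ih =>
    obtain ⟨σ₁, h₁, hv₁, hw₁, hp₁⟩ := ih he hl d σ hs hpow hview hpres
    have hmem : σ₁.mem = (view σ).mem := by rw [← hw₁]; rfl
    refine ⟨_, .seq h₁ (.load _ _ _ ?_), ?_, ?_, ?_⟩
    · rw [hv₁, hmem]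
      exact (hs.mem _).trans (le_wordBound V)
    · simp [State.setReg, hv₁, hmem]
    · rw [hview, hw₁]
    · intro j hj
      rw [hpres _ _ j hj, hp₁ j hj]

/-! ### Derived program constructs, and the variables and memory that they can change. -/

namespace Prog

/-- `x := e` -/
def assign (x : ℕ) (e : Exp) : Prog := .seq (e.code 0) (.op .and (2 * x) 1 1)

/-- `x := y o z` for variables `x, y, z` -/
def assignOp (o : Op) (x y z : ℕ) : Prog := .op o (2 * x) (2 * y) (2 * z)

/-- `M[e] := f` -/
def storeExp (e f : Exp) : Prog := .seq (e.code 0) (.seq (f.code 1) (.store 1 3))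

/-- if `e ≠ 0` then `p` else `q` -/
def ite (e : Exp) (p q : Prog) : Prog := .seq (e.code 0) (.cond 1 p q)

/-- while `e ≠ 0` do `p` -/
def whileDo (e : Exp) (p : Prog) : Prog := .seq (e.code 0) (.loop 1 (.seq p (e.code 0)))

/-- do nothing -/
def skip : Prog := .const 1 0

/-- for `i = 0, …, n - 1` do `p` -/
def forDo (i : ℕ) (n : ℕ) (p : Prog) : Prog :=
  .seq (assign i 0) (whileDo (Exp.var n - Exp.var i) (.seq p (assign i (Exp.var i + 1))))

/-- Every variable that the program writes satisfies `A`. -/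
def Touches (A : ℕ → Prop) : Prog → Prop
  | const i _ => i % 2 = 1 ∨ A (i / 2)
  | op _ i _ _ => i % 2 = 1 ∨ A (i / 2)
  | load i _ => i % 2 = 1 ∨ A (i / 2)
  | store _ _ => True
  | seq p q => p.Touches A ∧ q.Touches A
  | cond _ p q => p.Touches A ∧ q.Touches A
  | loop _ p => p.Touches A

/-- The program does not write to memory. -/
def ReadOnly : Prog → Prop
  | const _ _ => True
  | op _ _ _ _ => True
  | load _ _ => True
  | store _ _ => False
  | seq p q => p.ReadOnly ∧ q.ReadOnly
  | cond _ p q => p.ReadOnly ∧ q.ReadOnly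
  | loop _ p => p.ReadOnly

section
variable (A : ℕ → Prop)

theorem touches_code (e : Exp) (d : ℕ) : (e.code d).Touches A := by
  induction e generalizing d with
  | const | var => left; omega
  | bin o e f he hf => exact ⟨he d, hf _, .inl (by omega)⟩
  | load e he => exact ⟨he d, .inl (by omega)⟩

theorem readOnly_code (e : Exp) (d : ℕ) : (e.code d).ReadOnly := by
  induction e generalizing d with
  | const | var => trivial
  | bin o e f he hf => exact ⟨he d, hf _, trivial⟩
  | load e he => exact ⟨he d, trivial⟩

@[simp] theorem touches_assign {x : ℕ} {e : Exp} : (assign x e).Touches A ↔ A x := by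
  simp [assign, Touches, touches_code]

@[simp] theorem touches_assignOp {o : Op} {x y z : ℕ} : (assignOp o x y z).Touches A ↔ A x := by
  simp [assignOp, Touches]

@[simp] theorem touches_storeExp {e f : Exp} : (storeExp e f).Touches A := by
  simp [storeExp, Touches, touches_code]

@[simp] theorem touches_skip : skip.Touches A := .inl rfl

@[simp] theorem touches_seq {p q : Prog} : (seq p q).Touches A ↔ p.Touches A ∧ q.Touches A := Iff.rfl

@[simp] theorem touches_ite {e : Exp} {p q : Prog} :
    (ite e p q).Touches A ↔ p.Touches A ∧ q.Touches A := by
  simp [ite, Touches, touches_code]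

@[simp] theorem touches_whileDo {e : Exp} {p : Prog} : (whileDo e p).Touches A ↔ p.Touches A := by
  simp [whileDo, Touches, touches_code]

@[simp] theorem touches_forDo {i n : ℕ} {p : Prog} : (forDo i n p).Touches A ↔ A i ∧ p.Touches A := by
  simp only [forDo, touches_seq, touches_assign, touches_whileDo]; tauto

theorem Touches.mono {A A' : ℕ → Prop} (h : ∀ x, A x → A' x) {p : Prog} (hp : p.Touches A) :
    p.Touches A' := by
  induction p with
  | const | op | load => exact hp.imp_right (h _)
  | store => trivial
  | seq p q ihp ihq => exact ⟨ihp hp.1, ihq hp.2⟩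
  | cond i p q ihp ihq => exact ⟨ihp hp.1, ihq hp.2⟩
  | loop i p ih => exact ih hp

@[simp] theorem readOnly_assign {x : ℕ} {e : Exp} : (assign x e).ReadOnly := by
  simp [assign, ReadOnly, readOnly_code]

@[simp] theorem readOnly_assignOp {o : Op} {x y z : ℕ} : (assignOp o x y z).ReadOnly := trivial

@[simp] theorem readOnly_skip : skip.ReadOnly := trivial

@[simp] theorem readOnly_seq {p q : Prog} : (seq p q).ReadOnly ↔ p.ReadOnly ∧ q.ReadOnly := Iff.rfl

@[simp] theorem readOnly_ite {e : Exp} {p q : Prog} :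
    (ite e p q).ReadOnly ↔ p.ReadOnly ∧ q.ReadOnly := by
  simp [ite, ReadOnly, readOnly_code]

@[simp] theorem readOnly_whileDo {e : Exp} {p : Prog} : (whileDo e p).ReadOnly ↔ p.ReadOnly := by
  simp [whileDo, ReadOnly, readOnly_code]

@[simp] theorem readOnly_forDo {i n : ℕ} {p : Prog} : (forDo i n p).ReadOnly ↔ p.ReadOnly := by
  simp [forDo]

end

end Prog

theorem Exec.reg_eq {B : ℕ} {p : Prog} {A : ℕ → Prop} {s t : State} {k : ℕ} (h : Exec B p s t k)
    (hp : p.Touches A) {x : ℕ} (hx : ¬ A x) : t.reg (2 * x) = s.reg (2 * x) := by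
  have key : ∀ (s : State) (i v : ℕ), (i % 2 = 1 ∨ A (i / 2)) →
      (s.setReg i v).reg (2 * x) = s.reg (2 * x) := by
    intro s i v hi
    refine Function.update_of_ne ?_ _ _
    rintro rfl
    rcases hi with hi | hi
    · omega
    · exact hx (by simpa using hi)
  induction h with
  | const | op | load => exact key _ _ _ hp
  | store => rfl
  | seq _ _ ih₁ ih₂ => exact (ih₂ hp.2).trans (ih₁ hp.1)
  | cond_true _ _ ih => exact ih hp.1
  | cond_false _ _ ih => exact ih hp.2
  | loop_done => rfl
  | loop_step _ _ _ ih₁ ih₂ => exact (ih₂ hp).trans (ih₁ hp)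

theorem Exec.mem_eq {B : ℕ} {p : Prog} {s t : State} {k : ℕ} (h : Exec B p s t k)
    (hp : p.ReadOnly) : t.mem = s.mem := by
  induction h with
  | const | op | load => rfl
  | store => exact hp.elim
  | seq _ _ ih₁ ih₂ => exact (ih₂ hp.2).trans (ih₁ hp.1)
  | cond_true _ _ ih => exact ih hp.1
  | cond_false _ _ ih => exact ih hp.2
  | loop_done => rfl
  | loop_step _ _ _ ih₁ ih₂ => exact (ih₂ hp).trans (ih₁ hp)

theorem Exec.mono {B B' : ℕ} (hB : B ≤ B') {p : Prog} {s t : State} {k : ℕ} (h : Exec B p s t k) :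
    Exec B' p s t k := by
  induction h with
  | const i c s h => exact .const i c s (h.trans hB)
  | op o i j k s h => exact .op o i j k s (h.trans hB)
  | load i j s h => exact .load i j s (h.trans hB)
  | store i j s => exact .store i j s
  | seq _ _ ih₁ ih₂ => exact .seq ih₁ ih₂
  | cond_true h _ ih => exact .cond_true h ih
  | cond_false h _ ih => exact .cond_false h ih
  | loop_done h => exact .loop_done h
  | loop_step h _ _ ih₁ ih₂ => exact .loop_step h ih₁ ih₂

/-! ### Total correctness with running times -/

/-- In terms of variables and memory, `p` leads from `s` to `t` in at most `k` steps. -/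
def Runs (V : ℕ) (p : Prog) (s t : State) (k : ℕ) : Prop :=
  ∀ σ, view σ = s → ∃ σ' k', k' ≤ k ∧ view σ' = t ∧ Exec (wordBound V) p σ σ' k'

/-- Started in the bounded state `s`, the program `p` reaches within `T` steps a bounded state in
which `Q` holds. -/
def Triple (V : ℕ) (p : Prog) (s : State) (T : ℕ) (Q : State → Prop) : Prop :=
  Bounded V s → ∃ t, Runs V p s t T ∧ Bounded V t ∧ Q t

theorem exists_view_eq (s : State) : ∃ σ, view σ = s :=
  ⟨⟨fun i => s.reg (i / 2), s.mem⟩, by simp [view]⟩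

theorem Bounded.setReg {V : ℕ} {s : State} (hs : Bounded V s) {x v : ℕ} (hv : v ≤ V) :
    Bounded V (s.setReg x v) := by
  refine ⟨hs.eight_le, fun y => ?_, hs.mem⟩
  simp only [State.setReg, Function.update_apply]
  split_ifs
  exacts [hv, hs.reg y]

theorem Bounded.setMem {V : ℕ} {s : State} (hs : Bounded V s) {x v : ℕ} (hv : v ≤ V) :
    Bounded V (s.setMem x v) := by
  refine ⟨hs.eight_le, hs.reg, fun y => ?_⟩
  simp only [State.setMem, Function.update_apply]
  split_ifs
  exacts [hv, hs.mem y]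

theorem view_setReg (σ : State) (x v : ℕ) : view (σ.setReg (2 * x) v) = (view σ).setReg x v := by
  simp only [view, State.setReg]
  congr 1
  funext i
  simp [Function.update_apply]

theorem view_setReg_odd (σ : State) {x : ℕ} (hx : x % 2 = 1) (v : ℕ) :
    view (σ.setReg x v) = view σ := by
  simp only [view, State.setReg]
  congr 1
  funext i
  rw [Function.update_of_ne (by omega)]

theorem Runs.mono {V : ℕ} {p : Prog} {s t : State} {k k' : ℕ} (h : Runs V p s t k) (hk : k ≤ k') :
    Runs V p s t k' := fun σ hσ => by
  obtain ⟨σ', l, hl, h⟩ := h σ hσ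
  exact ⟨σ', l, hl.trans hk, h⟩

theorem Runs.seq {V : ℕ} {p q : Prog} {s t u : State} {k l : ℕ} (hp : Runs V p s t k)
    (hq : Runs V q t u l) : Runs V (.seq p q) s u (k + l) := fun σ hσ => by
  obtain ⟨σ₁, k', hk, hv, h₁⟩ := hp σ hσ
  obtain ⟨σ₂, l', hl, hw, h₂⟩ := hq σ₁ hv
  exact ⟨σ₂, _, Nat.add_le_add hk hl, hw, .seq h₁ h₂⟩

theorem Runs.reg_eq {V : ℕ} {p : Prog} {A : ℕ → Prop} {s t : State} {k : ℕ} (h : Runs V p s t k)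
    (hp : p.Touches A) {x : ℕ} (hx : ¬ A x) : t.reg x = s.reg x := by
  obtain ⟨σ, rfl⟩ := exists_view_eq s
  obtain ⟨σ', k', -, rfl, h'⟩ := h σ rfl
  exact Exec.reg_eq h' hp hx

theorem Runs.mem_eq {V : ℕ} {p : Prog} {s t : State} {k : ℕ} (h : Runs V p s t k)
    (hp : p.ReadOnly) : t.mem = s.mem := by
  obtain ⟨σ, rfl⟩ := exists_view_eq s
  obtain ⟨σ', k', -, rfl, h'⟩ := h σ rfl
  exact (Exec.mem_eq h' hp : _)

/-- The side conditions on the expressions in programs. -/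
def Exp.Ok (e : Exp) : Prop := (e.tame && Nat.ble e.leaves 32) = true

theorem Exp.Ok.exec {V : ℕ} {e : Exp} (he : e.Ok) (d : ℕ) (σ : State) (hs : Bounded V (view σ)) :
    ∃ σ', Exec (wordBound V) (e.code d) σ σ' e.size ∧ σ'.reg (2 * d + 1) = e.eval (view σ) ∧
      view σ' = view σ ∧ ∀ j < d, σ'.reg (2 * j + 1) = σ.reg (2 * j + 1) := by
  rw [Exp.Ok, Bool.and_eq_true] at he
  exact Exp.code_exec he.1 (Nat.le_of_ble_eq_true he.2) d σ hs

theorem Runs.ite_true {V : ℕ} {e : Exp} {p q : Prog} {s t : State} {k : ℕ} (hs : Bounded V s)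
    (he : e.Ok) (h : e.eval s ≠ 0) (hp : Runs V p s t k) :
    Runs V (.ite e p q) s t (e.size + (k + 1)) := fun σ hσ => by
  subst hσ
  obtain ⟨σ₁, h₁, hv, hw, -⟩ := he.exec 0 σ hs
  obtain ⟨σ₂, k', hk, ht, h₂⟩ := hp σ₁ hw
  exact ⟨σ₂, _, by omega, ht, .seq h₁ (.cond_true (by rwa [show (1 : ℕ) = 2 * 0 + 1 from rfl, hv]) h₂)⟩

theorem Runs.ite_false {V : ℕ} {e : Exp} {p q : Prog} {s t : State} {k : ℕ} (hs : Bounded V s)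
    (he : e.Ok) (h : e.eval s = 0) (hp : Runs V q s t k) :
    Runs V (.ite e p q) s t (e.size + (k + 1)) := fun σ hσ => by
  subst hσ
  obtain ⟨σ₁, h₁, hv, hw, -⟩ := he.exec 0 σ hs
  obtain ⟨σ₂, k', hk, ht, h₂⟩ := hp σ₁ hw
  exact ⟨σ₂, _, by omega, ht, .seq h₁ (.cond_false (by rwa [show (1 : ℕ) = 2 * 0 + 1 from rfl, hv]) h₂)⟩

theorem Runs.whileDo_done {V : ℕ} {e : Exp} {p : Prog} {s : State} (hs : Bounded V s)
    (he : e.Ok) (h : e.eval s = 0) : Runs V (.whileDo e p) s s (e.size + 1) := fun σ hσ => by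
  subst hσ
  obtain ⟨σ₁, h₁, hv, hw, -⟩ := he.exec 0 σ hs
  exact ⟨σ₁, _, le_rfl, hw, .seq h₁ (.loop_done (by rwa [show (1 : ℕ) = 2 * 0 + 1 from rfl, hv]))⟩

/-- The guard is compiled twice: before the loop and at the end of its body. A run of the whole loop
from `t` begins with the guard code, and this first piece becomes the end of the current iteration.
-/
theorem Runs.whileDo_step {V : ℕ} {e : Exp} {p : Prog} {s t u : State} {k l : ℕ} (hs : Bounded V s)
    (he : e.Ok) (h : e.eval s ≠ 0) (hp : Runs V p s t k) (hl : Runs V (.whileDo e p) t u l) :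
    Runs V (.whileDo e p) s u (e.size + 1 + k + l) := fun σ hσ => by
  subst hσ
  obtain ⟨σ₁, h₁, hv, hw, -⟩ := he.exec 0 σ hs
  obtain ⟨σ₂, k', hk, ht, h₂⟩ := hp σ₁ hw
  obtain ⟨σ₃, l', hl', ht', h₃⟩ := hl σ₂ ht
  cases h₃ with
  | seq hc hloop =>
    refine ⟨σ₃, _, ?_, ht', .seq h₁ (.loop_step (by rwa [show (1 : ℕ) = 2 * 0 + 1 from rfl, hv]) (.seq h₂ hc) hloop)⟩
    omega

namespace Triple

variable {V : ℕ} {p q : Prog} {s : State} {T T₁ T₂ : ℕ} {Q R : State → Prop} {x : ℕ} {e f : Exp}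

theorem mono (h : Triple V p s T₁ R) (hT : T₁ ≤ T₂) (hQ : ∀ t, R t → Q t) : Triple V p s T₂ Q :=
  fun hs => by
    obtain ⟨t, ht, hb, hR⟩ := h hs
    exact ⟨t, ht.mono hT, hb, hQ t hR⟩

theorem le_time (h : Triple V p s T₁ Q) (hT : T₁ ≤ T₂) : Triple V p s T₂ Q := h.mono hT fun _ => id

theorem seq (h : Triple V p s T₁ fun t => Triple V q t T₂ Q) : Triple V (.seq p q) s (T₁ + T₂) Q :=
  fun hs => by
    obtain ⟨t, ht, hb, h⟩ := h hs
    obtain ⟨u, hu, hb', h⟩ := h hb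
    exact ⟨u, ht.seq hu, hb', h⟩

/-- Passing the remaining time `T - T₁` to the continuation lets a long program be verified
instruction by instruction against one fixed total, without assembling a sum of costs. -/
theorem seq' (h : Triple V p s T₁ fun t => Triple V q t (T - T₁) Q) (hT : T₁ ≤ T) :
    Triple V (.seq p q) s T Q := (seq h).le_time (by omega)

theorem of_bounded (h : Bounded V s → Triple V p s T Q) : Triple V p s T Q := fun hs => h hs hs

theorem frame {A : ℕ → Prop} (hA : p.Touches A) (h : Triple V p s T Q) :
    Triple V p s T fun t => Q t ∧ ∀ x, ¬ A x → t.reg x = s.reg x := fun hs => by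
  obtain ⟨t, ht, hb, hQ⟩ := h hs
  exact ⟨t, ht, hb, hQ, fun x hx => ht.reg_eq hA hx⟩

theorem frame_mem (hp : p.ReadOnly) (h : Triple V p s T Q) :
    Triple V p s T fun t => Q t ∧ t.mem = s.mem := fun hs => by
  obtain ⟨t, ht, hb, hQ⟩ := h hs
  exact ⟨t, ht, hb, hQ, ht.mem_eq hp⟩

theorem skip (h : Q s) : Triple V .skip s 1 Q := fun hs => by
  refine ⟨s, fun σ hσ => ⟨_, 1, le_rfl, ?_, .const _ _ _ (Nat.zero_le _)⟩, hs, h⟩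
  rw [view_setReg_odd _ rfl, hσ]

theorem assign (he : e.Ok) (hV : Bounded V s → e.eval s ≤ V) (h : Q (s.setReg x (e.eval s))) :
    Triple V (.assign x e) s (e.size + 1) Q := fun hs => by
  refine ⟨_, fun σ hσ => ?_, hs.setReg (hV hs), h⟩
  subst hσ
  obtain ⟨σ₁, h₁, hv, hw, -⟩ := he.exec 0 σ hs
  -- There is no move instruction; a register is copied as `x &&& x`.
  have hval : Op.and.eval (σ₁.reg 1) (σ₁.reg 1) = e.eval (view σ) := by
    rw [show (1 : ℕ) = 2 * 0 + 1 from rfl, hv]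
    simp [Op.eval]
  refine ⟨_, _, le_rfl, ?_, .seq h₁ (.op _ _ _ _ _ ?_)⟩
  · rw [view_setReg, hval, hw]
  · rw [hval]; exact (hV hs).trans (le_wordBound V)

theorem assignOp {o : Op} {y z : ℕ} (hV : Bounded V s → o.eval (s.reg y) (s.reg z) ≤ V)
    (h : Q (s.setReg x (o.eval (s.reg y) (s.reg z)))) :
    Triple V (.assignOp o x y z) s 1 Q := fun hs => by
  refine ⟨_, fun σ hσ => ?_, hs.setReg (hV hs), h⟩
  subst hσ
  exact ⟨_, _, le_rfl, view_setReg _ _ _, .op _ _ _ _ _ ((hV hs).trans (le_wordBound V))⟩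

theorem constant {c : ℕ} (hV : c ≤ V) (h : Q (s.setReg x c)) :
    Triple V (.const (2 * x) c) s 1 Q := fun hs => by
  refine ⟨_, fun σ hσ => ?_, hs.setReg hV, h⟩
  subst hσ
  exact ⟨_, _, le_rfl, view_setReg _ _ _, .const _ _ _ (hV.trans (le_wordBound V))⟩

theorem storeExp (he : e.Ok) (hf : f.Ok) (hV : Bounded V s → f.eval s ≤ V)
    (h : Q (s.setMem (e.eval s) (f.eval s))) :
    Triple V (.storeExp e f) s (e.size + (f.size + 1)) Q := fun hs => by
  refine ⟨_, fun σ hσ => ?_, hs.setMem (hV hs), h⟩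
  subst hσ
  obtain ⟨σ₁, h₁, hv, hw, -⟩ := he.exec 0 σ hs
  obtain ⟨σ₂, h₂, hv', hw', hp⟩ := hf.exec 1 σ₁ (by rwa [hw])
  refine ⟨_, _, le_rfl, ?_, .seq h₁ (.seq h₂ (.store _ _ _))⟩
  have h1 : σ₂.reg 1 = e.eval (view σ) := by rw [show (1 : ℕ) = 2 * 0 + 1 from rfl, hp 0 one_pos, hv]
  have h3 : σ₂.reg 3 = f.eval (view σ) := by rw [show (3 : ℕ) = 2 * 1 + 1 from rfl, hv', hw]
  rw [h1, h3]
  rw [hw] at hw'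
  rw [← hw']
  rfl

theorem ite (he : e.Ok) (ht : e.eval s ≠ 0 → Triple V p s T Q) (hf : e.eval s = 0 → Triple V q s T Q) :
    Triple V (.ite e p q) s (e.size + (T + 1)) Q := fun hs => by
  by_cases h : e.eval s = 0
  · obtain ⟨t, hr, hb, hQ⟩ := hf h hs
    exact ⟨t, .ite_false hs he h hr, hb, hQ⟩
  · obtain ⟨t, hr, hb, hQ⟩ := ht h hs
    exact ⟨t, .ite_true hs he h hr, hb, hQ⟩

theorem branch (he : e.Ok) (ht : e.eval s ≠ 0 → Triple V p s (T - (e.size + 1)) Q)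
    (hf : e.eval s = 0 → Triple V q s (T - (e.size + 1)) Q)
    (hT : e.size + 1 ≤ T := by simp <;> omega) : Triple V (.ite e p q) s T Q :=
  (ite he ht hf).le_time (by omega)

theorem step (he : e.Ok) (hV : Bounded V s → e.eval s ≤ V)
    (h : Triple V p (s.setReg x (e.eval s)) (T - (e.size + 1)) Q)
    (hT : e.size + 1 ≤ T := by simp <;> omega) : Triple V (.seq (.assign x e) p) s T Q :=
  seq' (assign he hV h) hT

theorem last (he : e.Ok) (hV : Bounded V s → e.eval s ≤ V) (h : Q (s.setReg x (e.eval s)))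
    (hT : e.size + 1 ≤ T := by simp <;> omega) : Triple V (.assign x e) s T Q :=
  (assign he hV h).le_time hT

theorem whileDo (Inv : State → Prop) (μ : State → ℕ) (he : e.Ok)
    (body : ∀ s, Inv s → e.eval s ≠ 0 → Triple V p s T fun t => Inv t ∧ μ t < μ s)
    (hs : Inv s) (hQ : ∀ t, Inv t → e.eval t = 0 → Q t) :
    Triple V (.whileDo e p) s (μ s * (e.size + 1 + T) + (e.size + 1)) Q := by
  induction hn : μ s using Nat.strong_induction_on generalizing s with
  | _ n ih =>
    intro hb
    by_cases h : e.eval s = 0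
    · exact ⟨s, (Runs.whileDo_done hb he h).mono (by omega), hb, hQ s hs h⟩
    · obtain ⟨t, hr, hb', hI, hμ⟩ := body s hs h hb
      obtain ⟨u, hr', hb'', hQ'⟩ := ih (μ t) (by omega) hI rfl hb'
      refine ⟨u, (Runs.whileDo_step hb he h hr hr').mono ?_, hb'', hQ'⟩
      have : (μ t + 1) * (e.size + 1 + T) ≤ n * (e.size + 1 + T) := Nat.mul_le_mul_right _ (by omega)
      rw [add_mul, one_mul] at this
      omega

/-- The condition `hp` keeps the body from changing the counter and the bound, so the number of
iterations is known in advance. The invariant refers to the loop head; this is why the body has to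
establish it after the increment of the counter. -/
theorem forDo {i n N : ℕ} (Inv : ℕ → State → Prop) (hn : s.reg n = N) (hin : i ≠ n)
    (hp : p.Touches fun x => x ≠ i ∧ x ≠ n) (h0 : Inv 0 (s.setReg i 0))
    (body : ∀ j < N, ∀ s, s.reg i = j → s.reg n = N → Inv j s →
      Triple V p s T fun t => Inv (j + 1) (t.setReg i (j + 1)))
    (hQ : ∀ t, t.reg i = N → Inv N t → Q t) :
    Triple V (.forDo i n p) s (N * (T + 8) + 6) Q := by
  refine of_bounded fun hb => ?_
  have hNV : N ≤ V := hn ▸ hb.reg n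
  refine (seq (assign (e := 0) rfl (fun _ => Nat.zero_le _)
    (le_time (whileDo (e := Exp.var n - Exp.var i) (T := T + 4) (fun t => t.reg n = N ∧ t.reg i ≤ N ∧ Inv (t.reg i) t)
      (fun t => N - t.reg i) rfl ?_ ?_ ?_) le_rfl))).le_time ?_
  · rintro s ⟨h1, h2, h3⟩ h4
    have h4' : N - s.reg i ≠ 0 := by simpa [h1] using h4
    refine (seq ((frame hp (body _ (by omega) s rfl h1 h3)).mono le_rfl ?_)).le_time
      (T₁ := T + 4) le_rfl
    rintro t ⟨ht, hfr⟩
    have hti := hfr i (by simp)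
    have htn := hfr n (by simp)
    refine assign (e := Exp.var i + 1) rfl (fun _ => ?_) ?_
    · simp [hti]; omega
    · simp only [Exp.eval_add, Exp.eval_var, Exp.eval_one, hti]
      refine ⟨⟨?_, ?_, ?_⟩, ?_⟩
      · simp [State.setReg, Function.update_of_ne hin.symm, htn, h1]
      · simp [State.setReg]; omega
      · simpa [State.setReg] using ht
      · simp [State.setReg]; omega
  · refine ⟨?_, ?_, ?_⟩
    · simp [State.setReg, Function.update_of_ne hin.symm, hn]
    · simp [State.setReg]
    · simpa [State.setReg] using h0
  · rintro t ⟨h1, h2, h3⟩ h4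
    have h4' : N - t.reg i = 0 := by simpa [h1] using h4
    have : t.reg i = N := by omega
    exact hQ t this (this ▸ h3)
  -- Each iteration pays four steps for the guard and four for the increment, hence `T + 8`; the
  -- initialisation and the last guard cost `2 + 4 = 6`.
  · have h1 : (Exp.var n - Exp.var i).size = 3 := rfl
    have h2 : (0 : Exp).size = 1 := rfl
    have h3 : (State.setReg s i (Exp.eval s 0)).reg i = 0 := by simp [State.setReg]
    simp only [h1, h2, h3, Nat.sub_zero]
    rw [show 3 + 1 + (T + 4) = T + 8 by omega]
    omega

end Triple

end FlowHardness

/-! ### Rewriting rules for updates, and the layout of the variables. -/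

namespace FlowHardness

@[simp] theorem State.reg_setReg (s : State) (i v j : ℕ) :
    (s.setReg i v).reg j = if j = i then v else s.reg j := Function.update_apply ..

@[simp] theorem State.mem_setReg (s : State) (i v : ℕ) : (s.setReg i v).mem = s.mem := rfl

@[simp] theorem State.reg_setMem (s : State) (i v : ℕ) : (s.setMem i v).reg = s.reg := rfl

@[simp] theorem State.mem_setMem (s : State) (i v j : ℕ) :
    (s.setMem i v).mem j = if j = i then v else s.mem j := Function.update_apply ..

namespace Exp
variable (e f : Exp)
@[simp] theorem size_const (c : ℕ) : (const c).size = 1 := rfl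
@[simp] theorem size_ofNat (c : ℕ) : (ofNat(c) : Exp).size = 1 := rfl
@[simp] theorem size_zero : (0 : Exp).size = 1 := rfl
@[simp] theorem size_one : (1 : Exp).size = 1 := rfl
@[simp] theorem size_var (x : ℕ) : (var x).size = 1 := rfl
@[simp] theorem size_add : (e + f).size = e.size + f.size + 1 := rfl
@[simp] theorem size_sub : (e - f).size = e.size + f.size + 1 := rfl
@[simp] theorem size_mul : (e * f).size = e.size + f.size + 1 := rfl
@[simp] theorem size_div : (e / f).size = e.size + f.size + 1 := rfl
@[simp] theorem size_mod : (e % f).size = e.size + f.size + 1 := rfl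
@[simp] theorem size_bin (o : Op) : (bin o e f).size = e.size + f.size + 1 := rfl
@[simp] theorem size_load : (load e).size = e.size + 1 := rfl
end Exp

infixr:60 " ;; " => Prog.seq
prefix:max "𝕣" => Exp.var

/-! ### The variables of the program -/

notation "v_best" => (0 : ℕ)
notation "v_m" => (1 : ℕ)
notation "v_n" => (2 : ℕ)
notation "v_base" => (3 : ℕ)
notation "v_H" => (4 : ℕ)
notation "v_cap" => (5 : ℕ)
notation "v_capLog" => (6 : ℕ)
notation "v_budget" => (7 : ℕ)
notation "v_a" => (8 : ℕ)
notation "v_b" => (9 : ℕ)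
notation "v_S" => (10 : ℕ)
notation "v_T" => (11 : ℕ)
notation "v_N" => (12 : ℕ)
notation "v_X" => (13 : ℕ)
notation "v_thr" => (14 : ℕ)
notation "v_pos" => (15 : ℕ)
notation "v_pow" => (16 : ℕ)
notation "v_fix" => (17 : ℕ)
notation "v_call" => (18 : ℕ)
notation "v_unit" => (19 : ℕ)
notation "v_bound" => (20 : ℕ)
notation "v_G" => (21 : ℕ)
notation "v_L" => (22 : ℕ)
notation "v_addr" => (40 : ℕ)
notation "v_val" => (41 : ℕ)
notation "v_u" => (42 : ℕ)
notation "v_side" => (43 : ℕ)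
notation "v_i" => (44 : ℕ)
notation "v_flag" => (45 : ℕ)
notation "v_ptr" => (46 : ℕ)
notation "v_j" => (47 : ℕ)
notation "v_len" => (48 : ℕ)
notation "v_l" => (49 : ℕ)
notation "v_lit" => (50 : ℕ)
notation "v_uu" => (51 : ℕ)
notation "v_e" => (52 : ℕ)
notation "v_x" => (53 : ℕ)
notation "v_y" => (54 : ℕ)
notation "v_src" => (55 : ℕ)
notation "v_tgt" => (56 : ℕ)
notation "v_tmp" => (57 : ℕ)
notation "v_arg" => (58 : ℕ)
notation "v_found" => (60 : ℕ)
notation "v_idx" => (61 : ℕ)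
notation "v_row" => (62 : ℕ)
notation "v_cnt" => (63 : ℕ)
notation "v_fst" => (64 : ℕ)
notation "v_clk" => (99 : ℕ)
notation "v_sim" => (100 : ℕ)

/-! ### Reading clauses -/

/-- The address of the `i`-th clause of a formula in memory. -/
def clausePtr (mem : ℕ → ℕ) : ℕ → ℕ
  | 0 => 2
  | i + 1 => clausePtr mem i + 1 + mem (clausePtr mem i)

theorem clausePtr_mono (mem : ℕ → ℕ) : Monotone (clausePtr mem) :=
  monotone_nat_of_le_succ fun i => by simp only [clausePtr]; omega

theorem le_clausePtr (mem : ℕ → ℕ) (i : ℕ) : i + 2 ≤ clausePtr mem i := by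
  induction i with
  | zero => exact le_rfl
  | succ i ih => simp only [clausePtr]; omega

/-- The parameters of a call of the flow algorithm: the formula in memory, the partition of the
variables into `a` variables for the sources, `b` variables for the sinks and the remaining
variables, the resulting sizes, and the part of the assignment that is already fixed. -/
structure Ctx where
  mem : ℕ → ℕ
  m : ℕ
  n : ℕ
  base : ℕ
  H : ℕ
  cap : ℕ
  capLog : ℕ
  budget : ℕ
  a : ℕ
  b : ℕ
  S : ℕ
  T : ℕ
  N : ℕ
  X : ℕ
  thr : ℕ
  pow : ℕ
  fix : ℕ
  call : ℕ

namespace Ctx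
variable (C : Ctx)

/-- The variables and the formula in memory are as given by `C`. -/
structure Holds (s : State) : Prop where
  m : s.reg v_m = C.m
  n : s.reg v_n = C.n
  base : s.reg v_base = C.base
  H : s.reg v_H = C.H
  cap : s.reg v_cap = C.cap
  capLog : s.reg v_capLog = C.capLog
  budget : s.reg v_budget = C.budget
  a : s.reg v_a = C.a
  b : s.reg v_b = C.b
  S : s.reg v_S = C.S
  T : s.reg v_T = C.T
  N : s.reg v_N = C.N
  X : s.reg v_X = C.X
  thr : s.reg v_thr = C.thr
  pow : s.reg v_pow = C.pow
  fix : s.reg v_fix = C.fix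
  call : s.reg v_call = C.call
  mem : ∀ x < C.base, s.mem x = C.mem x

variable {C}

theorem Holds.congr_of_pos {s t : State} (h : C.Holds s)
    (hr : ∀ x, 0 < x → x < 40 → t.reg x = s.reg x)
    (hm : ∀ x < C.base, t.mem x = s.mem x) : C.Holds t := by
  constructor
  case mem => exact fun x hx => (hm x hx).trans (h.mem x hx)
  all_goals rw [hr _ (by norm_num) (by norm_num)]
  exacts [h.m, h.n, h.base, h.H, h.cap, h.capLog, h.budget, h.a, h.b, h.S, h.T, h.N, h.X, h.thr, h.pow, h.fix, h.call]

theorem Holds.congr {s t : State} (h : C.Holds s) (hr : ∀ x < 40, t.reg x = s.reg x)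
    (hm : ∀ x < C.base, t.mem x = s.mem x) : C.Holds t :=
  h.congr_of_pos (fun x _ hx => hr x hx) hm

variable (C)

/-- Is the variable `k` one of the `b` variables for the sinks? -/
def sinkVar (k : ℕ) : ℕ := if C.a ≤ k ∧ k < C.a + C.b then 1 else 0

/-- The literal is on the given side and true under the assignment given by the bits of `w`. -/
def LitTrue (side w lit : ℕ) : Prop := C.sinkVar (lit / 2) = side ∧ (w >>> (lit / 2)) % 2 = lit % 2

instance (side w lit : ℕ) : Decidable (C.LitTrue side w lit) := inferInstanceAs (Decidable (_ ∧ _))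

/-- No literal of the `i`-th clause that is on the given side is true. -/
def Unsat (side w i : ℕ) : Prop :=
  ∀ l < C.mem (clausePtr C.mem i), ¬ C.LitTrue side w (C.mem (clausePtr C.mem i + 1 + l))

instance (side w i : ℕ) : Decidable (C.Unsat side w i) := inferInstanceAs (Decidable (∀ l < _, _))

/-- The assignment `u` with the fixed part put in. -/
def patch (u : ℕ) : ℕ := u / C.pow * C.pow + C.fix

end Ctx

namespace Prog

/-- Is the variable of the literal one of the variables for the sinks? -/
def sinkVarExp : Exp :=
  (1 - (1 - (𝕣 v_lit / 2 + 1 - 𝕣 v_a))) * (1 - (1 - (𝕣 v_a + 𝕣 v_b - 𝕣 v_lit / 2)))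

/-- `flag := 1` if no literal on the side `side` of the clause `i` is true under the assignment
`u`, and `flag := 0` otherwise -/
def unsat : Prog :=
  assign v_uu (𝕣 v_u / 𝕣 v_pow * 𝕣 v_pow + 𝕣 v_fix) ;;
  assign v_ptr 2 ;;
  forDo v_j v_i (assign v_ptr (𝕣 v_ptr + 1 + .load (𝕣 v_ptr))) ;;
  assign v_len (.load (𝕣 v_ptr)) ;;
  assign v_flag 1 ;;
  forDo v_l v_len
    (assign v_lit (.load (𝕣 v_ptr + 1 + 𝕣 v_l)) ;;
     ite (.bin .xor sinkVarExp (𝕣 v_side) +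
        .bin .xor (.bin .shr (𝕣 v_uu) (𝕣 v_lit / 2) % 2) (𝕣 v_lit % 2))
       skip (assign v_flag 0))

theorem touches_unsat : unsat.Touches fun x => 45 ≤ x ∧ x ≤ 51 := by
  simp [unsat]

theorem readOnly_unsat : unsat.ReadOnly := by simp [unsat]

end Prog

/-- Clauses have variable length, so the `i`-th one is reached by following `i` lengths; then its
literals are scanned. Both loops run at most `C.base` times, because every clause occupies at least
one word and all of them lie below `C.base`. -/
theorem unsat_spec {V : ℕ} {C : Ctx} {s : State} (hC : C.Holds s) (hi : s.reg v_i < C.m)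
    (hbase : clausePtr C.mem C.m = C.base) (huu : C.patch (s.reg v_u) ≤ V) :
    Triple V .unsat s (100 * (C.base + 1)) fun t =>
      t.reg v_flag = (if C.Unsat (s.reg v_side) (C.patch (s.reg v_u)) (s.reg v_i) then 1 else 0) ∧
      t.mem = s.mem ∧ ∀ x, ¬ (45 ≤ x ∧ x ≤ 51) → t.reg x = s.reg x := by
  suffices h : Triple V .unsat s (100 * (C.base + 1)) fun t =>
      t.reg v_flag = (if C.Unsat (s.reg v_side) (C.patch (s.reg v_u)) (s.reg v_i) then 1 else 0) from
    ((h.frame_mem Prog.readOnly_unsat).frame Prog.touches_unsat).mono le_rfl fun t ht =>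
      ⟨ht.1.1, ht.1.2, ht.2⟩
  generalize hi0 : s.reg v_i = i at *
  generalize hu : s.reg v_u = u at *
  generalize hside : s.reg v_side = side at *
  have hlen : clausePtr C.mem (i + 1) ≤ C.base := hbase ▸ clausePtr_mono C.mem hi
  have hile := le_clausePtr C.mem i
  simp only [clausePtr] at hlen
  have hread : ∀ x < C.base, s.mem x = C.mem x := hC.mem
  refine Triple.of_bounded fun hb => ?_
  have hbV : C.base ≤ V := hC.base ▸ hb.reg _
  have h8 := hb.eight_le
  unfold Prog.unsat
  have hT : i ≤ C.base := by omega
  refine Triple.seq' (Triple.assign rfl (fun _ => ?_) ?_) (by simp; omega)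
  · simpa [hu, hC.pow, hC.fix, Ctx.patch] using huu
  · simp only [Exp.eval_add, Exp.eval_mul, Exp.eval_div, Exp.eval_var, hu, hC.pow, hC.fix]
    change Triple V _ (s.setReg v_uu (C.patch u)) _ _
    refine Triple.seq' (Triple.assign rfl (fun _ => by simp; omega) ?_) (by simp; omega)
    refine Triple.seq' (Triple.forDo (N := i) (T := 10)
      (fun j t => t.reg v_ptr = clausePtr C.mem j ∧ t.mem = s.mem ∧
        t.reg v_uu = C.patch u ∧ ∀ x, ¬ (45 ≤ x ∧ x ≤ 51) → t.reg x = s.reg x)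
      (by simp [hi0]) (by norm_num) (by simp) ?_ ?_ ?_) (by simp; omega)
    · refine ⟨by simp [clausePtr], by simp, by simp, fun x hx => ?_⟩
      simp [show x ≠ 46 by omega, show x ≠ 47 by omega, show x ≠ 51 by omega]
    · rintro j hj t hj1 hj2 ⟨h1, h2, h3, h4⟩
      have hjb : clausePtr C.mem (j + 1) ≤ C.base :=
        hbase ▸ clausePtr_mono C.mem (by omega)
      simp only [clausePtr] at hjb
      have hm : t.mem (clausePtr C.mem j) = C.mem (clausePtr C.mem j) := by
        rw [h2, hread _ (by omega)]
      refine Triple.le_time (Triple.assign rfl (fun _ => ?_) ?_) (by simp)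
      · simp [h1, hm]; omega
      · refine ⟨by simp [h1, hm, clausePtr], by simp [h2], by simp [h3], fun x hx => ?_⟩
        simp [show x ≠ 46 by omega, show x ≠ 47 by omega, h4 x hx]
    · rintro t ht ⟨h1, h2, h3, h4⟩
      have hm : t.mem (clausePtr C.mem i) = C.mem (clausePtr C.mem i) := by
        rw [h2, hread _ (by omega)]
      refine Triple.seq' (Triple.assign rfl (fun _ => by simp [h1, hm]; omega) ?_) (by simp; omega)
      refine Triple.seq' (Triple.assign rfl (fun _ => by simp; omega) ?_) (by simp; omega)
      refine Triple.le_time (Triple.forDo (N := C.mem (clausePtr C.mem i)) (T := 60)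
        (fun j r => r.reg v_ptr = clausePtr C.mem i ∧ r.mem = s.mem ∧ r.reg v_uu = C.patch u ∧
          (∀ x, ¬ (45 ≤ x ∧ x ≤ 51) → r.reg x = s.reg x) ∧
          r.reg v_flag = if ∀ l < j, ¬ C.LitTrue side (C.patch u)
            (C.mem (clausePtr C.mem i + 1 + l)) then 1 else 0)
        (by simp [h1, hm]) (by norm_num) (by simp) ?_ ?_ ?_)
          (le_trans (Nat.add_le_add_right (Nat.mul_le_mul_right 68 (show _ ≤ C.base by omega)) 6)
            (by simp; omega))
      · refine ⟨by simp [h1], by simp [h2], by simp [h3], fun x hx => ?_, by simp⟩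
        simp [show x ≠ 48 by omega, show x ≠ 45 by omega, show x ≠ 49 by omega, h4 x hx]
      · rintro j hj r hr1 hr2 ⟨g1, g2, g3, g4, g5⟩
        have hmr : r.mem (clausePtr C.mem i + 1 + j) = C.mem (clausePtr C.mem i + 1 + j) := by
          rw [g2, hread _ (by omega)]
        have hlit : C.mem (clausePtr C.mem i + 1 + j) ≤ V := by
          rw [← hread _ (by omega)]; exact hb.mem _
        refine Triple.seq' (Triple.assign rfl
          (fun _ => by simpa [g1, hr1, hmr] using hlit) ?_) (by simp)
        simp only [Exp.eval_add, Exp.eval_load, Exp.eval_var, Exp.eval_one, g1, hr1, hmr]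
        set lit := C.mem (clausePtr C.mem i + 1 + j) with hlitdef
        have ga : r.reg v_a = C.a := (g4 _ (by norm_num)).trans hC.a
        have gb : r.reg v_b = C.b := (g4 _ (by norm_num)).trans hC.b
        have gs : r.reg v_side = side := (g4 _ (by norm_num)).trans hside
        -- Under truncated subtraction `1 - (1 - t)` is the indicator of `t ≠ 0`, and `k + 1 - a ≠
        -- 0` means `a ≤ k`.
        have hsv : Prog.sinkVarExp.eval (r.setReg v_lit lit) = C.sinkVar (lit / 2) := by
          simp only [Prog.sinkVarExp, Exp.eval_mul, Exp.eval_sub, Exp.eval_add, Exp.eval_div,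
            Exp.eval_var, Exp.eval_ofNat, State.reg_setReg, Ctx.sinkVar]
          norm_num [ga, gb]
          split_ifs with h
          · rw [show 1 - (1 - (lit / 2 + 1 - C.a)) = 1 by omega,
              show 1 - (1 - (C.a + C.b - lit / 2)) = 1 by omega]
          · rw [Nat.mul_eq_zero]; omega
        -- An exclusive or vanishes exactly for equal arguments, and a sum of naturals vanishes only
        -- if both terms do.
        have hcond : (.bin .xor Prog.sinkVarExp (𝕣 v_side) +
            .bin .xor (.bin .shr (𝕣 v_uu) (𝕣 v_lit / 2) % 2) (𝕣 v_lit % 2) : Exp).eval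
            (r.setReg v_lit lit) = 0 ↔ C.LitTrue side (C.patch u) lit := by
          simp only [Exp.eval_add, Exp.eval_xor, hsv, Exp.eval_shr, Exp.eval_mod, Exp.eval_div,
            Exp.eval_var, Exp.eval_ofNat, State.reg_setReg]
          norm_num [gs, g3]
          exact Iff.rfl
        refine Triple.le_time (Triple.ite (T := 2) rfl (fun h => ?_) (fun h => ?_)) (by simp [Prog.sinkVarExp])
        · rw [Ne, hcond] at h
          refine Triple.le_time (Triple.skip ?_) (by simp)
          refine ⟨by simp [g1], by simp [g2], by simp [g3], fun x hx => ?_, ?_⟩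
          · simp [show x ≠ 49 by omega, show x ≠ 50 by omega, g4 x hx]
          · simp only [State.reg_setReg, g5]
            norm_num
            refine if_congr ?_ rfl rfl
            constructor
            · intro hh l hl
              rcases Nat.le_iff_lt_or_eq.1 hl with hl | rfl
              exacts [hh l hl, h]
            · exact fun hh l hl => hh l (by omega)
        · rw [hcond] at h
          refine Triple.le_time (Triple.assign rfl (fun _ => by simp) ?_) (by simp)
          refine ⟨by simp [g1], by simp [g2], by simp [g3], fun x hx => ?_, ?_⟩
          · simp [show x ≠ 49 by omega, show x ≠ 50 by omega, show x ≠ 45 by omega, g4 x hx]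
          · simp only [State.reg_setReg, Exp.eval_zero]
            norm_num
            exact ⟨j, by omega, h⟩
      · rintro r hr ⟨g1, g2, g3, g4, g5⟩
        rw [g5]
        rfl

end FlowHardness

namespace FlowHardness

/-! ### The input words of the flow instance -/

namespace Ctx
variable (C : Ctx)

/-- The clause of the slot `x` is not satisfied by the source `α` together with the middle part
of the assignment that belongs to `x`. -/
def SourceUnsat (α x : ℕ) : Prop := C.Unsat 0 (C.patch (α + x / C.m * (C.S * C.T))) (x % C.m)

/-- The clause of the slot `x` is not satisfied by the sink `β`. -/
def SinkUnsat (β x : ℕ) : Prop := C.Unsat 1 (C.patch (β * C.S)) (x % C.m)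

instance (α x : ℕ) : Decidable (C.SourceUnsat α x) := inferInstanceAs (Decidable (C.Unsat _ _ _))
instance (α x : ℕ) : Decidable (C.SinkUnsat α x) := inferInstanceAs (Decidable (C.Unsat _ _ _))

/-- The start of the edge number `x` of row `y`. -/
def edgeSrc (x y : ℕ) : ℕ :=
  if y < C.S then y
  else if y < C.S + C.T then if C.SinkUnsat (y - C.S) x then 2 * C.N + x else 4 * C.N + x
  else if y < C.S + 2 * C.T then 5 * C.N + x
  else if y < C.S + 2 * C.T + 1 then 2 * C.N + x
  else if y < C.S + 2 * C.T + 2 then 3 * C.N + x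
  else 7 * C.N + x / C.m

/-- The end of the edge number `x` of row `y`. -/
def edgeTgt (x y : ℕ) : ℕ :=
  if y < C.S then if C.SourceUnsat y x then 2 * C.N + x else 3 * C.N + x
  else if y < C.S + C.T then C.N + (y - C.S)
  else if y < C.S + 2 * C.T then C.N + (y - (C.S + C.T))
  else if y < C.S + 2 * C.T + 1 then 7 * C.N + x / C.m
  else if y < C.S + 2 * C.T + 2 then 7 * C.N + x / C.m
  else if C.thr < x % C.m then 5 * C.N + x else 6 * C.N + x

/-- The number of edges. -/
def numEdges : ℕ := C.X * (C.S + 2 * C.T + 3)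

/-- The input word at an address. -/
def word (addr : ℕ) : ℕ :=
  if addr < 4 then
    if addr = 0 then 8 * C.N else if addr = 1 then C.numEdges else if addr = 2 then C.S else C.T
  else if addr - 4 < C.S then addr - 4
  else if addr - 4 - C.S < C.T then C.N + (addr - 4 - C.S)
  else if addr - 4 - C.S - C.T < 2 * C.numEdges then
    let e := addr - 4 - C.S - C.T
    if e % 2 = 0 then C.edgeSrc (e / 2 % C.X) (e / 2 / C.X) else C.edgeTgt (e / 2 % C.X) (e / 2 / C.X)
  else 0

/-- All values needed to compute input words are at most `V`. -/
structure Fits (V : ℕ) : Prop where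
  base_eq : clausePtr C.mem C.m = C.base
  m_pos : 0 < C.X → 0 < C.m
  node_le : 8 * C.N + C.X + C.T ≤ V
  edge_le : 2 * C.numEdges ≤ V
  patch_le : C.S + C.X * (C.S * C.T) + C.T * C.S + C.fix ≤ V

end Ctx

namespace Prog

/-- the two ends of the edge number `x` of row `y` -/
def edgeEnds : Prog :=
  ite (𝕣 v_S - 𝕣 v_y)
    (assign v_u (𝕣 v_y + 𝕣 v_x / 𝕣 v_m * (𝕣 v_S * 𝕣 v_T)) ;; assign v_side 0 ;; unsat ;;
      assign v_src (𝕣 v_y) ;;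
      ite (𝕣 v_flag) (assign v_tgt (2 * 𝕣 v_N + 𝕣 v_x)) (assign v_tgt (3 * 𝕣 v_N + 𝕣 v_x)))
  (ite (𝕣 v_S + 𝕣 v_T - 𝕣 v_y)
    (assign v_u ((𝕣 v_y - 𝕣 v_S) * 𝕣 v_S) ;; assign v_side 1 ;; unsat ;;
      assign v_tgt (𝕣 v_N + (𝕣 v_y - 𝕣 v_S)) ;;
      ite (𝕣 v_flag) (assign v_src (2 * 𝕣 v_N + 𝕣 v_x)) (assign v_src (4 * 𝕣 v_N + 𝕣 v_x)))
  (ite (𝕣 v_S + 2 * 𝕣 v_T - 𝕣 v_y)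
    (assign v_src (5 * 𝕣 v_N + 𝕣 v_x) ;; assign v_tgt (𝕣 v_N + (𝕣 v_y - (𝕣 v_S + 𝕣 v_T))))
  (ite (𝕣 v_S + 2 * 𝕣 v_T + 1 - 𝕣 v_y)
    (assign v_src (2 * 𝕣 v_N + 𝕣 v_x) ;; assign v_tgt (7 * 𝕣 v_N + 𝕣 v_x / 𝕣 v_m))
  (ite (𝕣 v_S + 2 * 𝕣 v_T + 2 - 𝕣 v_y)
    (assign v_src (3 * 𝕣 v_N + 𝕣 v_x) ;; assign v_tgt (7 * 𝕣 v_N + 𝕣 v_x / 𝕣 v_m))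
    (assign v_src (7 * 𝕣 v_N + 𝕣 v_x / 𝕣 v_m) ;;
      ite (𝕣 v_x % 𝕣 v_m - 𝕣 v_thr) (assign v_tgt (5 * 𝕣 v_N + 𝕣 v_x))
        (assign v_tgt (6 * 𝕣 v_N + 𝕣 v_x)))))))

/-- `val :=` the input word at the address `addr` -/
def fetch : Prog :=
  ite (4 - 𝕣 v_addr)
    (ite (𝕣 v_addr)
      (ite (𝕣 v_addr - 1)
        (ite (𝕣 v_addr - 2) (assign v_val (𝕣 v_T)) (assign v_val (𝕣 v_S)))
        (assign v_val (𝕣 v_X * (𝕣 v_S + 2 * 𝕣 v_T + 3))))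
      (assign v_val (8 * 𝕣 v_N)))
  (assign v_e (𝕣 v_addr - 4) ;;
  ite (𝕣 v_S - 𝕣 v_e) (assign v_val (𝕣 v_e))
  (assign v_e (𝕣 v_e - 𝕣 v_S) ;;
  ite (𝕣 v_T - 𝕣 v_e) (assign v_val (𝕣 v_N + 𝕣 v_e))
  (assign v_e (𝕣 v_e - 𝕣 v_T) ;;
  ite (2 * (𝕣 v_X * (𝕣 v_S + 2 * 𝕣 v_T + 3)) - 𝕣 v_e)
    (assign v_x (𝕣 v_e / 2 % 𝕣 v_X) ;; assign v_y (𝕣 v_e / 2 / 𝕣 v_X) ;;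
      assign v_i (𝕣 v_x % 𝕣 v_m) ;; edgeEnds ;;
      ite (𝕣 v_e % 2) (assign v_val (𝕣 v_tgt)) (assign v_val (𝕣 v_src)))
    (assign v_val 0))))

theorem touches_edgeEnds : edgeEnds.Touches fun x => 42 ≤ x ∧ x ≤ 56 ∧ x ≠ 52 ∧ x ≠ 53 ∧ x ≠ 54 := by
  have h := touches_unsat.mono (A' := fun x => 42 ≤ x ∧ x ≤ 56 ∧ x ≠ 52 ∧ x ≠ 53 ∧ x ≠ 54)
    fun x hx => by omega
  simp [edgeEnds, h]

theorem readOnly_edgeEnds : edgeEnds.ReadOnly := by simp [edgeEnds, readOnly_unsat]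

theorem touches_fetch : fetch.Touches fun x => 41 ≤ x ∧ x ≤ 56 := by
  have h := touches_edgeEnds.mono (A' := fun x => 41 ≤ x ∧ x ≤ 56) fun x hx => by omega
  simp [fetch, h]

theorem readOnly_fetch : fetch.ReadOnly := by simp [fetch, readOnly_edgeEnds]

end Prog

/-- In each row at most one end depends on the formula, through a single clause. One edge therefore
costs time linear in the formula, however large the flow instance is. -/
theorem edgeEnds_spec {V : ℕ} {C : Ctx} {s : State} (hC : C.Holds s) (hV : C.Fits V)
    (hx : s.reg v_x < C.X) (hy : s.reg v_y < C.S + 2 * C.T + 3) (hi : s.reg v_i = s.reg v_x % C.m) :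
    Triple V .edgeEnds s (100 * (C.base + 1) + 150) fun t =>
      t.reg v_src = C.edgeSrc (s.reg v_x) (s.reg v_y) ∧ t.reg v_tgt = C.edgeTgt (s.reg v_x) (s.reg v_y) := by
  generalize hx' : s.reg v_x = x at *
  generalize hy' : s.reg v_y = y at *
  have hm : 0 < C.m := hV.m_pos (by omega)
  have hiM : s.reg v_i < C.m := hi ▸ Nat.mod_lt _ hm
  have hnode := hV.node_le
  have hpatch := hV.patch_le
  have hdiv : x / C.m ≤ x := Nat.div_le_self _ _
  have hS := hC.S; have hT := hC.T; have hN := hC.N; have hX := hC.X; have hmm := hC.m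
  have hthr := hC.thr
  have h1 : x / C.m * (C.S * C.T) ≤ C.X * (C.S * C.T) := Nat.mul_le_mul_right _ (by omega)
  unfold Prog.edgeEnds Ctx.edgeSrc Ctx.edgeTgt
  refine Triple.branch rfl (fun h => ?_) fun h => ?_
  · have hlt : y < C.S := by simp [hS, hy'] at h; omega
    simp only [hlt, if_true]
    refine Triple.step rfl (fun _ => ?_) ?_
    · simp [hS, hT, hx', hy', hmm]; omega
    refine Triple.step rfl (fun _ => Nat.zero_le _) ?_
    refine Triple.seq' (Triple.mono (unsat_spec (C := C) ?_ ?_ hV.base_eq ?_) le_rfl ?_) (by simp)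
    · exact hC.congr (fun z hz => by simp [show z ≠ 42 by omega, show z ≠ 43 by omega]) (by simp)
    · simpa using hiM
    · simp [hS, hT, hx', hy', hmm]
      exact (Nat.add_le_add_right (Nat.div_mul_le_self _ _) _).trans (by omega)
    · rintro t ⟨ht1, -, ht2⟩
      have g : ∀ z, z < 42 ∨ 52 ≤ z → t.reg z = s.reg z := fun z hz => by
        rw [ht2 z (by omega)]; simp [show z ≠ 42 by omega, show z ≠ 43 by omega]
      have gN := (g v_N (by norm_num)).trans hN
      have gx := (g v_x (by norm_num)).trans hx'
      have gy := (g v_y (by norm_num)).trans hy'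
      simp [hS, hT, hx', hy', hmm, hi] at ht1
      refine Triple.step rfl (fun _ => by simp [gy]; omega) ?_
      refine Triple.branch rfl (fun h => ?_) fun h => ?_
      · have hP : C.SourceUnsat y x := by
          by_contra hcon
          simp [ht1] at h
          exact hcon h
        refine Triple.last rfl (fun _ => by simp [gN, gx]; omega) ?_
        simp [hP, gN, gx, gy]
      · have hP : ¬ C.SourceUnsat y x := by
          intro hcon
          simp [ht1] at h
          exact h hcon
        refine Triple.last rfl (fun _ => by simp [gN, gx]; omega) ?_
        simp [hP, gN, gx, gy]
  have hlt : ¬ y < C.S := by simp [hS, hy'] at h; omega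
  simp only [hlt, if_false]
  refine Triple.branch rfl (fun h => ?_) fun h => ?_
  · have hlt' : y < C.S + C.T := by simp [hS, hT, hy'] at h; omega
    simp only [hlt', if_true]
    have h2 : (y - C.S) * C.S ≤ C.T * C.S := Nat.mul_le_mul_right _ (by omega)
    refine Triple.step rfl (fun _ => ?_) ?_
    · simp [hS, hy']; omega
    refine Triple.step rfl (fun hb => by simpa using (by norm_num : 1 ≤ 8).trans hb.eight_le) ?_
    refine Triple.seq' (Triple.mono (unsat_spec (C := C) ?_ ?_ hV.base_eq ?_) le_rfl ?_) (by simp)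
    · exact hC.congr (fun z hz => by simp [show z ≠ 42 by omega, show z ≠ 43 by omega]) (by simp)
    · simpa using hiM
    · simp [hS, hy']
      exact (Nat.add_le_add_right (Nat.div_mul_le_self _ _) _).trans (by omega)
    · rintro t ⟨ht1, -, ht2⟩
      have g : ∀ z, z < 42 ∨ 52 ≤ z → t.reg z = s.reg z := fun z hz => by
        rw [ht2 z (by omega)]; simp [show z ≠ 42 by omega, show z ≠ 43 by omega]
      have gN := (g v_N (by norm_num)).trans hN
      have gS := (g v_S (by norm_num)).trans hS
      have gx := (g v_x (by norm_num)).trans hx'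
      have gy := (g v_y (by norm_num)).trans hy'
      simp [hS, hy', hi] at ht1
      refine Triple.step rfl (fun _ => by simp [gy, gN, gS]; omega) ?_
      refine Triple.branch rfl (fun h => ?_) fun h => ?_
      · have hP : C.SinkUnsat (y - C.S) x := by
          by_contra hcon
          simp [ht1] at h
          exact hcon h
        refine Triple.last rfl (fun _ => by simp [gN, gx]; omega) ?_
        simp [hP, gN, gx, gy, gS]
      · have hP : ¬ C.SinkUnsat (y - C.S) x := by
          intro hcon
          simp [ht1] at h
          exact h hcon
        refine Triple.last rfl (fun _ => by simp [gN, gx]; omega) ?_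
        simp [hP, gN, gx, gy, gS]
  have hlt' : ¬ y < C.S + C.T := by simp [hS, hT, hy'] at h; omega
  simp only [hlt', if_false]
  refine Triple.branch rfl (fun h => ?_) fun h => ?_
  · have hlt2 : y < C.S + 2 * C.T := by simp [hS, hT, hy'] at h; omega
    refine Triple.step rfl (fun _ => by simp [hN, hx']; omega) ?_
    refine Triple.last rfl (fun _ => by simp [hS, hT, hN, hy']; omega) ?_
    simp [hlt2, hS, hT, hN, hx', hy']
  have hlt2 : ¬ y < C.S + 2 * C.T := by simp [hS, hT, hy'] at h; omega
  simp only [hlt2, if_false]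
  refine Triple.branch rfl (fun h => ?_) fun h => ?_
  · have hlt3 : y < C.S + 2 * C.T + 1 := by simp [hS, hT, hy'] at h; omega
    refine Triple.step rfl (fun _ => by simp [hN, hx']; omega) ?_
    refine Triple.last rfl (fun _ => by simp [hN, hmm, hx']; omega) ?_
    simp [hlt3, hN, hx', hmm]
  have hlt3 : ¬ y < C.S + 2 * C.T + 1 := by simp [hS, hT, hy'] at h; omega
  simp only [hlt3, if_false]
  refine Triple.branch rfl (fun h => ?_) fun h => ?_
  · have hlt4 : y < C.S + 2 * C.T + 2 := by simp [hS, hT, hy'] at h; omega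
    refine Triple.step rfl (fun _ => by simp [hN, hx']; omega) ?_
    refine Triple.last rfl (fun _ => by simp [hN, hmm, hx']; omega) ?_
    simp [hlt4, hN, hx', hmm]
  have hlt4 : ¬ y < C.S + 2 * C.T + 2 := by simp [hS, hT, hy'] at h; omega
  simp only [hlt4, if_false]
  refine Triple.step rfl (fun _ => by simp [hN, hx', hmm]; omega) ?_
  refine Triple.branch rfl (fun h => ?_) fun h => ?_
  · have hlt5 : C.thr < x % C.m := by simp [hthr, hmm, hx'] at h; omega
    refine Triple.last rfl (fun _ => by simp [hN, hx']; omega) ?_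
    simp [hlt5, hN, hx', hmm]
  · have hlt5 : ¬ C.thr < x % C.m := by simp [hthr, hmm, hx'] at h; omega
    refine Triple.last rfl (fun _ => by simp [hN, hx']; omega) ?_
    simp [hlt5, hN, hx', hmm]

theorem fetch_spec {V : ℕ} {C : Ctx} {s : State} (hC : C.Holds s) (hV : C.Fits V) :
    Triple V .fetch s (100 * (C.base + 1) + 300) fun t =>
      t.reg v_val = C.word (s.reg v_addr) ∧ t.mem = s.mem ∧
        ∀ x, ¬ (41 ≤ x ∧ x ≤ 56) → t.reg x = s.reg x := by
  suffices h : Triple V .fetch s (100 * (C.base + 1) + 300) fun t =>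
      t.reg v_val = C.word (s.reg v_addr) from
    ((h.frame_mem Prog.readOnly_fetch).frame Prog.touches_fetch).mono le_rfl fun t ht =>
      ⟨ht.1.1, ht.1.2, ht.2⟩
  generalize haddr : s.reg v_addr = addr
  have hnode := hV.node_le
  have hedge := hV.edge_le
  have hS := hC.S; have hT := hC.T; have hN := hC.N; have hX := hC.X; have hmm := hC.m
  refine Triple.of_bounded fun hb => ?_
  have haddrV : addr ≤ V := haddr ▸ hb.reg _
  have hSV : C.S ≤ V := hS ▸ hb.reg _
  have hTV : C.T ≤ V := hT ▸ hb.reg _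
  unfold Prog.fetch Ctx.word
  refine Triple.branch rfl (fun h => ?_) fun h => ?_
  · have hlt : addr < 4 := by simp [haddr] at h; omega
    simp only [hlt, if_true]
    refine Triple.branch rfl (fun h => ?_) fun h => ?_
    · have hne : addr ≠ 0 := by simpa [haddr] using h
      simp only [hne, if_false]
      refine Triple.branch rfl (fun h => ?_) fun h => ?_
      · have hne1 : addr ≠ 1 := by simp [haddr] at h; omega
        simp only [hne1, if_false]
        refine Triple.branch rfl (fun h => ?_) fun h => ?_
        · have hne2 : addr ≠ 2 := by simp [haddr] at h; omega
          refine Triple.last rfl (fun _ => by simpa [hT] using hTV) ?_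
          simp [hne2, hT]
        · have hne2 : addr = 2 := by simp [haddr] at h; omega
          refine Triple.last rfl (fun _ => by simpa [hS] using hSV) ?_
          simp [hne2, hS]
      · have hne1 : addr = 1 := by simp [haddr] at h; omega
        refine Triple.last rfl (fun _ => ?_) ?_
        · rw [Ctx.numEdges] at hedge
          simp [hX, hS, hT]; omega
        · simp [hne1, hX, hS, hT, Ctx.numEdges]
    · have hne : addr = 0 := by simpa [haddr] using h
      refine Triple.last rfl (fun _ => by simp [hN]; omega) ?_
      simp [hne, hN]
  have hlt : ¬ addr < 4 := by simp [haddr] at h; omega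
  simp only [hlt, if_false]
  refine Triple.step rfl (fun _ => by simp [haddr]; omega) ?_
  simp only [Exp.eval_sub, Exp.eval_var, Exp.eval_ofNat, haddr]
  have he₁ : addr - 4 ≤ V := by omega
  generalize addr - 4 = e₁ at *
  refine Triple.branch rfl (fun h => ?_) fun h => ?_
  · have hlt : e₁ < C.S := by simp [hS] at h; omega
    refine Triple.last rfl (fun _ => by simp; omega) ?_
    simp [hlt]
  have hlt : ¬ e₁ < C.S := by simp [hS] at h; omega
  simp only [hlt, if_false]
  refine Triple.step rfl (fun _ => by simp; omega) ?_
  simp only [Exp.eval_sub, Exp.eval_var, State.reg_setReg, if_true]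
  rw [if_neg (by norm_num), hS]
  have he₂ : e₁ - C.S ≤ V := by omega
  generalize e₁ - C.S = e₂ at *
  refine Triple.branch rfl (fun h => ?_) fun h => ?_
  · have hlt : e₂ < C.T := by simp [hT] at h; omega
    refine Triple.last rfl (fun _ => by simp [hN]; omega) ?_
    simp [hlt, hN]
  have hlt : ¬ e₂ < C.T := by simp [hT] at h; omega
  simp only [hlt, if_false]
  refine Triple.step rfl (fun _ => by simp; omega) ?_
  simp only [Exp.eval_sub, Exp.eval_var, State.reg_setReg, if_true]
  norm_num only [if_false, hT]
  have he₃ : e₂ - C.T ≤ V := by omega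
  generalize e₂ - C.T = e at *
  refine Triple.branch rfl (fun h => ?_) fun h => ?_
  · have hlt : e < 2 * C.numEdges := by simp [hT, hX, hS] at h; rw [Ctx.numEdges]; omega
    simp only [hlt, if_true]
    have hq : e / 2 < C.numEdges := by omega
    have hXpos : 0 < C.X := by
      rcases Nat.eq_zero_or_pos C.X with h0 | h0
      · simp [Ctx.numEdges, h0] at hq
      · exact h0
    have hmod : e / 2 % C.X < C.X := Nat.mod_lt _ hXpos
    have hrow : e / 2 / C.X < C.S + 2 * C.T + 3 := Nat.div_lt_of_lt_mul hq
    have hdiv : e / 2 / C.X ≤ e / 2 := Nat.div_le_self _ _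
    have hmm' : e / 2 % C.X % C.m ≤ e / 2 % C.X := Nat.mod_le _ _
    refine Triple.step rfl (fun _ => by simp [hX]; omega) ?_
    refine Triple.step rfl (fun _ => by simp [hX]; omega) ?_
    refine Triple.step rfl (fun _ => by simp [hX, hmm]; omega) ?_
    refine Triple.seq' (Triple.mono (Triple.frame Prog.touches_edgeEnds
      (edgeEnds_spec (C := C) ?_ hV ?_ ?_ ?_)) le_rfl ?_) (by simp)
    · refine hC.congr (fun z hz => ?_) (by simp)
      simp [show z ≠ 44 by omega, show z ≠ 52 by omega, show z ≠ 53 by omega, show z ≠ 54 by omega]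
    · simpa [hX] using hmod
    · simpa [hX] using hrow
    · simp [hX, hmm]
    · rintro t ⟨⟨ht1, ht2⟩, hfr⟩
      have hte : t.reg v_e = e := by rw [hfr v_e (by norm_num)]; simp
      simp [hX] at ht1 ht2
      refine Triple.of_bounded fun hbt => ?_
      refine Triple.branch rfl (fun h => ?_) fun h => ?_
      · have h' : e % 2 ≠ 0 := by simpa [hte] using h
        refine Triple.last rfl (fun _ => hbt.reg _) ?_
        simp [h', ht2]
      · have h' : e % 2 = 0 := by simpa [hte] using h
        refine Triple.last rfl (fun _ => hbt.reg _) ?_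
        simp [h', ht1]
  · have hlt : ¬ e < 2 * C.numEdges := by simp [hT, hX, hS] at h; rw [Ctx.numEdges]; omega
    refine Triple.last rfl (fun _ => by simp) ?_
    simp [hlt]

end FlowHardness

namespace FlowHardness

/-! ### Simulating a program on an instance that is generated on demand

The word `a` of the simulated memory is kept at the address `base + 2 a + 1`, provided that the
word at the address `base + 2 a` is the number of the present call; otherwise the word has not
been written to yet, and its value is the input word. A clock and a bound for the values make
the simulation stop on all inputs. -/

namespace Ctx
variable (C : Ctx)

/-- The simulated memory. -/
def cell (mem : ℕ → ℕ) (a : ℕ) : ℕ :=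
  if mem (C.base + 2 * a) = C.call then mem (C.base + 2 * a + 1) else C.word a

/-- What the simulation preserves. -/
structure SimInv (s : State) : Prop where
  holds : C.Holds s
  regs : ∀ i, s.reg (v_sim + i) ≤ C.cap
  stamps : ∀ a, s.mem (C.base + 2 * a) ≤ C.call

/-- The state `s` represents the configuration `o` of the simulated program. -/
structure Represents (s o : State) : Prop where
  reg : ∀ i, s.reg (v_sim + i) = o.reg i
  mem : ∀ a, C.cell s.mem a = o.mem a

/-- From `s` to `t` the program `p` is simulated, as long as the clock has not run out. -/
structure SimStep (p : Prog) (s t : State) : Prop where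
  inv : C.SimInv t
  clk_le : t.reg v_clk ≤ s.reg v_clk
  exec : ∀ o o' k B, C.Represents s o → Exec B p o o' k → B ≤ C.cap → k < s.reg v_clk →
    C.Represents t o' ∧ t.reg v_clk = s.reg v_clk - k

/-- The bounds needed for the simulation. -/
structure SimFits (V : ℕ) : Prop extends C.Fits V where
  cap_eq : C.cap = 2 ^ C.capLog
  cap_le : 2 * C.cap * C.cap + C.capLog + 1 ≤ V

variable {C}

theorem SimInv.congr {s t : State} (h : C.SimInv s) (hr : ∀ x, x < 40 ∨ 100 ≤ x → t.reg x = s.reg x)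
    (hm : t.mem = s.mem) : C.SimInv t where
  holds := h.holds.congr (fun x hx => hr x (.inl hx)) fun x _ => by rw [hm]
  regs i := by rw [hr _ (.inr (Nat.le_add_right ..))]; exact h.regs i
  stamps a := by rw [hm]; exact h.stamps a

theorem Represents.congr {s t o : State} (h : C.Represents s o)
    (hr : ∀ x, 100 ≤ x → t.reg x = s.reg x) (hm : t.mem = s.mem) : C.Represents t o where
  reg i := by rw [hr _ (Nat.le_add_right ..)]; exact h.reg i
  mem a := by rw [hm]; exact h.mem a

end Ctx

namespace Prog

/-- `val :=` the simulated memory at the address `addr` -/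
def lazyLoad : Prog :=
  ite (.bin .xor (.load (𝕣 v_base + 2 * 𝕣 v_addr)) (𝕣 v_call)) fetch
    (assign v_val (.load (𝕣 v_base + 2 * 𝕣 v_addr + 1)))

/-- move a result to a simulated register, unless it is too large -/
def commit (i : ℕ) : Prog :=
  ite (𝕣 v_tmp - 𝕣 v_cap) (assign v_clk 0)
    (assign (v_sim + i) (𝕣 v_tmp) ;; assign v_clk (𝕣 v_clk - 1))

/-- A second operand that does not change results up to `2 ^ c`. -/
def _root_.FlowHardness.Op.clampArg (c y : ℕ) : Op → ℕ
  | .shl => min y (c + 1)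
  | _ => y

/-- restrict the second operand of an operation, without effect on results within the bound -/
def clamp : Op → Prog
  | .shl => ite (𝕣 v_arg - (𝕣 v_capLog + 1)) (assign v_arg (𝕣 v_capLog + 1)) skip
  | _ => skip

/-- The simulation of a program. -/
def sim : Prog → Prog
  | const i c => ite (𝕣 v_clk) (.const (2 * v_tmp) c ;; commit i) skip
  | op o i j k =>
    ite (𝕣 v_clk) (assign v_arg (.var (v_sim + k)) ;; clamp o ;; assignOp o v_tmp (v_sim + j) v_arg ;;
      commit i) skip
  | load i j =>
    ite (𝕣 v_clk) (assign v_addr (.var (v_sim + j)) ;; lazyLoad ;; assign v_tmp (𝕣 v_val) ;;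
      commit i) skip
  | store i j =>
    ite (𝕣 v_clk) (storeExp (𝕣 v_base + 2 * .var (v_sim + i)) (𝕣 v_call) ;;
      storeExp (𝕣 v_base + 2 * .var (v_sim + i) + 1) (.var (v_sim + j)) ;;
      assign v_clk (𝕣 v_clk - 1)) skip
  | seq p q => p.sim ;; q.sim
  | cond i p q => assign v_clk (𝕣 v_clk - 1) ;; ite (.var (v_sim + i)) p.sim q.sim
  | loop i p =>
    whileDo (.var (v_sim + i) * 𝕣 v_clk) (assign v_clk (𝕣 v_clk - 1) ;; p.sim) ;;
      assign v_clk (𝕣 v_clk - 1)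

/-- All constants in the program are at most `V`. -/
def ConstLe (V : ℕ) : Prog → Prop
  | const _ c => c ≤ V
  | op _ _ _ _ => True
  | load _ _ => True
  | store _ _ => True
  | seq p q => p.ConstLe V ∧ q.ConstLe V
  | cond _ p q => p.ConstLe V ∧ q.ConstLe V
  | loop _ p => p.ConstLe V

/-- The time of the simulation per step of the clock, for a formula of length `L`. -/
def simCost (L : ℕ) : Prog → ℕ
  | const _ _ => 100 * (L + 1) + 400
  | op _ _ _ _ => 100 * (L + 1) + 400
  | load _ _ => 100 * (L + 1) + 400
  | store _ _ => 100 * (L + 1) + 400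
  | seq p q => p.simCost L + q.simCost L
  | cond _ p q => p.simCost L + q.simCost L + 20
  | loop _ p => p.simCost L + 40

theorem touches_lazyLoad : lazyLoad.Touches fun x => 41 ≤ x ∧ x ≤ 56 := by
  simp [lazyLoad, touches_fetch]

theorem readOnly_lazyLoad : lazyLoad.ReadOnly := by simp [lazyLoad, readOnly_fetch]

end Prog

section
variable {V : ℕ} {C : Ctx}

theorem lazyLoad_spec {s : State} (hC : C.Holds s) (hV : C.Fits V) :
    Triple V .lazyLoad s (100 * (C.base + 1) + 320) fun t =>
      t.reg v_val = C.cell s.mem (s.reg v_addr) ∧ t.mem = s.mem ∧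
        ∀ x, ¬ (41 ≤ x ∧ x ≤ 56) → t.reg x = s.reg x := by
  suffices h : Triple V .lazyLoad s (100 * (C.base + 1) + 320) fun t =>
      t.reg v_val = C.cell s.mem (s.reg v_addr) from
    ((h.frame_mem Prog.readOnly_lazyLoad).frame Prog.touches_lazyLoad).mono le_rfl fun t ht =>
      ⟨ht.1.1, ht.1.2, ht.2⟩
  unfold Prog.lazyLoad Ctx.cell
  refine Triple.branch rfl (fun h => ?_) fun h => ?_
  · have h' : s.mem (C.base + 2 * s.reg v_addr) ≠ C.call := by simpa [hC.base, hC.call] using h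
    refine Triple.mono (fetch_spec hC hV) (by simp) fun t ht => ?_
    rw [if_neg h']
    exact ht.1
  · have h' : s.mem (C.base + 2 * s.reg v_addr) = C.call := by simpa [hC.base, hC.call] using h
    refine Triple.last rfl (fun hb => hb.mem _) ?_
    simp [h', hC.base]

theorem commit_spec {s : State} {i : ℕ} (hC : C.Holds s) :
    Triple V (.commit i) s 20 fun t =>
      (C.cap < s.reg v_tmp ∧ t = s.setReg v_clk 0) ∨
      (s.reg v_tmp ≤ C.cap ∧
        t = (s.setReg (v_sim + i) (s.reg v_tmp)).setReg v_clk (s.reg v_clk - 1)) := by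
  unfold Prog.commit
  refine Triple.of_bounded fun hb => Triple.branch rfl (fun h => ?_) fun h => ?_
  · refine Triple.last rfl (fun _ => Nat.zero_le _) (.inl ⟨?_, rfl⟩)
    simp [hC.cap] at h; omega
  · refine Triple.step rfl (fun _ => hb.reg _) (Triple.last rfl (fun _ => ?_) (.inr ⟨?_, ?_⟩))
    · simp [show 99 ≠ 100 + i by omega]
      exact (hb.reg _).trans (Nat.le_add_right _ _)
    · simp [hC.cap] at h; omega
    · simp [show 99 ≠ 100 + i by omega]

/-- The effect of `commit` in the simulation of an instruction that sets a register. -/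
theorem simStep_of_commit {p : Prog} {s r t : State} {i : ℕ} (hs : C.SimInv s)
    (hr : ∀ x, x < 40 ∨ 99 ≤ x → r.reg x = s.reg x) (hm : r.mem = s.mem)
    (hexec : ∀ o o' k B, C.Represents s o → Exec B p o o' k → B ≤ C.cap →
      k = 1 ∧ r.reg v_tmp ≤ C.cap ∧ o' = o.setReg i (r.reg v_tmp))
    (ht : (C.cap < r.reg v_tmp ∧ t = r.setReg v_clk 0) ∨
      (r.reg v_tmp ≤ C.cap ∧
        t = (r.setReg (v_sim + i) (r.reg v_tmp)).setReg v_clk (r.reg v_clk - 1))) :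
    C.SimStep p s t := by
  have hclk : r.reg v_clk = s.reg v_clk := hr _ (by norm_num)
  have hr' : C.SimInv r := hs.congr (fun x hx => hr x (by omega)) hm
  rcases ht with ⟨h, rfl⟩ | ⟨h, rfl⟩
  · refine ⟨hr'.congr (fun x hx => by simp [show x ≠ 99 by omega]) rfl, by simp, ?_⟩
    intro o o' k B ho he hB hk
    have := (hexec o o' k B ho he hB).2.1
    omega
  · refine ⟨⟨hr'.holds.congr (fun x hx => ?_) fun _ _ => rfl, fun j => ?_, hr'.stamps⟩, ?_, ?_⟩
    · simp [show x ≠ 99 by omega, show x ≠ 100 + i by omega]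
    · simp only [State.reg_setReg, show 100 + j ≠ 99 by omega, if_false]
      split_ifs
      exacts [h, hr'.regs j]
    · simp [hclk]
    · intro o o' k B ho he hB hk
      obtain ⟨rfl, -, rfl⟩ := hexec o o' k B ho he hB
      refine ⟨⟨fun j => ?_, fun a => ?_⟩, by simp [hclk]⟩
      · simp only [State.reg_setReg, show 100 + j ≠ 99 by omega, if_false, Nat.add_left_cancel_iff]
        split_ifs
        · rfl
        · rw [hr _ (by omega), ho.reg]
      · simp only [State.mem_setReg, hm]
        exact ho.mem a

/-- With an exhausted clock the simulation owes nothing: no `k` satisfies `k < 0`. This allows every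
instruction to be skipped from then on. -/
theorem simStep_of_clk_eq_zero {p : Prog} {s : State} (hs : C.SimInv s) (h : s.reg v_clk = 0) :
    C.SimStep p s s :=
  ⟨hs, le_rfl, fun _ _ _ _ _ _ _ hk => by omega⟩

/-- An unrestricted shift could produce a number of exponential length, which the simulating machine
cannot hold. With the shift amount capped at `c + 1`, every result is at most twice the square of
the bound and can be computed first and compared with the bound afterwards. -/
theorem Op.eval_clampArg_le {o : Op} {x y c : ℕ} (hx : x ≤ 2 ^ c) (hy : y ≤ 2 ^ c) :
    o.eval x (o.clampArg c y) ≤ 2 * 2 ^ c * 2 ^ c := by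
  have h1 : 1 ≤ 2 ^ c := Nat.one_le_two_pow
  have h2 : x + y ≤ 2 * 2 ^ c * 2 ^ c := by nlinarith
  cases o with
  | add => exact h2
  | sub => exact (Nat.sub_le _ _).trans ((Nat.le_add_right _ _).trans h2)
  | mul => exact (Nat.mul_le_mul hx hy).trans (by nlinarith)
  | div => exact (Nat.div_le_self _ _).trans ((Nat.le_add_right _ _).trans h2)
  | mod => exact (Nat.mod_le _ _).trans ((Nat.le_add_right _ _).trans h2)
  | and => exact Nat.and_le_left.trans ((Nat.le_add_right _ _).trans h2)
  | or => exact (Exp.or_le_add x y).trans h2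
  | xor => exact (Exp.xor_le_add x y).trans h2
  | shl =>
    have h3 : 2 ^ min y (c + 1) ≤ 2 ^ (c + 1) := Nat.pow_le_pow_right (by norm_num) (min_le_right _ _)
    simp only [Op.eval, Op.clampArg, Nat.shiftLeft_eq]
    exact (Nat.mul_le_mul hx h3).trans (by rw [pow_succ]; nlinarith)
  | shr => exact (Nat.shiftRight_le _ _).trans ((Nat.le_add_right _ _).trans h2)

theorem Op.eval_clampArg_eq {o : Op} {x y c : ℕ} (h : o.eval x y ≤ 2 ^ c) :
    o.eval x (o.clampArg c y) = o.eval x y := by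
  cases o with
  | shl =>
    simp only [Op.eval, Op.clampArg, Nat.shiftLeft_eq] at h ⊢
    rcases le_total y (c + 1) with hy | hy
    · rw [min_eq_left hy]
    · rcases Nat.eq_zero_or_pos x with rfl | hx
      · simp
      -- A positive number shifted by at least `c + 1` places is at least `2 ^ (c + 1)`, which
      -- contradicts `h`.
      · exfalso
        have h1 : 2 ^ (c + 1) ≤ 2 ^ y := Nat.pow_le_pow_right (by norm_num) hy
        have h2 : 2 ^ y ≤ x * 2 ^ y := Nat.le_mul_of_pos_left _ hx
        have h3 : 0 < 2 ^ c := by positivity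
        rw [pow_succ] at h1
        omega
  | _ => rfl

theorem clamp_spec {s : State} {o : Op} (hC : C.Holds s) (hV : C.SimFits V) :
    Triple V (.clamp o) s 20 fun t => t = s.setReg v_arg (o.clampArg C.capLog (s.reg v_arg)) := by
  have hcap := hV.cap_le
  have hsame : s.setReg v_arg (s.reg v_arg) = s := by
    simp [State.setReg]
  by_cases ho : o = .shl
  · subst ho
    unfold Prog.clamp Op.clampArg
    refine Triple.branch rfl (fun h => ?_) fun h => ?_
    · have h' : C.capLog + 1 < s.reg v_arg := by simp [hC.capLog] at h; omega
      refine Triple.last rfl (fun _ => by simp [hC.capLog]; omega) ?_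
      simp [h'.le, hC.capLog]
    · have h' : s.reg v_arg ≤ C.capLog + 1 := by simp [hC.capLog] at h; omega
      refine (Triple.skip ?_).le_time (by simp)
      simp [h', hsame]
  · have h1 : Prog.clamp o = .skip := by cases o <;> first | rfl | exact absurd rfl ho
    have h2 : o.clampArg C.capLog (s.reg v_arg) = s.reg v_arg := by
      cases o <;> first | rfl | exact absurd rfl ho
    rw [h1]
    refine (Triple.skip ?_).le_time (by simp)
    rw [h2, hsame]

theorem sim_const_spec {s : State} {i c : ℕ} (hc : c ≤ V) (hs : C.SimInv s) :
    Triple V (Prog.const i c).sim s (100 * (C.base + 1) + 400) (C.SimStep (.const i c) s) := by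
  unfold Prog.sim
  refine Triple.branch rfl (fun _ => ?_) fun h => ?_
  · refine Triple.seq' (Triple.constant hc ?_) (by simp)
    refine Triple.mono (commit_spec (C := C) ?_) (by simp) fun t ht => ?_
    · exact hs.holds.congr (fun x hx => by simp [show x ≠ 57 by omega]) fun _ _ => rfl
    · refine simStep_of_commit (r := s.setReg v_tmp c) hs (fun x hx => ?_) rfl ?_ ht
      · simp [show x ≠ 57 by omega]
      · intro o o' k B ho he hB
        cases he with
        | const _ _ _ h => exact ⟨rfl, by simpa using h.trans hB, by simp⟩
  · exact (Triple.skip (simStep_of_clk_eq_zero hs h)).le_time (by simp)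

theorem sim_op_spec {s : State} {o : Op} {i j k : ℕ} (hV : C.SimFits V) (hs : C.SimInv s) :
    Triple V (Prog.op o i j k).sim s (100 * (C.base + 1) + 400) (C.SimStep (.op o i j k) s) := by
  unfold Prog.sim
  have hcap := hV.cap_le
  have hregs := hs.regs
  refine Triple.of_bounded fun hb => Triple.branch rfl (fun _ => ?_) fun h => ?_
  · refine Triple.step rfl (fun _ => hb.reg _) ?_
    refine Triple.seq' (Triple.mono (clamp_spec (C := C) ?_ hV) le_rfl ?_) (by simp)
    · exact hs.holds.congr (fun x hx => by simp [show x ≠ 58 by omega]) fun _ _ => rfl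
    rintro t ht
    simp only [Exp.eval_var, State.reg_setReg, if_true] at ht
    have htj : t.reg (100 + j) = s.reg (100 + j) := by
      simp [ht, show 100 + j ≠ 58 by omega]
    have hta : t.reg v_arg = o.clampArg C.capLog (s.reg (100 + k)) := by simp [ht]
    have hval := Op.eval_clampArg_le (o := o) (hV.cap_eq ▸ hregs j) (hV.cap_eq ▸ hregs k)
    rw [← hta, ← htj, ← hV.cap_eq] at hval
    refine Triple.seq' (Triple.assignOp (fun _ => by omega) ?_) (by simp)
    refine Triple.mono (commit_spec (C := C) ?_) (by simp) fun r hr => ?_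
    · exact hs.holds.congr (fun x hx => by simp [ht, show x ≠ 57 by omega, show x ≠ 58 by omega])
        fun _ _ => by simp [ht]
    · refine simStep_of_commit hs (fun x hx => ?_) (by simp [ht]) ?_ hr
      · simp [ht, show x ≠ 57 by omega, show x ≠ 58 by omega]
      · intro q q' l B hq he hB
        cases he with
        | op _ _ _ _ _ h =>
          have h' : o.eval (q.reg j) (q.reg k) ≤ 2 ^ C.capLog := hV.cap_eq ▸ h.trans hB
          have heq : o.eval (t.reg (100 + j)) (t.reg v_arg) = o.eval (q.reg j) (q.reg k) := by
            rw [hta, htj, hq.reg, hq.reg, Op.eval_clampArg_eq h']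
          refine ⟨rfl, ?_, ?_⟩
          · simpa [heq] using h.trans hB
          · simp [heq]
  · exact (Triple.skip (simStep_of_clk_eq_zero hs h)).le_time (by simp)

theorem sim_load_spec {s : State} {i j : ℕ} (hV : C.Fits V) (hs : C.SimInv s) :
    Triple V (Prog.load i j).sim s (100 * (C.base + 1) + 400) (C.SimStep (.load i j) s) := by
  unfold Prog.sim
  refine Triple.of_bounded fun hb => Triple.branch rfl (fun _ => ?_) fun h => ?_
  · refine Triple.step rfl (fun _ => hb.reg _) ?_
    refine Triple.seq' (Triple.mono (lazyLoad_spec (C := C) ?_ hV) le_rfl ?_) (by simp)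
    · exact hs.holds.congr (fun x hx => by simp [show x ≠ 40 by omega]) fun _ _ => rfl
    rintro t ⟨ht1, ht2, ht3⟩
    simp at ht1 ht2
    have hreg : ∀ x, x < 40 ∨ 99 ≤ x → t.reg x = s.reg x := fun x hx => by
      rw [ht3 x (by omega)]; simp [show x ≠ 40 by omega]
    refine Triple.of_bounded fun hbt => ?_
    refine Triple.step rfl (fun _ => hbt.reg _) ?_
    refine Triple.mono (commit_spec (C := C) ?_) (by simp) fun r hr => ?_
    · exact hs.holds.congr (fun x hx => by simp [hreg x (.inl hx), show x ≠ 57 by omega])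
        fun _ _ => by simp [ht2]
    · refine simStep_of_commit hs (fun x hx => ?_) (by simp [ht2]) ?_ hr
      · simp [hreg x hx, show x ≠ 57 by omega]
      · intro q q' l B hq he hB
        cases he with
        | load _ _ _ h =>
          have heq : t.reg v_val = q.mem (q.reg j) := by rw [ht1, hq.reg, hq.mem]
          refine ⟨rfl, ?_, ?_⟩
          · simpa [heq] using h.trans hB
          · simp [heq]
  · exact (Triple.skip (simStep_of_clk_eq_zero hs h)).le_time (by simp)

theorem sim_store_spec {s : State} {i j : ℕ} (hs : C.SimInv s) :
    Triple V (Prog.store i j).sim s (100 * (C.base + 1) + 400) (C.SimStep (.store i j) s) := by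
  unfold Prog.sim
  refine Triple.of_bounded fun hb => Triple.branch rfl (fun _ => ?_) fun h => ?_
  · have hbase := hs.holds.base
    have hcall := hs.holds.call
    refine Triple.seq' (Triple.storeExp rfl rfl (fun _ => hb.reg _) ?_) (by simp)
    refine Triple.seq' (Triple.storeExp rfl rfl (fun _ => hb.reg _) ?_) (by simp)
    refine Triple.last rfl (fun _ => (Nat.sub_le _ _).trans (hb.reg _)) ?_
    simp [hbase, hcall]
    refine ⟨⟨hs.holds.congr (fun x hx => by simp [show x ≠ 99 by omega]) fun x hx => ?_,
      fun l => ?_, fun a => ?_⟩, by simp, ?_⟩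
    · simp [show x ≠ C.base + 2 * s.reg (100 + i) + 1 by omega,
        show x ≠ C.base + 2 * s.reg (100 + i) by omega]
    · simpa [show 100 + l ≠ 99 by omega] using hs.regs l
    · simp only [State.mem_setReg, State.mem_setMem]
      rw [if_neg (by omega)]
      split_ifs
      exacts [le_rfl, hs.stamps a]
    · intro o o' k B ho he hB hk
      cases he with
      | store =>
        refine ⟨⟨fun l => ?_, fun a => ?_⟩, by simp⟩
        · simpa [show 100 + l ≠ 99 by omega] using ho.reg l
        · simp only [State.mem_setReg, State.mem_setMem, Ctx.cell, ← ho.reg]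
          by_cases ha : a = s.reg (100 + i)
          · simp [ha]
          -- Stamps and values sit at offsets of different parity, so a store affects no other
          -- simulated cell.
          · have h1 : C.base + 2 * a ≠ C.base + 2 * s.reg (100 + i) + 1 := by omega
            have h2 : C.base + 2 * a ≠ C.base + 2 * s.reg (100 + i) := by omega
            have h3 : C.base + 2 * a + 1 ≠ C.base + 2 * s.reg (100 + i) + 1 := by omega
            have h4 : C.base + 2 * a + 1 ≠ C.base + 2 * s.reg (100 + i) := by omega
            simp only [h1, h2, h3, h4, ha, if_false]
            exact ho.mem a
  · exact (Triple.skip (simStep_of_clk_eq_zero hs h)).le_time (by simp)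

end

end FlowHardness

/-! ### Correctness and amortised running time of the simulation. -/

namespace FlowHardness

section
variable {V : ℕ} {C : Ctx}

theorem Ctx.SimInv.setClk {s : State} (hs : C.SimInv s) (v : ℕ) : C.SimInv (s.setReg v_clk v) :=
  hs.congr (fun x hx => by simp [show x ≠ 99 by omega]) rfl

theorem Ctx.Represents.setClk {s o : State} (hs : C.Represents s o) (v : ℕ) :
    C.Represents (s.setReg v_clk v) o :=
  hs.congr (fun x hx => by simp [show x ≠ 99 by omega]) rfl

/-- The summand `1` in `s.reg v_clk + 1` pays for a basic instruction even if the clock does not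
move, as happens when it already stands at zero. -/
theorem Triple.runs_of_simStep {p q : Prog} {s : State} {D : ℕ} (hb : Bounded V s)
    (h : Triple V q s D (C.SimStep p s)) :
    ∃ t k, Runs V q s t k ∧ k + D * t.reg v_clk ≤ D * (s.reg v_clk + 1) ∧ Bounded V t ∧
      C.SimStep p s t := by
  obtain ⟨t, hr, hb', h⟩ := h hb
  refine ⟨t, D, hr, ?_, hb', h⟩
  rw [mul_add, mul_one, add_comm]
  exact Nat.add_le_add_right (Nat.mul_le_mul_left _ h.clk_le) _

theorem runs_decrement {s : State} (hb : Bounded V s) :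
    Runs V (.assign v_clk (𝕣 v_clk - 1)) s (s.setReg v_clk (s.reg v_clk - 1)) 4 ∧
      Bounded V (s.setReg v_clk (s.reg v_clk - 1)) := by
  obtain ⟨t, hr, hb', rfl⟩ := Triple.assign (V := V) (s := s) (x := v_clk) (e := 𝕣 v_clk - 1)
    (Q := fun t => t = s.setReg v_clk (s.reg v_clk - 1)) rfl
    (fun _ => (Nat.sub_le _ _).trans (hb.reg _)) rfl hb
  exact ⟨hr, hb'⟩

/-- The simulation always stops, in time proportional to the elapsed time on the clock; and it is
correct as long as the clock has not run out. -/
theorem sim_spec (hV : C.SimFits V) {p : Prog} (hp : p.ConstLe V) {s : State} (hb : Bounded V s)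
    (hs : C.SimInv s) :
    ∃ t k, Runs V p.sim s t k ∧
      k + p.simCost C.base * t.reg v_clk ≤ p.simCost C.base * (s.reg v_clk + 1) ∧ Bounded V t ∧
      C.SimStep p s t := by
  induction p generalizing s with
  | const i c => exact (sim_const_spec hp hs).runs_of_simStep hb
  | op o i j k => exact (sim_op_spec hV hs).runs_of_simStep hb
  | load i j => exact (sim_load_spec hV.toFits hs).runs_of_simStep hb
  | store i j => exact (sim_store_spec hs).runs_of_simStep hb
  | seq p q ihp ihq =>
    obtain ⟨t, k, hr, hk, hb₁, h₁⟩ := ihp hp.1 hb hs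
    obtain ⟨u, l, hr', hl, hb₂, h₂⟩ := ihq hp.2 hb₁ h₁.inv
    refine ⟨u, k + l, hr.seq hr', ?_, hb₂, h₂.inv, h₂.clk_le.trans h₁.clk_le, ?_⟩
    -- The clock serves as a potential. Each part charges its own coefficient for the ticks that it
    -- consumes, and these are among the ticks consumed by the whole.
    · have h3 := h₁.clk_le
      have h4 := h₂.clk_le
      simp only [Prog.simCost]
      generalize p.simCost C.base = A at *
      generalize q.simCost C.base = B at *
      have h5 : A * u.reg v_clk ≤ A * t.reg v_clk := Nat.mul_le_mul_left _ h4
      have h6 : B * t.reg v_clk ≤ B * s.reg v_clk := Nat.mul_le_mul_left _ h3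
      simp only [mul_add, add_mul, mul_one] at *
      omega
    · intro o o' m B ho he hB hm
      cases he with
      | seq he₁ he₂ =>
        obtain ⟨ho₁, hc₁⟩ := h₁.exec _ _ _ _ ho he₁ hB (by omega)
        obtain ⟨ho₂, hc₂⟩ := h₂.exec _ _ _ _ ho₁ he₂ hB (by omega)
        exact ⟨ho₂, by omega⟩
  | cond i p q ihp ihq =>
    obtain ⟨hr₀, hb₀⟩ := runs_decrement hb
    set s₀ := s.setReg v_clk (s.reg v_clk - 1) with hs₀
    have hi₀ : C.SimInv s₀ := hs.setClk _
    have hc₀ : s₀.reg v_clk = s.reg v_clk - 1 := by simp [hs₀]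
    have hri : ∀ i, s₀.reg (v_sim + i) = s.reg (v_sim + i) := fun i => by
      simp [hs₀, show 100 + i ≠ 99 by omega]
    by_cases h : s₀.reg (v_sim + i) = 0
    · obtain ⟨t, k, hr, hk, hb₁, h₁⟩ := ihq hp.2 hb₀ hi₀
      refine ⟨t, _, hr₀.seq (Runs.ite_false hb₀ rfl h hr), ?_, hb₁, h₁.inv, ?_, ?_⟩
      · have h3 := h₁.clk_le
        simp only [Prog.simCost, Exp.size_var]
        generalize p.simCost C.base = A at *
        generalize q.simCost C.base = B at *
        have h5 : A * t.reg v_clk ≤ A * s.reg v_clk := Nat.mul_le_mul_left _ (by omega)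
        have h6 : B * s₀.reg v_clk ≤ B * s.reg v_clk := Nat.mul_le_mul_left _ (by omega)
        simp only [mul_add, add_mul, mul_one] at *
        omega
      · exact h₁.clk_le.trans (by omega)
      · intro o o' m B ho he hB hm
        cases he with
        | cond_true h' _ => exact absurd ((ho.reg i).symm.trans ((hri i).symm.trans h)) h'
        | cond_false _ he =>
          obtain ⟨ho₁, hc₁⟩ := h₁.exec _ _ _ _ (ho.setClk _) he hB (by omega)
          exact ⟨ho₁, by omega⟩
    · obtain ⟨t, k, hr, hk, hb₁, h₁⟩ := ihp hp.1 hb₀ hi₀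
      refine ⟨t, _, hr₀.seq (Runs.ite_true hb₀ rfl h hr), ?_, hb₁, h₁.inv, ?_, ?_⟩
      · have h3 := h₁.clk_le
        simp only [Prog.simCost, Exp.size_var]
        generalize p.simCost C.base = A at *
        generalize q.simCost C.base = B at *
        have h5 : B * t.reg v_clk ≤ B * s.reg v_clk := Nat.mul_le_mul_left _ (by omega)
        have h6 : A * s₀.reg v_clk ≤ A * s.reg v_clk := Nat.mul_le_mul_left _ (by omega)
        simp only [mul_add, add_mul, mul_one] at *
        omega
      · exact h₁.clk_le.trans (by omega)
      · intro o o' m B ho he hB hm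
        cases he with
        | cond_false h' _ => exact absurd ((hri i).trans ((ho.reg i).trans h')) h
        | cond_true _ he =>
          obtain ⟨ho₁, hc₁⟩ := h₁.exec _ _ _ _ (ho.setClk _) he hB (by omega)
          exact ⟨ho₁, by omega⟩
  | loop i p ih =>
    -- Every iteration consumes at least one tick, so induction on the clock proves termination for
    -- an arbitrary body. In the time relation `k` exceeds the consumed ticks by one: the step of
    -- the last, failing test is taken off the clock only after the loop.
    have hloop : ∀ n, ∀ s : State, s.reg v_clk = n → Bounded V s → C.SimInv s →
        ∃ t k, Runs V (.whileDo (.var (v_sim + i) * 𝕣 v_clk) (.assign v_clk (𝕣 v_clk - 1) ;; p.sim))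
          s t k ∧ k + (p.simCost C.base + 10) * t.reg v_clk ≤
            (p.simCost C.base + 10) * (s.reg v_clk) + 10 ∧ Bounded V t ∧ C.SimInv t ∧
          t.reg v_clk ≤ s.reg v_clk ∧ ∀ o o' k B, C.Represents s o → Exec B (.loop i p) o o' k →
            B ≤ C.cap → k < s.reg v_clk → C.Represents t o' ∧ t.reg v_clk + k = s.reg v_clk + 1 := by
      intro n
      induction n using Nat.strong_induction_on with
      | _ n ihn =>
        intro s hn hb hs
        by_cases h : (Exp.var (v_sim + i) * 𝕣 v_clk).eval s = 0
        · refine ⟨s, _, Runs.whileDo_done hb rfl h, by simp; omega, hb, hs, le_rfl, ?_⟩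
          intro o o' k B ho he hB hk
          -- The guard is a product. Since `k < s.reg v_clk`, the clock is not zero, so it is the
          -- simulated register that vanishes.
          have h0 : o.reg i = 0 := by
            simp at h
            rw [← ho.reg]
            omega
          cases he with
          | loop_done _ => exact ⟨ho, rfl⟩
          | loop_step h' _ _ => exact absurd h0 h'
        · have h0 : s.reg (v_sim + i) ≠ 0 ∧ s.reg v_clk ≠ 0 := by simpa using h
          obtain ⟨hr₀, hb₀⟩ := runs_decrement hb
          set s₀ := s.setReg v_clk (s.reg v_clk - 1) with hs₀
          have hi₀ : C.SimInv s₀ := hs.setClk _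
          have hc₀ : s₀.reg v_clk = s.reg v_clk - 1 := by simp [hs₀]
          obtain ⟨t, k, hr, hk, hb₁, h₁⟩ := ih hp hb₀ hi₀
          have hc₁ := h₁.clk_le
          obtain ⟨u, l, hr', hl, hb₂, hi₂, hc₂, hex⟩ := ihn (t.reg v_clk) (by omega) t rfl hb₁ h₁.inv
          refine ⟨u, _, Runs.whileDo_step hb rfl h (hr₀.seq hr) hr', ?_, hb₂, hi₂, by omega, ?_⟩
          · simp only [Exp.size_mul, Exp.size_var]
            generalize p.simCost C.base = A at *
            have h5 : s₀.reg v_clk + 1 = s.reg v_clk := by omega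
            rw [h5] at hk
            simp only [add_mul] at *
            omega
          · intro o o' m B ho he hB hm
            cases he with
            | loop_done h' => exact absurd ((ho.reg i).trans h') h0.1
            | loop_step _ he₁ he₂ =>
              obtain ⟨ho₁, hc₁⟩ := h₁.exec _ _ _ _ (ho.setClk _) he₁ hB (by omega)
              obtain ⟨ho₂, hc₂⟩ := hex _ _ _ _ ho₁ he₂ hB (by omega)
              exact ⟨ho₂, by omega⟩
    obtain ⟨t, k, hr, hk, hb₁, hi₁, hc₁, hex⟩ := hloop _ s rfl hb hs
    obtain ⟨hr₀, hb₀⟩ := runs_decrement hb₁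
    refine ⟨_, _, hr.seq hr₀, ?_, hb₀, hi₁.setClk _, ?_, ?_⟩
    · simp only [Prog.simCost, State.reg_setReg, if_true]
      generalize p.simCost C.base = A at *
      have h5 : A * (t.reg v_clk - 1) ≤ A * t.reg v_clk := Nat.mul_le_mul_left _ (by omega)
      simp only [mul_add, add_mul, mul_one] at *
      omega
    · simp; omega
    · intro o o' m B ho he hB hm
      obtain ⟨ho₁, hc₁⟩ := hex _ _ _ _ ho he hB hm
      exact ⟨ho₁.setClk _, by simp; omega⟩

/-- For a fixed program the overhead per simulated step is linear in the length of the formula,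
hence only a polynomial factor in the total time. -/
theorem Prog.exists_simCost_le (p : Prog) : ∃ D, ∀ L, p.simCost L ≤ D * (L + 1) := by
  induction p with
  | const | op | load | store => exact ⟨500, fun L => by simp only [simCost]; omega⟩
  | seq p q hp hq =>
    obtain ⟨D, hD⟩ := hp
    obtain ⟨E, hE⟩ := hq
    exact ⟨D + E, fun L => by
      have h1 := hD L; have h2 := hE L
      simp only [simCost, add_mul] at *; omega⟩
  | cond i p q hp hq =>
    obtain ⟨D, hD⟩ := hp
    obtain ⟨E, hE⟩ := hq
    exact ⟨D + E + 20, fun L => by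
      have h1 := hD L; have h2 := hE L
      simp only [simCost, add_mul] at *; omega⟩
  | loop i p hp =>
    obtain ⟨D, hD⟩ := hp
    exact ⟨D + 40, fun L => by
      have h1 := hD L
      simp only [simCost, add_mul] at *; omega⟩

theorem Prog.exists_constLe (p : Prog) : ∃ c, ∀ V, c ≤ V → p.ConstLe V := by
  induction p with
  | const i c => exact ⟨c, fun V h => h⟩
  | op | load | store => exact ⟨0, fun V h => trivial⟩
  | seq p q hp hq =>
    obtain ⟨c, hc⟩ := hp
    obtain ⟨d, hd⟩ := hq
    exact ⟨max c d, fun V h => ⟨hc V (by omega), hd V (by omega)⟩⟩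
  | cond i p q hp hq =>
    obtain ⟨c, hc⟩ := hp
    obtain ⟨d, hd⟩ := hq
    exact ⟨max c d, fun V h => ⟨hc V (by omega), hd V (by omega)⟩⟩
  | loop i p hp => exact hp

end

end FlowHardness

namespace FlowHardness

/-! ### The reduction -/

namespace Prog

/-- set the first `R` simulated registers to zero -/
def clearRegs : ℕ → Prog
  | 0 => skip
  | R + 1 => clearRegs R ;; assign (v_sim + R) 0

/-- run the simulation of `p` on the flow instance with the present parameters, and put into
`found` whether there is a source and a sink with a flow of less than `X` -/
def decideFlow (p : Prog) (R : ℕ) : Prog :=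
  assign v_call (𝕣 v_call + 1) ;; clearRegs R ;; assign v_clk (𝕣 v_budget) ;; p.sim ;;
  assign v_found 0 ;; assign v_row (𝕣 v_S * 𝕣 v_T) ;;
  forDo v_idx v_row
    (assign v_addr (.var v_sim + 𝕣 v_idx) ;; lazyLoad ;; ite (𝕣 v_X - 𝕣 v_val) (assign v_found 1) skip)

theorem touches_clearRegs (R : ℕ) : (clearRegs R).Touches fun x => 100 ≤ x ∧ x < 100 + R := by
  induction R with
  | zero => simp [clearRegs]
  | succ R ih =>
    exact ⟨ih.mono fun x hx => by omega, (touches_assign _).2 (by omega)⟩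

theorem readOnly_clearRegs (R : ℕ) : (clearRegs R).ReadOnly := by
  induction R with
  | zero => simp [clearRegs]
  | succ R ih => exact ⟨ih, readOnly_assign⟩

/-- The simulation writes to finitely many simulated registers. -/
theorem exists_touches_sim (p : Prog) :
    ∃ R, ∀ R', R ≤ R' → p.sim.Touches fun x => 40 ≤ x ∧ x < 100 + R' := by
  have h : ∀ R', lazyLoad.Touches fun x => 40 ≤ x ∧ x < 100 + R' := fun R' =>
    touches_lazyLoad.mono fun x hx => by omega
  have h2 : ∀ i R', i < R' → (commit i).Touches fun x => 40 ≤ x ∧ x < 100 + R' := fun i R' hi => by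
    simp [commit]; omega
  induction p with
  | const i c =>
    exact ⟨i + 1, fun R' h' => by simp [sim, h2 i R' h']; simp [Touches]; omega⟩
  | op o i j k =>
    have h3 : ∀ R', (clamp o).Touches fun x => 40 ≤ x ∧ x < 100 + R' := fun R' => by
      cases o <;> simp [clamp]; omega
    exact ⟨i + 1, fun R' h' => by simp [sim, h2 i R' h', h3]; omega⟩
  | load i j => exact ⟨i + 1, fun R' h' => by simp [sim, h2 i R' h', h]; omega⟩
  | store i j => exact ⟨0, fun R' _ => by simp [sim]; omega⟩
  | seq p q hp hq =>
    obtain ⟨R, hR⟩ := hp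
    obtain ⟨R', hR'⟩ := hq
    exact ⟨max R R', fun r hr => ⟨hR r (by omega), hR' r (by omega)⟩⟩
  | cond i p q hp hq =>
    obtain ⟨R, hR⟩ := hp
    obtain ⟨R', hR'⟩ := hq
    exact ⟨max R R', fun r hr => by
      simp [sim, hR r (by omega), hR' r (by omega)]; omega⟩
  | loop i p hp =>
    obtain ⟨R, hR⟩ := hp
    exact ⟨R, fun r hr => by simp [sim, hR r hr]; omega⟩

end Prog

/-- Between two calls of the simulation no cell of the simulated memory carries a future stamp,
and only the first `R` simulated registers are in use. -/
structure Ready (base R : ℕ) (s : State) : Prop where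
  stamps : ∀ a, s.mem (base + 2 * a) ≤ s.reg v_call
  zeros : ∀ i, R ≤ i → s.reg (v_sim + i) = 0

theorem Ready.congr {base R : ℕ} {s t : State} (h : Ready base R s) (hc : t.reg v_call = s.reg v_call)
    (hr : ∀ x, 100 ≤ x → t.reg x = s.reg x) (hm : t.mem = s.mem) : Ready base R t where
  stamps a := by rw [hm, hc]; exact h.stamps a
  zeros i hi := by rw [hr _ (Nat.le_add_right ..)]; exact h.zeros i hi

section
variable {V : ℕ} {C : Ctx} {p : Prog} {R : ℕ}

theorem clearRegs_spec (s : State) : Triple V (.clearRegs R) s (2 * R + 1) fun t =>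
    (∀ i < R, t.reg (v_sim + i) = 0) ∧ t.mem = s.mem ∧
      ∀ x, ¬ (100 ≤ x ∧ x < 100 + R) → t.reg x = s.reg x := by
  suffices h : Triple V (.clearRegs R) s (2 * R + 1) fun t => ∀ i < R, t.reg (v_sim + i) = 0 from
    ((h.frame_mem (Prog.readOnly_clearRegs R)).frame (Prog.touches_clearRegs R)).mono le_rfl
      fun t ht => ⟨ht.1.1, ht.1.2, ht.2⟩
  induction R with
  | zero => exact (Triple.skip (by simp)).le_time (by omega)
  | succ R ih =>
    refine (Triple.seq (Triple.mono ih le_rfl fun t ht => ?_)).le_time (T₁ := 2 * R + 1 + 2) (by omega)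
    refine Triple.last rfl (fun _ => Nat.zero_le _) fun i hi => ?_
    simp only [State.reg_setReg, Exp.eval_zero]
    split_ifs with h
    · rfl
    · exact ht i (by omega)

/-- The running time of `decideFlow`. -/
def decideCost (p : Prog) (R : ℕ) (C : Ctx) : ℕ :=
  2 * R + p.simCost C.base * (C.budget + 1) + C.budget * (100 * (C.base + 1) + 392 + 8) + 40

/-- Termination within the stated time and readiness for the next call hold for any simulated
program. Only the meaning of `v_found` depends on a run that stays within the clock and the value
bound. -/
theorem decideFlow_spec (hR : p.sim.Touches fun x => 40 ≤ x ∧ x < 100 + R) (hV : C.SimFits V)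
    (hp : p.ConstLe V) (hcall : C.call + 1 ≤ V) (hST : C.cap + C.S * C.T ≤ V)
    (hbud : C.S * C.T ≤ C.budget)
    {s : State} (hC : C.Holds s) (hr : Ready C.base R s) :
    Triple V (.decideFlow p R) s (decideCost p R C) fun t =>
      ({C with call := C.call + 1} : Ctx).Holds t ∧ Ready C.base R t ∧
      (∀ x < 40, x ≠ v_call → t.reg x = s.reg x) ∧
      ∀ o k B, Exec B p ⟨fun _ => 0, C.word⟩ o k → B ≤ C.cap → k < C.budget →
        (t.reg v_found ≠ 0 ↔ ∃ i < C.S * C.T, o.mem (o.reg 0 + i) < C.X) := by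
  set C' : Ctx := {C with call := C.call + 1} with hC'
  have hV' : C'.SimFits V := ⟨⟨hV.base_eq, hV.m_pos, hV.node_le, hV.edge_le, hV.patch_le⟩, hV.cap_eq, hV.cap_le⟩
  unfold Prog.decideFlow decideCost
  have hcost : C.S * C.T * (100 * (C.base + 1) + 392 + 8) ≤
      C.budget * (100 * (C.base + 1) + 392 + 8) := Nat.mul_le_mul_right _ hbud
  refine Triple.of_bounded fun hb => ?_
  refine Triple.step rfl (fun _ => by simpa [hC.call] using hcall) ?_
  refine Triple.seq' (Triple.mono (clearRegs_spec _) le_rfl ?_) (by simp; omega)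
  rintro t ⟨ht1, ht2, ht3⟩
  simp only [Exp.eval_add, Exp.eval_var, Exp.eval_one, hC.call] at ht2 ht3
  simp only [State.mem_setReg] at ht2
  have htr : ∀ x < 100, t.reg x = if x = 18 then C.call + 1 else s.reg x := fun x hx => by
    rw [ht3 x (by omega), State.reg_setReg]
  have hhold : C'.Holds t := by
    have := hC.mem
    constructor
    case mem => rw [ht2]; exact hC.mem
    all_goals rw [htr _ (by norm_num)]
    all_goals norm_num
    exacts [hC.m, hC.n, hC.base, hC.H, hC.cap, hC.capLog, hC.budget, hC.a, hC.b, hC.S, hC.T, hC.N, hC.X, hC.thr, hC.pow, hC.fix, rfl]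
  -- The simulation never writes to registers from `R` on, so clearing the first `R` restores the
  -- initial configuration.
  have hzero : ∀ i, t.reg (100 + i) = 0 := fun i => by
    by_cases hi : i < R
    · exact ht1 i hi
    · rw [ht3 _ (by omega), State.reg_setReg, if_neg (by omega)]
      exact hr.zeros i (by omega)
  refine Triple.of_bounded fun hbt => ?_
  refine Triple.step rfl (fun _ => hbt.reg _) ?_
  set t₁ := t.setReg v_clk ((𝕣 v_budget : Exp).eval t) with ht₁
  have hclk : t₁.reg v_clk = C.budget := by simp [ht₁, hhold.budget, hC']
  have hinv : C'.SimInv t₁ := by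
    refine ⟨hhold.congr (fun x hx => by simp [ht₁, show x ≠ 99 by omega]) fun _ _ => rfl,
      fun i => ?_, fun a => ?_⟩
    · simp [ht₁, hzero, show 100 + i ≠ 99 by omega]
    · have := hr.stamps a
      rw [hC.call] at this
      simp only [ht₁, State.mem_setReg, ht2]
      exact this.trans (Nat.le_succ _)
  -- The new call number exceeds all stamps. Every cell thus counts as unwritten and reads as an
  -- input word.
  have hrep : C'.Represents t₁ ⟨fun _ => 0, C.word⟩ := by
    refine ⟨fun i => ?_, fun a => ?_⟩
    · simp [ht₁, hzero, show 100 + i ≠ 99 by omega]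
    · have := hr.stamps a
      rw [hC.call] at this
      simp only [ht₁, State.mem_setReg, ht2, Ctx.cell]
      rw [if_neg]
      · rfl
      · simp only [hC']
        omega
  have hsim : Triple V p.sim t₁ (p.simCost C.base * (C.budget + 1)) (C'.SimStep p t₁) := fun hb₁ => by
    obtain ⟨u, k, hru, hk, hbu, hu⟩ := sim_spec hV' hp hb₁ hinv
    refine ⟨u, hru.mono ?_, hbu, hu⟩
    rw [hclk] at hk
    exact (Nat.le_add_right _ _).trans hk
  refine Triple.seq' (Triple.mono (hsim.frame hR) le_rfl ?_) (by simp; omega)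
  rintro u ⟨hu, hufr⟩
  refine Triple.step rfl (fun _ => Nat.zero_le _) ?_ (by simp; omega)
  refine Triple.step rfl (fun _ => ?_) ?_ (by simp; omega)
  · simp [hu.inv.holds.S, hu.inv.holds.T, hC']; omega
  have aux : ∀ r x y : ℕ, y + 6 ≤ 2 * r + x + y + 40 - 4 - (2 * r + 1) - 2 - x - 2 - 4 := by omega
  refine Triple.le_time (Triple.forDo (N := C.S * C.T) (T := 100 * (C.base + 1) + 392)
    (fun j r => r.mem = u.mem ∧ (∀ x, (x < 40 ∨ 100 ≤ x) → r.reg x = u.reg x) ∧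
      (r.reg v_found ≠ 0 ↔ ∃ i < j, C'.cell u.mem (u.reg 100 + i) < C.X))
    ?_ (by norm_num) ?_ ?_ ?_ ?_) (le_trans (Nat.add_le_add_right hcost 6) (aux _ _ _))
  · simp [hu.inv.holds.S, hu.inv.holds.T, hC']
  · have := Prog.touches_lazyLoad.mono (A' := fun x => x ≠ 61 ∧ x ≠ 62) fun x hx => by omega
    simp [this]
  · refine ⟨rfl, fun x hx => ?_, by simp⟩
    simp [show x ≠ 60 by omega, show x ≠ 61 by omega, show x ≠ 62 by omega]
  · rintro j hj r hrj hrN ⟨h1, h2, h3⟩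
    have hholdr : C'.Holds r := hu.inv.holds.congr (fun x hx => h2 x (.inl hx)) fun _ _ => by rw [h1]
    refine Triple.step rfl (fun _ => ?_) ?_
    · have := hu.inv.regs 0
      simp [hrj, h2]
      simp [hC'] at this
      omega
    refine Triple.seq' (Triple.mono (lazyLoad_spec (C := C') ?_ hV'.toFits) le_rfl ?_) (by simp [hC'])
    · exact hholdr.congr (fun x hx => by simp [show x ≠ 40 by omega]) fun _ _ => rfl
    rintro w ⟨hw1, hw2, hw3⟩
    simp [h1, hrj, h2] at hw1 hw2
    have hwX : w.reg v_X = C.X := by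
      rw [hw3 _ (by norm_num)]
      simpa using hholdr.X
    have hreg : ∀ x, x < 40 ∨ 57 ≤ x → w.reg x = r.reg x := fun x hx => by
      rw [hw3 x (by omega), State.reg_setReg, if_neg (by omega)]
    refine Triple.branch rfl (fun h => ?_) (fun h => ?_) (by simp [hC'])
    · have h' : C'.cell u.mem (u.reg 100 + j) < C.X := by simp [hwX, hw1] at h; omega
      refine Triple.last rfl (fun hb => ?_) ⟨?_, fun x hx => ?_, ?_⟩ (by simp [hC'])
      · have := hb.eight_le; simp; omega
      · simpa using hw2
      · simp [show x ≠ 60 by omega, show x ≠ 61 by omega]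
        rw [hreg x (by omega), h2 x hx]
      · simp
        exact ⟨j, le_rfl, h'⟩
    · have h' : ¬ C'.cell u.mem (u.reg 100 + j) < C.X := by simp [hwX, hw1] at h; omega
      refine Triple.le_time (Triple.skip ⟨?_, fun x hx => ?_, ?_⟩) (by simp [hC'])
      · simpa using hw2
      · simp [show x ≠ 61 by omega]
        rw [hreg x (by omega), h2 x hx]
      · simp only [State.reg_setReg]
        norm_num only [if_false]
        rw [hreg _ (by norm_num), h3]
        constructor
        · rintro ⟨i, hi, hi'⟩
          exact ⟨i, by omega, hi'⟩
        · rintro ⟨i, hi, hi'⟩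
          rcases Nat.lt_succ_iff_lt_or_eq.1 hi with hi | rfl
          exacts [⟨i, hi, hi'⟩, absurd hi' h']
  · rintro r - ⟨h1, h2, h3⟩
    refine ⟨hu.inv.holds.congr (fun x hx => h2 x (.inl hx)) fun _ _ => by rw [h1], ⟨fun a => ?_, fun i hi => ?_⟩,
      fun x hx hx' => ?_, fun o k B he hB hk => ?_⟩
    · rw [h1, h2 _ (by norm_num), hu.inv.holds.call]
      exact hu.inv.stamps a
    · rw [h2 _ (by omega), hufr _ (by omega)]
      simp [ht₁, hzero, show 100 + i ≠ 99 by omega]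
    · rw [h2 _ (.inl hx), hufr _ (by omega), ht₁, State.reg_setReg, if_neg (by omega), htr _ (by omega),
        if_neg hx']
    · obtain ⟨ho, -⟩ := hu.exec _ _ _ _ hrep he hB (by omega)
      rw [h3]
      have h0 := ho.reg 0
      simp only [add_zero] at h0
      simp only [ho.mem, h0]

end

end FlowHardness

/-! ### Searching for an assignment bit by bit, and counting the clauses it satisfies. -/

namespace FlowHardness

/-- The clause number `i` is not satisfied by the assignment given by the bits of `w`. -/
def ClauseUnsat (mem : ℕ → ℕ) (w i : ℕ) : Prop :=
  ∀ l < mem (clausePtr mem i),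
    (w >>> (mem (clausePtr mem i + 1 + l) / 2)) % 2 ≠ mem (clausePtr mem i + 1 + l) % 2

instance (mem : ℕ → ℕ) (w i : ℕ) : Decidable (ClauseUnsat mem w i) :=
  inferInstanceAs (Decidable (∀ l < _, _))

/-- The number of clauses among the first `m` that the assignment `w` does not satisfy. -/
def numUnsat (mem : ℕ → ℕ) (m w : ℕ) : ℕ := ((Finset.range m).filter (ClauseUnsat mem w)).card

/-- The two sides partition the variables, with the middle variables belonging to side `0`. A clause
is falsified if and only if all its literals on either side are. -/
theorem Ctx.unsat_and_unsat {C : Ctx} {w i : ℕ} :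
    C.Unsat 0 w i ∧ C.Unsat 1 w i ↔ ClauseUnsat C.mem w i := by
  constructor
  · rintro ⟨h0, h1⟩ l hl he
    by_cases h : C.a ≤ C.mem (clausePtr C.mem i + 1 + l) / 2 ∧
        C.mem (clausePtr C.mem i + 1 + l) / 2 < C.a + C.b
    · exact h1 l hl ⟨if_pos h, he⟩
    · exact h0 l hl ⟨if_neg h, he⟩
  · exact fun h => ⟨fun l hl hc => h l hl hc.2, fun l hl hc => h l hl hc.2⟩

namespace Prog

/-- find the fixed part of the assignment bit by bit -/
def search (p : Prog) (R : ℕ) : Prog :=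
  assign v_pow 1 ;; assign v_fix 0 ;;
  forDo v_pos v_n
    (assign v_pow (𝕣 v_pow * 2) ;; decideFlow p R ;;
      ite (𝕣 v_found) skip (assign v_fix (𝕣 v_fix + 𝕣 v_pow / 2)))

/-- `best :=` the maximum of `best` and the number of clauses satisfied by the fixed assignment -/
def evaluate : Prog :=
  assign v_cnt 0 ;; assign v_u 0 ;;
  forDo v_i v_m
    (assign v_side 0 ;; unsat ;; assign v_fst (𝕣 v_flag) ;; assign v_side 1 ;; unsat ;;
      assign v_cnt (𝕣 v_cnt + 𝕣 v_fst * 𝕣 v_flag)) ;;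
  ite (𝕣 v_m - 𝕣 v_cnt - 𝕣 v_best) (assign v_best (𝕣 v_m - 𝕣 v_cnt)) skip

/-- search with all thresholds -/
def allThresholds (p : Prog) (R : ℕ) : Prog := forDo v_thr v_m (search p R ;; evaluate)

theorem touches_decideFlow {p : Prog} {R : ℕ} (hR : p.sim.Touches fun x => 40 ≤ x ∧ x < 100 + R) :
    (decideFlow p R).Touches fun x => x = 18 ∨ 40 ≤ x := by
  have h1 := touches_lazyLoad.mono (A' := fun x => x = 18 ∨ 40 ≤ x) fun x hx => by omega
  have h2 := (touches_clearRegs R).mono (A' := fun x => x = 18 ∨ 40 ≤ x) fun x hx => by omega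
  have h3 := hR.mono (A' := fun x => x = 18 ∨ 40 ≤ x) fun x hx => by omega
  simp [decideFlow, h1, h2, h3]

theorem touches_search {p : Prog} {R : ℕ} (hR : p.sim.Touches fun x => 40 ≤ x ∧ x < 100 + R) :
    (search p R).Touches fun x => (15 ≤ x ∧ x ≤ 18) ∨ 40 ≤ x := by
  have h1 := (touches_decideFlow hR).mono (A' := fun x => (15 ≤ x ∧ x ≤ 18) ∨ 40 ≤ x)
    fun x hx => by omega
  simp [search, h1]

theorem touches_evaluate : evaluate.Touches fun x => x = 0 ∨ (42 ≤ x ∧ x < 100) := by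
  have h1 := touches_unsat.mono (A' := fun x => x = 0 ∨ (42 ≤ x ∧ x < 100)) fun x hx => by omega
  simp [evaluate, h1]

theorem readOnly_evaluate : evaluate.ReadOnly := by simp [evaluate, readOnly_unsat]

theorem touches_allThresholds {p : Prog} {R : ℕ}
    (hR : p.sim.Touches fun x => 40 ≤ x ∧ x < 100 + R) :
    (allThresholds p R).Touches fun x => x = 0 ∨ (14 ≤ x ∧ x ≤ 18) ∨ 40 ≤ x := by
  have h1 := (touches_search hR).mono (A' := fun x => x = 0 ∨ (14 ≤ x ∧ x ≤ 18) ∨ 40 ≤ x)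
    fun x hx => by omega
  have h2 := touches_evaluate.mono (A' := fun x => x = 0 ∨ (14 ≤ x ∧ x ≤ 18) ∨ 40 ≤ x)
    fun x hx => by omega
  simp [allThresholds, h1, h2]

end Prog

namespace Ctx

/-- The context with another threshold and another fixed part of the assignment. -/
def upd (C : Ctx) (thr pow fix call : ℕ) : Ctx :=
  {C with thr := thr, pow := pow, fix := fix, call := call}

/-- The simulated program answers the question for an assignment that extends the fixed part and
leaves at most `thr` clauses unsatisfied. -/
def Answered (C : Ctx) (p : Prog) : Prop :=
  ∃ o k B, Exec B p ⟨fun _ => 0, C.word⟩ o k ∧ B ≤ C.cap ∧ k < C.budget ∧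
    ((∃ i < C.S * C.T, o.mem (o.reg 0 + i) < C.X) ↔
      ∃ u, u % C.pow = C.fix ∧ numUnsat C.mem C.m u ≤ C.thr)

/-- The bounds needed for the search. -/
structure SearchFits (C : Ctx) (V : ℕ) : Prop where
  sim : ∀ thr < C.m, ∀ j ≤ C.n, ∀ fix < 2 ^ j, ∀ call, (C.upd thr (2 ^ j) fix call).SimFits V
  pow_le : 2 ^ C.n ≤ V
  table_le : C.cap + C.S * C.T ≤ V
  scan_le : C.S * C.T ≤ C.budget

end Ctx

section
variable {V : ℕ} {C : Ctx} {p : Prog} {R : ℕ}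

/-- The running time of `search`. -/
def searchCost (p : Prog) (R : ℕ) (C : Ctx) : ℕ := C.n * (decideCost p R C + 22 + 8) + 20

/-- This is the usual self-reduction: each bit is tried as `0` and set to `1` if no good completion
exists. Fixed bits are patched into the assignments instead of being removed from the formula, so
all questions concern instances of the same size. Without correct answers the search still ends with
some `fix < 2 ^ n`. -/
theorem search_spec (hR : p.sim.Touches fun x => 40 ≤ x ∧ x < 100 + R) (hV : C.SearchFits V)
    (hp : p.ConstLe V) (hthr : C.thr < C.m) (hcall : C.call + C.n ≤ V)
    {s : State} (hC : C.Holds s) (hr : Ready C.base R s) :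
    Triple V (.search p R) s (searchCost p R C) fun t =>
      (∃ fix < 2 ^ C.n, ∃ call ≤ C.call + C.n, (C.upd C.thr (2 ^ C.n) fix call).Holds t ∧
        ((∀ j ≤ C.n, ∀ fix < 2 ^ j, (C.upd C.thr (2 ^ j) fix 0).Answered p) →
          (∃ u, numUnsat C.mem C.m u ≤ C.thr) →
            ∃ u, u % 2 ^ C.n = fix ∧ numUnsat C.mem C.m u ≤ C.thr)) ∧
      Ready C.base R t ∧ ∀ x < 40, ¬ (15 ≤ x ∧ x ≤ 18) → t.reg x = s.reg x := by
  unfold Prog.search searchCost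
  refine Triple.of_bounded fun hb => ?_
  have h8 := hb.eight_le
  refine Triple.step rfl (fun _ => by simp; omega) ?_
  refine Triple.step rfl (fun _ => by simp) ?_
  refine Triple.le_time (Triple.forDo (N := C.n) (T := decideCost p R C + 22)
    (fun j t => (∃ fix < 2 ^ j, ∃ call ≤ C.call + j, (C.upd C.thr (2 ^ j) fix call).Holds t ∧
        ((∀ j ≤ C.n, ∀ fix < 2 ^ j, (C.upd C.thr (2 ^ j) fix 0).Answered p) →
          (∃ u, numUnsat C.mem C.m u ≤ C.thr) →
            ∃ u, u % 2 ^ j = fix ∧ numUnsat C.mem C.m u ≤ C.thr)) ∧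
      Ready C.base R t ∧ ∀ x < 40, ¬ (15 ≤ x ∧ x ≤ 18) → t.reg x = s.reg x)
    ?_ (by norm_num) ?_ ?_ ?_ ?_) (by simp)
  · simpa using hC.n
  · have := (Prog.touches_decideFlow hR).mono (A' := fun x => x ≠ 15 ∧ x ≠ 2) fun x hx => by omega
    simp [this]
  · refine ⟨⟨0, by simp, C.call, by simp, ?_, ?_⟩, ?_, fun x hx hx' => ?_⟩
    · constructor
      case mem => exact hC.mem
      all_goals simp [Ctx.upd]
      exacts [hC.m, hC.n, hC.base, hC.H, hC.cap, hC.capLog, hC.budget, hC.a, hC.b, hC.S, hC.T, hC.N, hC.X, hC.thr, hC.call]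
    · rintro - ⟨u, hu⟩
      exact ⟨u, Nat.mod_one u, hu⟩
    · exact hr.congr (by simp) (fun x hx => by
        simp [show x ≠ 15 by omega, show x ≠ 16 by omega, show x ≠ 17 by omega]) rfl
    · simp [show x ≠ 15 by omega, show x ≠ 16 by omega, show x ≠ 17 by omega]
  · rintro j hj t htj htn ⟨⟨fix, hfix, call, hcl, hh, himp⟩, htr, htf⟩
    have hpow : t.reg v_pow = 2 ^ j := hh.pow
    have hfixr : t.reg v_fix = fix := hh.fix
    have hjn : (2 : ℕ) ^ (j + 1) ≤ 2 ^ C.n := Nat.pow_le_pow_right (by norm_num) hj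
    have hpV := hV.pow_le
    refine Triple.step rfl (fun _ => ?_) ?_
    · simp only [Exp.eval_mul, Exp.eval_var, Exp.eval_ofNat, hpow, ← pow_succ]
      omega
    have hfix' : fix < 2 ^ (j + 1) := hfix.trans_le (Nat.pow_le_pow_right (by norm_num) (by omega))
    set C₁ := C.upd C.thr (2 ^ (j + 1)) fix call with hC₁
    have hsf : C₁.SimFits V := hV.sim _ hthr _ hj fix hfix' call
    have hh₁ : C₁.Holds (t.setReg v_pow ((𝕣 v_pow * 2 : Exp).eval t)) := by
      constructor
      case mem => exact hh.mem
      all_goals simp [hC₁, Ctx.upd, hpow, pow_succ]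
      exacts [hh.m, hh.n, hh.base, hh.H, hh.cap, hh.capLog, hh.budget, hh.a, hh.b, hh.S, hh.T, hh.N, hh.X, hh.thr, hh.fix, hh.call]
    refine Triple.seq' (Triple.mono (decideFlow_spec (C := C₁) hR hsf hp (show call + 1 ≤ V by omega)
      hV.table_le hV.scan_le hh₁ (htr.congr (by simp) (fun x hx => by simp [show x ≠ 16 by omega]) rfl)) le_rfl ?_)
      (by simp [decideCost, hC₁, Ctx.upd])
    rintro u ⟨hu1, hu2, hu3, hu4⟩
    have hcost : decideCost p R C₁ = decideCost p R C := rfl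
    have hku : ∀ x < 40, ¬ (15 ≤ x ∧ x ≤ 18) → u.reg x = s.reg x := fun x hx hx' => by
      rw [hu3 x hx (by omega), State.reg_setReg, if_neg (by omega), htf x hx hx']
    -- As `fix < 2 ^ j`, the residue `fix` modulo `2 ^ (j + 1)` demands that bit `j` be zero.
    have hfound : (∀ j ≤ C.n, ∀ fix < 2 ^ j, (C.upd C.thr (2 ^ j) fix 0).Answered p) →
        (u.reg v_found ≠ 0 ↔ ∃ w, w % 2 ^ (j + 1) = fix ∧ numUnsat C.mem C.m w ≤ C.thr) := fun hgood => by
      obtain ⟨o, k, B, he, hB, hk, hiff⟩ := hgood (j + 1) hj fix hfix'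
      exact (hu4 o k B he hB hk).trans hiff
    have hsplit : ∀ w, w % 2 ^ (j + 1) = w % 2 ^ j ∨ w % 2 ^ (j + 1) = w % 2 ^ j + 2 ^ j := fun w => by
      rw [Nat.mod_pow_succ]
      rcases Nat.mod_two_eq_zero_or_one (w / 2 ^ j) with h | h <;> simp [h]
    rw [hcost]
    refine Triple.branch rfl (fun h => ?_) (fun h => ?_) (by simp)
    · refine Triple.le_time (Triple.skip ⟨⟨fix, hfix', call + 1, by omega, ?_, ?_⟩, ?_, fun x hx hx' => ?_⟩) (by simp)
      · constructor
        case mem => exact hu1.mem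
        all_goals simp [Ctx.upd]
        exacts [hu1.m, hu1.n, hu1.base, hu1.H, hu1.cap, hu1.capLog, hu1.budget, hu1.a, hu1.b, hu1.S, hu1.T, hu1.N, hu1.X, hu1.thr, hu1.pow, hu1.fix, hu1.call]
      · exact fun hgood _ => (hfound hgood).1 h
      · exact hu2.congr (by simp) (fun x hx => by simp [show x ≠ 15 by omega]) rfl
      · rw [State.reg_setReg, if_neg (by omega), hku x hx hx']
    · have hpu : u.reg v_pow = 2 ^ (j + 1) := hu1.pow
      have hfu : u.reg v_fix = fix := hu1.fix
      have hval : (𝕣 v_fix + 𝕣 v_pow / 2 : Exp).eval u = fix + 2 ^ j := by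
        simp [hpu, hfu, pow_succ]
      have hlt : fix + 2 ^ j < 2 ^ (j + 1) := by rw [pow_succ]; omega
      refine Triple.last rfl (fun _ => by rw [hval]; omega)
        ⟨⟨fix + 2 ^ j, hlt, call + 1, by omega, ?_, ?_⟩, ?_, fun x hx hx' => ?_⟩ (by simp)
      · rw [hval]
        constructor
        case mem => exact hu1.mem
        all_goals simp [Ctx.upd]
        exacts [hu1.m, hu1.n, hu1.base, hu1.H, hu1.cap, hu1.capLog, hu1.budget, hu1.a, hu1.b, hu1.S, hu1.T, hu1.N, hu1.X, hu1.thr, hpu, hu1.call]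
      · intro hgood hex
        -- No good completion has bit `j` equal to zero, so the one supplied by the invariant must
        -- have it equal to one.
        have hno := (not_congr (hfound hgood)).1 (by simpa using h)
        obtain ⟨w, hw, hw'⟩ := himp hgood hex
        refine ⟨w, ?_, hw'⟩
        rcases hsplit w with h' | h'
        · exact absurd ⟨w, by omega, hw'⟩ hno
        · omega
      · exact hu2.congr (by simp) (fun x hx => by
          simp [show x ≠ 15 by omega, show x ≠ 17 by omega]) rfl
      · rw [State.reg_setReg, if_neg (by omega), State.reg_setReg, if_neg (by omega), hku x hx hx']
  · rintro t - h
    exact h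

/-- The count is taken from the formula itself. Whatever the simulated program answered, `v_best` is
only ever raised to a value attained by an actual assignment. -/
theorem evaluate_spec (hbase : clausePtr C.mem C.m = C.base) (hfix : C.fix ≤ V)
    {s : State} (hC : C.Holds s) :
    Triple V .evaluate s (C.m * (200 * (C.base + 1) + 40 + 8) + 40) fun t =>
      t.reg v_best = max (s.reg v_best) (C.m - numUnsat C.mem C.m C.fix) ∧ t.mem = s.mem ∧
        ∀ x, ¬ (x = 0 ∨ (42 ≤ x ∧ x < 100)) → t.reg x = s.reg x := by
  suffices h : Triple V .evaluate s (C.m * (200 * (C.base + 1) + 40 + 8) + 40) fun t =>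
      t.reg v_best = max (s.reg v_best) (C.m - numUnsat C.mem C.m C.fix) from
    ((h.frame_mem Prog.readOnly_evaluate).frame Prog.touches_evaluate).mono le_rfl
      fun t ht => ⟨ht.1.1, ht.1.2, ht.2⟩
  have hp0 : C.patch 0 = C.fix := by simp [Ctx.patch]
  unfold Prog.evaluate
  refine Triple.of_bounded fun hb => ?_
  have h8 := hb.eight_le
  have hmV : C.m ≤ V := hC.m ▸ hb.reg _
  refine Triple.step rfl (fun _ => by simp) ?_
  refine Triple.step rfl (fun _ => by simp) ?_
  have hcnt : ∀ j ≤ C.m, numUnsat C.mem j C.fix ≤ j := fun j _ =>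
    (Finset.card_filter_le _ _).trans (by simp)
  refine Triple.seq' (Triple.forDo (N := C.m) (T := 200 * (C.base + 1) + 40)
    (fun j t => t.reg v_cnt = numUnsat C.mem j C.fix ∧ t.reg v_u = 0 ∧
      (∀ x < 40, t.reg x = s.reg x) ∧ t.mem = s.mem) ?_ (by norm_num) ?_ ?_ ?_ ?_) (by simp)
  · simpa using hC.m
  · have := Prog.touches_unsat.mono (A' := fun x => x ≠ 44 ∧ x ≠ 1) fun x hx => by omega
    simp [this]
  · refine ⟨by simp [numUnsat], by simp, fun x hx => ?_, rfl⟩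
    simp [show x ≠ 42 by omega, show x ≠ 63 by omega, show x ≠ 44 by omega]
  · rintro j hj t htj htm ⟨h1, h2, h3, h4⟩
    refine Triple.step rfl (fun _ => by simp) ?_
    refine Triple.seq' (Triple.mono (unsat_spec (C := C) ?_ ?_ hbase ?_) le_rfl ?_) (by simp; omega)
    · exact hC.congr (fun x hx => by simp [show x ≠ 43 by omega, h3 x hx]) fun _ _ => by simp [h4]
    · simpa [htj] using hj
    · simpa [h2, hp0] using hfix
    rintro u ⟨hu1, hu2, hu3⟩
    simp [h2, hp0, htj] at hu1 hu2
    have hu : ∀ x, ¬ (43 ≤ x ∧ x ≤ 51) → u.reg x = t.reg x := fun x hx => by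
      rw [hu3 x (by omega), State.reg_setReg, if_neg (by omega)]
    refine Triple.step rfl (fun _ => by simp [hu1]; split_ifs <;> omega) ?_ (by simp; omega)
    refine Triple.step rfl (fun _ => by simp; omega) ?_ (by simp; omega)
    have hui : u.reg v_i = j := by rw [hu3 _ (by norm_num)]; simpa using htj
    refine Triple.seq' (Triple.mono (unsat_spec (C := C) ?_ ?_ hbase ?_) le_rfl ?_) (by simp; omega)
    · exact hC.congr (fun x hx => by
        simp [show x ≠ 43 by omega, show x ≠ 64 by omega]
        rw [hu x (by omega), h3 x hx]) fun _ _ => by simp [hu2, h4]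
    · simpa [hui] using hj
    · simpa [hu v_u (by norm_num), h2, hp0] using hfix
    rintro r ⟨hr1, hr2, hr3⟩
    simp [hu v_u (by norm_num), hui, h2, hp0] at hr1 hr2
    have hrr : ∀ x, ¬ (43 ≤ x ∧ x ≤ 51) → x ≠ 64 → r.reg x = t.reg x := fun x hx hx' => by
      rw [hr3 x (by omega), State.reg_setReg, if_neg (by omega), State.reg_setReg, if_neg hx', hu x hx]
    have hfst : r.reg v_fst = if C.Unsat 0 C.fix j then 1 else 0 := by
      rw [hr3 _ (by norm_num)]
      simpa using hu1
    have hval : (𝕣 v_cnt + 𝕣 v_fst * 𝕣 v_flag : Exp).eval r = numUnsat C.mem (j + 1) C.fix := by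
      simp only [Exp.eval_add, Exp.eval_mul, Exp.eval_var, hfst, hr1, hrr v_cnt (by norm_num) (by norm_num), h1]
      rw [numUnsat, numUnsat, Finset.range_add_one, Finset.filter_insert]
      by_cases h : ClauseUnsat C.mem C.fix j
      · obtain ⟨h0, h1⟩ := Ctx.unsat_and_unsat.2 h
        simp [h, h0, h1]
      · have : ¬ (C.Unsat 0 C.fix j ∧ C.Unsat 1 C.fix j) := fun hc => h (Ctx.unsat_and_unsat.1 hc)
        rw [if_neg h]
        by_cases h0 : C.Unsat 0 C.fix j
        · have h1' : ¬ C.Unsat 1 C.fix j := fun h1 => this ⟨h0, h1⟩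
          simp [h0, h1']
        · simp [h0]
    refine Triple.last rfl (fun _ => ?_) ⟨?_, ?_, fun x hx => ?_, ?_⟩ (by simp; omega)
    · rw [hval]
      exact (hcnt _ hj).trans (by omega)
    · rw [hval]; simp
    · simp
      rw [hrr _ (by norm_num) (by norm_num), h2]
    · simp [show x ≠ 44 by omega, show x ≠ 63 by omega]
      rw [hrr x (by omega) (by omega), h3 x hx]
    · simp [hr2, hu2, h4]
  · rintro t - ⟨h1, h2, h3, h4⟩
    have hm : t.reg v_m = C.m := (h3 _ (by norm_num)).trans hC.m
    have hbest := h3 v_best (by norm_num)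
    refine Triple.branch rfl (fun h => ?_) (fun h => ?_) (by simp)
    · have h' : s.reg v_best < C.m - numUnsat C.mem C.m C.fix := by
        simp [hm, h1, hbest] at h; omega
      refine Triple.last rfl (fun _ => by simp [hm]; omega) ?_ (by simp)
      simp [hm, h1]
      omega
    · have h' : ¬ s.reg v_best < C.m - numUnsat C.mem C.m C.fix := by
        simp [hm, h1, hbest] at h; omega
      refine Triple.le_time (Triple.skip ?_) (by simp)
      rw [hbest]
      omega

end

end FlowHardness

/-! ### All thresholds and all ways to split the variables. -/

namespace FlowHardness

namespace Prog

/-- all searches for sources with `a` and sinks with `b` variables -/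
def guess (p : Prog) (R : ℕ) : Prog :=
  ite (𝕣 v_a + 𝕣 v_b - 𝕣 v_H) skip (assign v_L (𝕣 v_H - (𝕣 v_a + 𝕣 v_b)) ;;
  ite (𝕣 v_a - 𝕣 v_L) skip (ite (𝕣 v_b - 𝕣 v_L) skip
    (assignOp .shl v_S v_unit v_a ;; assignOp .shl v_T v_unit v_b ;; assignOp .shl v_N v_unit v_L ;;
      assign v_G (𝕣 v_n - (𝕣 v_a + 𝕣 v_b)) ;; assignOp .shl v_G v_unit v_G ;;
      assign v_X (𝕣 v_G * 𝕣 v_m) ;; allThresholds p R)))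

/-- compute the parameters that depend only on the size of the formula -/
def setup (K q : ℕ) : Prog :=
  assign v_n (.load 0) ;; assign v_m (.load 1) ;; assign v_unit 1 ;; assign v_base 2 ;;
  forDo v_idx v_m (assign v_base (𝕣 v_base + 1 + .load (𝕣 v_base))) ;;
  assign v_L 0 ;; assign v_G 1 ;;
  whileDo (𝕣 v_m - 𝕣 v_G) (assign v_G (𝕣 v_G * 2) ;; assign v_L (𝕣 v_L + 1)) ;;
  assign v_H (𝕣 v_n + 3 * 𝕣 v_L + 2) ;; assign v_bound (𝕣 v_H + 1) ;;
  .const (2 * v_tmp) K ;; assign v_capLog (𝕣 v_tmp * (2 * 𝕣 v_H + 8)) ;;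
  assignOp .shl v_cap v_unit v_capLog ;;
  .const (2 * v_arg) q ;; assign v_x (𝕣 v_H + 3 - (𝕣 v_H + 3) / 𝕣 v_arg) ;;
  assignOp .shl v_y v_unit v_x ;; assign v_budget (𝕣 v_tmp * 𝕣 v_y + 1)

/-- the algorithm for MAX-CNF-SAT that uses the flow algorithm `p` -/
def maxSat (p : Prog) (R K q : ℕ) : Prog :=
  setup K q ;; forDo v_a v_bound (forDo v_b v_bound (guess p R))

theorem touches_guess {p : Prog} {R : ℕ} (hR : p.sim.Touches fun x => 40 ≤ x ∧ x < 100 + R) :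
    (guess p R).Touches fun x => x = 0 ∨ (10 ≤ x ∧ x ≤ 18) ∨ x = 21 ∨ x = 22 ∨ 40 ≤ x := by
  have h1 := (touches_allThresholds hR).mono
    (A' := fun x => x = 0 ∨ (10 ≤ x ∧ x ≤ 18) ∨ x = 21 ∨ x = 22 ∨ 40 ≤ x) fun x hx => by omega
  simp [guess, h1]

end Prog

namespace Ctx

/-- The context with `a` variables for the sources and `b` variables for the sinks. -/
def split (C : Ctx) (a b : ℕ) : Ctx :=
  {C with a := a, b := b, S := 2 ^ a, T := 2 ^ b, N := 2 ^ (C.H - (a + b)),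
          X := 2 ^ (C.n - (a + b)) * C.m}

/-- The split leaves enough room for sources and sinks. -/
def Valid (C : Ctx) (a b : ℕ) : Prop := a + b ≤ C.H ∧ a ≤ C.H - (a + b) ∧ b ≤ C.H - (a + b)

/-- The parameters that depend only on the size of the formula. -/
structure Outer (C : Ctx) (s : State) : Prop where
  m : s.reg v_m = C.m
  n : s.reg v_n = C.n
  base : s.reg v_base = C.base
  H : s.reg v_H = C.H
  cap : s.reg v_cap = C.cap
  capLog : s.reg v_capLog = C.capLog
  budget : s.reg v_budget = C.budget
  unit : s.reg v_unit = 1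
  bound : s.reg v_bound = C.H + 1
  mem : ∀ x < C.base, s.mem x = C.mem x

/-- The bounds needed for the algorithm. -/
structure OuterFits (C : Ctx) (V : ℕ) : Prop where
  base_eq : clausePtr C.mem C.m = C.base
  search : ∀ a b, C.Valid a b → (C.split a b).SearchFits V
  pow_le : 2 ^ C.H ≤ V
  slots_le : ∀ a b, C.Valid a b → 2 ^ (C.n - (a + b)) * C.m ≤ V
  n_le : C.n ≤ C.H
  calls_le : (C.H + 1) * ((C.H + 1) * (C.m * C.n)) ≤ V

/-- All questions are answered for one way to split the variables. -/
def AllAnswered (C : Ctx) (p : Prog) : Prop :=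
  ∀ thr < C.m, ∀ j ≤ C.n, ∀ fix < 2 ^ j, (C.upd thr (2 ^ j) fix 0).Answered p

/-- `opt` is the maximum number of satisfied clauses, and only the first `n` bits of an assignment
matter. -/
structure IsOpt (C : Ctx) (opt : ℕ) : Prop where
  le : ∀ w, C.m - numUnsat C.mem C.m w ≤ opt
  exists_eq : ∃ w, C.m - numUnsat C.mem C.m w = opt
  mod : ∀ w, numUnsat C.mem C.m (w % 2 ^ C.n) = numUnsat C.mem C.m w

end Ctx

section
variable {V : ℕ} {C : Ctx} {p : Prog} {R opt : ℕ}

/-- The running time of `allThresholds`. -/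
def thresholdsCost (p : Prog) (R : ℕ) (C : Ctx) : ℕ :=
  C.m * (searchCost p R C + (C.m * (200 * (C.base + 1) + 40 + 8) + 40) + 8) + 6

/-- Soundness (`v_best ≤ opt`) needs nothing about the simulated program; optimality needs correct
answers. Assignments found by the search agree with good ones only in the first `n` bits, which
suffices by `IsOpt.mod`. -/
theorem allThresholds_spec (hR : p.sim.Touches fun x => 40 ≤ x ∧ x < 100 + R) (hV : C.SearchFits V)
    (hbase : clausePtr C.mem C.m = C.base)
    (hp : p.ConstLe V) (hcall : C.call + C.m * C.n ≤ V) (hopt : C.IsOpt opt)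
    {s : State} (hC : C.Holds s) (hr : Ready C.base R s) (hbest : s.reg v_best ≤ opt) :
    Triple V (.allThresholds p R) s (thresholdsCost p R C) fun t =>
      Ready C.base R t ∧ t.reg v_call ≤ C.call + C.m * C.n ∧ (∀ x < C.base, t.mem x = C.mem x) ∧
      s.reg v_best ≤ t.reg v_best ∧ t.reg v_best ≤ opt ∧
      (C.AllAnswered p → t.reg v_best = opt) := by
  unfold Prog.allThresholds thresholdsCost
  refine Triple.forDo (N := C.m)
    (T := searchCost p R C + (C.m * (200 * (C.base + 1) + 40 + 8) + 40))
    (fun j t => (∃ pow fix call, (C.upd (t.reg v_thr) pow fix call).Holds t ∧ call ≤ C.call + j * C.n) ∧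
      Ready C.base R t ∧ s.reg v_best ≤ t.reg v_best ∧ t.reg v_best ≤ opt ∧
      (C.AllAnswered p → ∀ thr < j, (∃ u, numUnsat C.mem C.m u ≤ thr) → C.m - thr ≤ t.reg v_best))
    hC.m (by norm_num) ?_ ?_ ?_ ?_
  · have h1 := (Prog.touches_search hR).mono (A' := fun x => x ≠ 14 ∧ x ≠ 1) fun x hx => by omega
    have h2 := Prog.touches_evaluate.mono (A' := fun x => x ≠ 14 ∧ x ≠ 1) fun x hx => by omega
    exact ⟨h1, h2⟩
  · refine ⟨⟨C.pow, C.fix, C.call, ?_, by simp⟩, ?_, by simp, by simpa using hbest, by simp⟩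
    · constructor
      case mem => exact hC.mem
      all_goals simp [Ctx.upd]
      exacts [hC.m, hC.n, hC.base, hC.H, hC.cap, hC.capLog, hC.budget, hC.a, hC.b, hC.S, hC.T, hC.N, hC.X, hC.pow, hC.fix, hC.call]
    · exact hr.congr (by simp) (fun x hx => by simp [show x ≠ 14 by omega]) rfl
  · rintro j hj t htj - ⟨⟨pow, fix, call, hh, hcl⟩, htr, hb1, hb2, himp⟩
    rw [htj] at hh
    set C₁ := C.upd j pow fix call with hC₁
    have hV₁ : C₁.SearchFits V := ⟨hV.sim, hV.pow_le, hV.table_le, hV.scan_le⟩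
    have hmul : (j + 1) * C.n ≤ C.m * C.n := Nat.mul_le_mul_right _ hj
    rw [add_mul, one_mul] at hmul
    refine Triple.seq (Triple.mono (search_spec (C := C₁) hR hV₁ hp hj
      (show call + C.n ≤ V by omega) hh htr) le_rfl ?_)
    rintro u ⟨⟨fix', hfix', call', hcl', hu, himp'⟩, hur, huf⟩
    have hub : u.reg v_best = t.reg v_best := huf _ (by norm_num) (by norm_num)
    have hut : u.reg v_thr = j := (huf _ (by norm_num) (by norm_num)).trans htj
    refine Triple.mono (evaluate_spec (C := C₁.upd j (2 ^ C.n) fix' call') hbase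
      (hfix'.le.trans hV.pow_le) hu) le_rfl ?_
    rintro r ⟨hr1, hr2, hr3⟩
    have hr1' : r.reg v_best = max (t.reg v_best) (C.m - numUnsat C.mem C.m fix') := hub ▸ hr1
    have hcl'' : call' ≤ call + C.n := hcl'
    refine ⟨⟨2 ^ C.n, fix', call', ?_, by rw [add_mul, one_mul]; omega⟩, ?_, ?_, ?_, ?_⟩
    · have hu' : ∀ x, 0 < x → x < 40 → x ≠ 14 →
          (r.setReg v_thr (j + 1)).reg x = u.reg x := fun x h0 h1 h2 => by
        rw [State.reg_setReg, if_neg h2, hr3 x (by omega)]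
      constructor
      case mem => exact fun x hx => (congrFun hr2 x).trans (hu.mem x hx)
      case thr => simp [Ctx.upd]
      all_goals rw [hu' _ (by norm_num) (by norm_num) (by norm_num)]
      exacts [hu.m, hu.n, hu.base, hu.H, hu.cap, hu.capLog, hu.budget, hu.a, hu.b, hu.S, hu.T, hu.N, hu.X, hu.pow, hu.fix, hu.call]
    · refine Ready.congr hur ?_ (fun x hx => ?_) (by simpa using hr2)
      · rw [State.reg_setReg, if_neg (by norm_num), hr3 _ (by norm_num)]
      · rw [State.reg_setReg, if_neg (by omega), hr3 _ (by omega)]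
    · simp [hr1']; omega
    · simp [hr1']
      have := hopt.le fix'
      omega
    · intro hgood thr hthr hex
      simp only [State.reg_setReg]
      norm_num only [if_false]
      rw [hr1']
      rcases Nat.lt_succ_iff_lt_or_eq.1 hthr with h | rfl
      · exact (himp hgood thr h hex).trans (le_max_left _ _)
      · obtain ⟨w, hw, hw'⟩ := himp' (hgood thr hj) hex
        have h1 : numUnsat C.mem C.m fix' ≤ thr := by
          rw [← hw]
          exact (hopt.mod w).le.trans hw'
        omega
  · rintro t - ⟨⟨pow, fix, call, hh, hcl⟩, htr, hb1, hb2, himp⟩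
    refine ⟨htr, by rw [hh.call]; exact hcl, hh.mem, hb1, hb2, fun hgood => ?_⟩
    rcases Nat.eq_zero_or_pos opt with h0 | h0
    · omega
    · obtain ⟨w, hw⟩ := hopt.exists_eq
      -- The decisive threshold is the minimum number of unsatisfied clauses. It is less than `m`
      -- because `opt > 0`; for `opt = 0` there is nothing to find.
      have := himp hgood (C.m - opt) (by omega) ⟨w, by omega⟩
      omega

/-- The running time of `guess`. -/
def guessCost (p : Prog) (R : ℕ) (C : Ctx) : ℕ := thresholdsCost p R C + 60

theorem guess_spec (hR : p.sim.Touches fun x => 40 ≤ x ∧ x < 100 + R) (hV : C.OuterFits V)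
    (hp : p.ConstLe V) (hopt : C.IsOpt opt)
    {s : State} (hC : C.Outer s) (hcall : s.reg v_call + C.m * C.n ≤ V)
    (hr : Ready C.base R s) (hbest : s.reg v_best ≤ opt) :
    Triple V (.guess p R) s (guessCost p R C) fun t =>
      C.Outer t ∧ Ready C.base R t ∧ t.reg v_call ≤ s.reg v_call + C.m * C.n ∧
      s.reg v_best ≤ t.reg v_best ∧ t.reg v_best ≤ opt ∧
      (C.Valid (s.reg v_a) (s.reg v_b) → (C.split (s.reg v_a) (s.reg v_b)).AllAnswered p →
        t.reg v_best = opt) := by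
  suffices h : Triple V (.guess p R) s (guessCost p R C) fun t =>
      Ready C.base R t ∧ t.reg v_call ≤ s.reg v_call + C.m * C.n ∧ (∀ x < C.base, t.mem x = C.mem x) ∧
      s.reg v_best ≤ t.reg v_best ∧ t.reg v_best ≤ opt ∧
      (C.Valid (s.reg v_a) (s.reg v_b) → (C.split (s.reg v_a) (s.reg v_b)).AllAnswered p →
        t.reg v_best = opt) by
    refine (h.frame (Prog.touches_guess hR)).mono le_rfl ?_
    rintro t ⟨⟨h1, h2, h3, h4, h5, h6⟩, hf⟩
    refine ⟨?_, h1, h2, h4, h5, h6⟩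
    constructor
    case mem => exact h3
    all_goals rw [hf _ (by norm_num)]
    exacts [hC.m, hC.n, hC.base, hC.H, hC.cap, hC.capLog, hC.budget, hC.unit, hC.bound]
  generalize ha : s.reg v_a = a
  generalize hb : s.reg v_b = b
  have hpH := hV.pow_le
  have hskip : ∀ t : State, (∀ x, x ≠ v_L → t.reg x = s.reg x) → t.mem = s.mem → ¬ C.Valid a b →
      Ready C.base R t ∧ t.reg v_call ≤ s.reg v_call + C.m * C.n ∧ (∀ x < C.base, t.mem x = C.mem x) ∧
      s.reg v_best ≤ t.reg v_best ∧ t.reg v_best ≤ opt ∧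
      (C.Valid a b → (C.split a b).AllAnswered p → t.reg v_best = opt) := by
    intro t h1 h2 h3
    refine ⟨hr.congr (h1 _ (by norm_num)) (fun x hx => h1 x (by omega)) h2, ?_, ?_, ?_, ?_, ?_⟩
    · rw [h1 _ (by norm_num)]; omega
    · rw [h2]; exact hC.mem
    · rw [h1 _ (by norm_num)]
    · rw [h1 _ (by norm_num)]; exact hbest
    · exact fun h => absurd h h3
  refine Triple.of_bounded fun hbd => ?_
  unfold Prog.guess guessCost
  refine Triple.branch rfl (fun h => ?_) (fun h => ?_) (by simp)
  · refine Triple.le_time (Triple.skip (hskip s (fun _ _ => rfl) rfl fun hv => ?_)) (by simp)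
    have := hv.1
    simp [ha, hb, hC.H] at h
    omega
  have hab : a + b ≤ C.H := by simp [ha, hb, hC.H] at h; omega
  refine Triple.step rfl (fun _ => (Nat.sub_le _ _).trans (hbd.reg _)) ?_ (by simp)
  simp only [Exp.eval_add, Exp.eval_sub, Exp.eval_var, ha, hb, hC.H]
  set s₁ := s.setReg v_L (C.H - (a + b)) with hs₁
  have hreg₁ : ∀ x, x ≠ v_L → s₁.reg x = s.reg x := fun x hx => by rw [hs₁, State.reg_setReg, if_neg hx]
  have hL : s₁.reg v_L = C.H - (a + b) := by simp [hs₁]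
  refine Triple.branch rfl (fun h => ?_) (fun h => ?_) (by simp)
  · refine Triple.le_time (Triple.skip (hskip s₁ hreg₁ rfl fun hv => ?_)) (by simp)
    have := hv.2.1
    simp [hreg₁, ha, hL] at h
    omega
  have haL : a ≤ C.H - (a + b) := by simp [hreg₁, ha, hL] at h; omega
  refine Triple.branch rfl (fun h => ?_) (fun h => ?_) (by simp)
  · refine Triple.le_time (Triple.skip (hskip s₁ hreg₁ rfl fun hv => ?_)) (by simp)
    have := hv.2.2
    simp [hreg₁, hb, hL] at h
    omega
  have hbL : b ≤ C.H - (a + b) := by simp [hreg₁, hb, hL] at h; omega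
  have hvalid : C.Valid a b := ⟨hab, haL, hbL⟩
  have hpow : ∀ i, i ≤ C.H → Op.shl.eval 1 i ≤ V := fun i hi => by
    simp only [Op.eval, Nat.shiftLeft_eq, one_mul]
    exact (Nat.pow_le_pow_right (by norm_num) hi).trans hpH
  have hnH := hV.n_le
  have hslots := hV.slots_le a b hvalid
  refine Triple.seq' (Triple.assignOp (fun _ => ?_) ?_) (by simp)
  · simpa [hreg₁, hC.unit, ha] using hpow a (by omega)
  refine Triple.seq' (Triple.assignOp (fun _ => ?_) ?_) (by simp)
  · simpa [hreg₁, hC.unit, hb] using hpow b (by omega)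
  refine Triple.seq' (Triple.assignOp (fun _ => ?_) ?_) (by simp)
  · simpa [hreg₁, hC.unit, hL] using hpow (C.H - (a + b)) (by omega)
  refine Triple.step rfl (fun _ => ?_) ?_ (by simp)
  · simp [hreg₁, hC.n, ha, hb]
    exact (hC.n ▸ hbd.reg _ : C.n ≤ V).trans (by omega)
  refine Triple.seq' (Triple.assignOp (fun _ => ?_) ?_) (by simp)
  · simpa [hreg₁, hC.unit, hC.n, ha, hb] using hpow (C.n - (a + b)) (by omega)
  refine Triple.step rfl (fun _ => ?_) ?_ (by simp)
  · simpa [hreg₁, hC.unit, hC.n, ha, hb, Op.eval, Nat.shiftLeft_eq, hC.m] using hslots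
  simp only [State.reg_setReg, Op.eval, Nat.shiftLeft_eq, Exp.eval_sub, Exp.eval_add, Exp.eval_var, Exp.eval_mul]
  norm_num [hreg₁, hC.unit, hC.n, ha, hb, hC.m, hL]
  set r := ((((((s₁.setReg 10 (2 ^ a)).setReg 11 (2 ^ b)).setReg 12 (2 ^ (C.H - (a + b)))).setReg 21
    (C.n - (a + b))).setReg 21 (2 ^ (C.n - (a + b)))).setReg 13 (2 ^ (C.n - (a + b)) * C.m)) with hr₀
  set C₁ : Ctx := {C.split a b with thr := s.reg v_thr, pow := s.reg v_pow, fix := s.reg v_fix,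
                                    call := s.reg v_call} with hC₁
  have hV' := hV.search a b hvalid
  have hrreg : ∀ x, ¬ (10 ≤ x ∧ x ≤ 13) → x ≠ 21 → x ≠ 22 → r.reg x = s.reg x := fun x h1 h2 h3 => by
    simp [hr₀, hs₁, h2, h3, show x ≠ 10 by omega, show x ≠ 11 by omega, show x ≠ 12 by omega,
      show x ≠ 13 by omega]
  refine Triple.mono (allThresholds_spec (C := C₁) hR ⟨hV'.sim, hV'.pow_le, hV'.table_le, hV'.scan_le⟩
    hV.base_eq hp hcall ⟨hopt.le, hopt.exists_eq, hopt.mod⟩ ?_ ?_ ?_) (by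
      have : thresholdsCost p R C₁ = thresholdsCost p R C := rfl
      rw [this]; omega) ?_
  · constructor
    case mem => exact hC.mem
    case S | T | N | X => simp [hr₀, hC₁, Ctx.split]
    all_goals rw [hrreg _ (by norm_num) (by norm_num) (by norm_num)]
    exacts [hC.m, hC.n, hC.base, hC.H, hC.cap, hC.capLog, hC.budget, ha, hb]
  · exact hr.congr (hrreg _ (by norm_num) (by norm_num) (by norm_num))
      (fun x hx => hrreg x (by omega) (by omega) (by omega)) rfl
  · rw [hrreg _ (by norm_num) (by norm_num) (by norm_num)]; exact hbest
  · rintro t ⟨h1, h2, h3, h4, h5, h6⟩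
    rw [hrreg _ (by norm_num) (by norm_num) (by norm_num)] at h4
    exact ⟨h1, h2, h3, h4, h5, fun _ hg => h6 hg⟩

end

end FlowHardness

/-! ### Computing the parameters, and the complete program. -/

namespace FlowHardness

/-- The parameters for a formula in memory. -/
def Ctx.ofMem (mem : ℕ → ℕ) (K q : ℕ) : Ctx where
  mem := mem
  m := mem 1
  n := mem 0
  base := clausePtr mem (mem 1)
  H := mem 0 + 3 * Nat.clog 2 (mem 1) + 2
  cap := 2 ^ (K * (2 * (mem 0 + 3 * Nat.clog 2 (mem 1) + 2) + 8))
  capLog := K * (2 * (mem 0 + 3 * Nat.clog 2 (mem 1) + 2) + 8)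
  budget := K * 2 ^ (mem 0 + 3 * Nat.clog 2 (mem 1) + 2 + 3 - (mem 0 + 3 * Nat.clog 2 (mem 1) + 2 + 3) / q) + 1
  a := 0
  b := 0
  S := 0
  T := 0
  N := 0
  X := 0
  thr := 0
  pow := 0
  fix := 0
  call := 0

/-- The bounds needed to compute the parameters. -/
structure Ctx.SetupFits (C : Ctx) (K q V : ℕ) : Prop where
  base_le : C.base ≤ V
  pow_le : 2 ^ (C.H + 3) ≤ V
  cap_le : C.cap ≤ V
  budget_le : C.budget ≤ V
  K_le : K ≤ V
  q_le : q ≤ V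

/-- The running time of `setup`. -/
def setupCost (C : Ctx) : ℕ := 16 * C.m + 16 * C.H + 100

theorem Prog.touches_setup {K q : ℕ} : (setup K q).Touches fun x =>
    (1 ≤ x ∧ x ≤ 7) ∨ (19 ≤ x ∧ x ≤ 22) ∨ (40 ≤ x ∧ x < 100) := by
  simp [setup]; simp [Touches]

theorem Prog.readOnly_setup {K q : ℕ} : (setup K q).ReadOnly := by
  simp [setup]; simp [ReadOnly]

theorem setup_spec {V K q : ℕ} {s : State} (hV : (Ctx.ofMem s.mem K q).SetupFits K q V) :
    Triple V (.setup K q) s (setupCost (Ctx.ofMem s.mem K q)) fun t =>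
      (Ctx.ofMem s.mem K q).Outer t ∧ t.mem = s.mem ∧
        ∀ x, ¬ ((1 ≤ x ∧ x ≤ 7) ∨ (19 ≤ x ∧ x ≤ 22) ∨ (40 ≤ x ∧ x < 100)) → t.reg x = s.reg x := by
  refine Triple.mono (((Triple.frame_mem Prog.readOnly_setup ?_).frame Prog.touches_setup))
    (T₁ := setupCost (Ctx.ofMem s.mem K q))
    (R := fun t => ((t.reg v_m = s.mem 1 ∧ t.reg v_n = s.mem 0 ∧ t.reg v_base = clausePtr s.mem (s.mem 1) ∧
      t.reg v_H = (Ctx.ofMem s.mem K q).H ∧ t.reg v_cap = (Ctx.ofMem s.mem K q).cap ∧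
      t.reg v_capLog = (Ctx.ofMem s.mem K q).capLog ∧ t.reg v_budget = (Ctx.ofMem s.mem K q).budget ∧
      t.reg v_unit = 1 ∧ t.reg v_bound = (Ctx.ofMem s.mem K q).H + 1) ∧ t.mem = s.mem) ∧ _)
    le_rfl ?_
  swap
  · rintro t ⟨⟨⟨h1, h2, h3, h4, h5, h6, h7, h8, h9⟩, hm⟩, hf⟩
    exact ⟨⟨h1, h2, h3, h4, h5, h6, h7, h8, h9, fun x _ => by rw [hm]; rfl⟩, hm, hf⟩
  obtain ⟨hbase, hpow, hcap, hbud, hK, hq⟩ := hV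
  generalize hμ : Nat.clog 2 (s.mem 1) = μ at *
  have hbase' : clausePtr s.mem (s.mem 1) ≤ V := hbase
  have hHV : (Ctx.ofMem s.mem K q).H + 3 < V := Nat.lt_two_pow_self.trans_le hpow
  have hlogV : (Ctx.ofMem s.mem K q).capLog ≤ V := Nat.lt_two_pow_self.le.trans hcap
  have hHe : (Ctx.ofMem s.mem K q).H = s.mem 0 + 3 * μ + 2 := by rw [← hμ]; rfl
  have hcapLog : (Ctx.ofMem s.mem K q).capLog = K * (2 * (Ctx.ofMem s.mem K q).H + 8) := rfl
  have hcape : (Ctx.ofMem s.mem K q).cap = 2 ^ (Ctx.ofMem s.mem K q).capLog := rfl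
  have hbude : (Ctx.ofMem s.mem K q).budget =
    K * 2 ^ ((Ctx.ofMem s.mem K q).H + 3 - ((Ctx.ofMem s.mem K q).H + 3) / q) + 1 := rfl
  have hcost : setupCost (Ctx.ofMem s.mem K q) = 16 * s.mem 1 + 16 * (Ctx.ofMem s.mem K q).H + 100 := rfl
  rw [hcost]
  generalize (Ctx.ofMem s.mem K q).H = H at *
  generalize (Ctx.ofMem s.mem K q).cap = cap at *
  generalize (Ctx.ofMem s.mem K q).capLog = capLog at *
  generalize (Ctx.ofMem s.mem K q).budget = budget at *
  refine Triple.of_bounded fun hb => ?_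
  have h8 := hb.eight_le
  unfold Prog.setup
  have hm0 := hb.mem 0
  have hm1 := hb.mem 1
  refine Triple.step rfl (fun _ => by simpa using hm0) ?_
  refine Triple.step rfl (fun _ => by simpa using hm1) ?_
  refine Triple.step rfl (fun _ => by simp; omega) ?_
  refine Triple.step rfl (fun _ => by simp; omega) ?_
  refine Triple.seq' (Triple.forDo (N := s.mem 1) (T := 8)
    (fun j t => t.reg v_base = clausePtr s.mem j ∧ t.mem = s.mem ∧ t.reg v_n = s.mem 0 ∧
      t.reg v_m = s.mem 1 ∧ t.reg v_unit = 1) ?_ (by norm_num) (by simp) ?_ ?_ ?_) (by simp; omega)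
  · simp
  · simp [clausePtr]
  · rintro j hj t htj - ⟨h1, h2, h3, h4, h5⟩
    have hle : clausePtr s.mem (j + 1) ≤ clausePtr s.mem (s.mem 1) := clausePtr_mono _ hj
    have hv : (𝕣 v_base + 1 + .load (𝕣 v_base) : Exp).eval t = clausePtr s.mem (j + 1) := by
      simp [h1, h2, clausePtr]
    refine Triple.last rfl (fun _ => by rw [hv]; omega) ?_ (by simp)
    rw [hv]
    simp [h2, h3, h4, h5]
  rintro t - ⟨h1, h2, h3, h4, h5⟩
  refine Triple.step rfl (fun _ => by simp) ?_ (by simp; omega)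
  refine Triple.step rfl (fun _ => by simp; omega) ?_ (by simp; omega)
  -- Doubling until `m` is reached computes the ceiling of the binary logarithm of `m`.
  refine Triple.seq' (Triple.mono (Triple.whileDo (T := 8)
    (fun t => t.reg v_base = clausePtr s.mem (s.mem 1) ∧ t.reg v_n = s.mem 0 ∧
      t.reg v_m = s.mem 1 ∧ t.reg v_unit = 1 ∧ t.reg v_G = 2 ^ t.reg v_L ∧ t.reg v_L ≤ μ)
    (fun t => μ - t.reg v_L) (Q := fun t => t.reg v_base = clausePtr s.mem (s.mem 1) ∧ t.reg v_n = s.mem 0 ∧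
      t.reg v_m = s.mem 1 ∧ t.reg v_unit = 1 ∧ t.reg v_L = μ) rfl ?_ ?_ ?_)
      (T₂ := 16 * μ + 10) (by simp; omega) ?_) (by simp; omega)
  · rintro u ⟨g1, g2, g3, g4, g5, g6⟩ hne
    have hlt : 2 ^ u.reg v_L < s.mem 1 := by simp [g3, g5] at hne; omega
    have hL : u.reg v_L < μ := by
      rw [← hμ]; exact (Nat.lt_clog_iff_pow_lt (by norm_num)).2 hlt
    have : 2 ^ (u.reg v_L + 1) ≤ V := (Nat.pow_le_pow_right (by norm_num) (by omega)).trans hpow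
    refine Triple.step rfl (fun _ => ?_) ?_
    · simpa [g5, ← pow_succ] using this
    refine Triple.last rfl (fun _ => by simp; omega) ?_
    simp [g1, g2, g3, g4, g5, pow_succ]
    omega
  · simp [h1, h3, h4, h5]
  · rintro u ⟨g1, g2, g3, g4, g5, g6⟩ he
    have hle : s.mem 1 ≤ 2 ^ u.reg v_L := by simp [g3, g5] at he; omega
    have : μ ≤ u.reg v_L := by rw [← hμ]; exact Nat.clog_le_of_le_pow hle
    exact ⟨g1, g2, g3, g4, by omega⟩
  rintro u ⟨g1, g2, g3, g4, g5⟩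
  refine Triple.step rfl (fun _ => by simp [g2, g5]; omega) ?_ (by simp; omega)
  simp only [Exp.eval_add, Exp.eval_mul, Exp.eval_var, Exp.eval_ofNat, g2, g5, ← hHe]
  refine Triple.step rfl (fun _ => by simp; omega) ?_ (by simp; omega)
  refine Triple.seq' (Triple.constant hK ?_) (by simp; omega)
  refine Triple.step rfl (fun _ => ?_) ?_ (by simp; omega)
  · simpa [← hcapLog] using hlogV
  have e1 : (𝕣 v_tmp * (2 * 𝕣 v_H + 8) : Exp).eval (((u.setReg v_H H).setReg v_bound
    ((𝕣 v_H + 1 : Exp).eval (u.setReg v_H H))).setReg v_tmp K) = capLog := by simp [hcapLog]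
  rw [e1]
  refine Triple.seq' (Triple.assignOp (fun _ => ?_) ?_) (by simp; omega)
  · simpa [g4, Op.eval, Nat.shiftLeft_eq, ← hcape] using hcap
  refine Triple.seq' (Triple.constant hq ?_) (by simp; omega)
  refine Triple.step rfl (fun _ => ?_) ?_ (by simp; omega)
  · exact (Nat.sub_le _ _).trans (by simp; omega)
  have hx : 2 ^ (H + 3 - (H + 3) / q) ≤ V := (Nat.pow_le_pow_right (by norm_num) (Nat.sub_le _ _)).trans hpow
  refine Triple.seq' (Triple.assignOp (fun _ => ?_) ?_) (by simp; omega)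
  · simpa [g4, Op.eval, Nat.shiftLeft_eq] using hx
  refine Triple.last rfl (fun _ => ?_) ?_ (by simp; omega)
  · simpa [g4, Op.eval, Nat.shiftLeft_eq, ← hbude] using hbud
  · simp [g1, g2, g3, g4, Op.eval, Nat.shiftLeft_eq, hcape, hbude]

section
variable {V : ℕ} {C : Ctx} {p : Prog} {R opt K q : ℕ}

/-- The running time of the two loops of `maxSat`. -/
def loopsCost (p : Prog) (R : ℕ) (C : Ctx) : ℕ :=
  (C.H + 1) * ((C.H + 1) * (guessCost p R C + 8) + 6 + 8) + 6

/-- Since `v_best` never decreases and never exceeds `opt`, a single good pair `(a₀, b₀)` settles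
the outcome, and the other pairs can do no harm. -/
theorem guesses_spec (hR : p.sim.Touches fun x => 40 ≤ x ∧ x < 100 + R) (hV : C.OuterFits V)
    (hp : p.ConstLe V) (hopt : C.IsOpt opt)
    {s : State} (hC : C.Outer s) (hcall : s.reg v_call = 0) (hr : Ready C.base R s)
    (hbest : s.reg v_best ≤ opt)
    (hgood : ∃ a b, a ≤ C.H ∧ b ≤ C.H ∧ C.Valid a b ∧ (C.split a b).AllAnswered p) :
    Triple V (.forDo v_a v_bound (.forDo v_b v_bound (.guess p R))) s (loopsCost p R C) fun t =>
      C.Outer t ∧ t.reg v_best = opt := by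
  obtain ⟨a₀, b₀, ha₀, hb₀, hval, hans⟩ := hgood
  have hcl := hV.calls_le
  unfold loopsCost
  have houter : ∀ {s t : State}, C.Outer s → (∀ x, x ≠ 8 → x ≠ 9 → t.reg x = s.reg x) →
      t.mem = s.mem → C.Outer t := by
    intro s t hs hreg hmem
    constructor
    case mem => rw [hmem]; exact hs.mem
    all_goals rw [hreg _ (by norm_num) (by norm_num)]
    exacts [hs.m, hs.n, hs.base, hs.H, hs.cap, hs.capLog, hs.budget, hs.unit, hs.bound]
  refine Triple.forDo (N := C.H + 1) (T := (C.H + 1) * (guessCost p R C + 8) + 6)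
    (fun i t => C.Outer t ∧ Ready C.base R t ∧ t.reg v_call ≤ i * ((C.H + 1) * (C.m * C.n)) ∧
      t.reg v_best ≤ opt ∧ (a₀ < i → t.reg v_best = opt)) hC.bound (by norm_num) ?_ ?_ ?_ ?_
  · have h1 := (Prog.touches_guess hR).mono (A' := fun x => x ≠ 8 ∧ x ≠ 20) fun x hx => by omega
    simp [h1]
  · refine ⟨houter hC (fun x h1 h2 => by simp [h1]) rfl,
      hr.congr (by simp) (fun x hx => by simp [show x ≠ 8 by omega]) rfl, by simp [hcall], by simpa using hbest, by simp⟩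
  · rintro i hi t hti - ⟨h1, h2, h3, h4, h5⟩
    have hstep : (i + 1) * ((C.H + 1) * (C.m * C.n)) ≤ (C.H + 1) * ((C.H + 1) * (C.m * C.n)) :=
      Nat.mul_le_mul_right _ hi
    rw [add_mul, one_mul] at hstep
    refine Triple.forDo (N := C.H + 1) (T := guessCost p R C)
      (fun j u => C.Outer u ∧ Ready C.base R u ∧ u.reg v_a = i ∧
        u.reg v_call ≤ i * ((C.H + 1) * (C.m * C.n)) + j * (C.m * C.n) ∧
        u.reg v_best ≤ opt ∧ (a₀ < i ∨ (a₀ = i ∧ b₀ < j) → u.reg v_best = opt))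
      h1.bound (by norm_num) ?_ ?_ ?_ ?_
    · exact (Prog.touches_guess hR).mono fun x hx => by omega
    · refine ⟨houter h1 (fun x h1 h2 => by simp [h2]) rfl,
        h2.congr (by simp) (fun x hx => by simp [show x ≠ 9 by omega]) rfl, by simpa using hti,
        by simpa using h3, by simpa using h4, by simpa using h5⟩
    · rintro j hj u huj - ⟨g1, g2, ga, g3, g4, g5⟩
      have hstep' : (j + 1) * (C.m * C.n) ≤ (C.H + 1) * (C.m * C.n) := Nat.mul_le_mul_right _ hj
      rw [add_mul, one_mul] at hstep'
      refine Triple.mono ((guess_spec hR hV hp hopt g1 (by omega) g2 g4).frame (Prog.touches_guess hR)) le_rfl ?_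
      rintro r ⟨⟨k1, k2, k3, k4, k5, k6⟩, kf⟩
      refine ⟨houter k1 (fun x h1 h2 => by simp [h2]) rfl,
        k2.congr (by simp) (fun x hx => by simp [show x ≠ 9 by omega]) rfl, ?_, ?_, by simpa using k5, fun hor => ?_⟩
      · rw [State.reg_setReg, if_neg (by norm_num), kf _ (by norm_num), ga]
      · rw [State.reg_setReg, if_neg (by norm_num), Nat.succ_mul j]
        omega
      · rw [State.reg_setReg, if_neg (by norm_num)]
        by_cases hprev : a₀ < i ∨ (a₀ = i ∧ b₀ < j)
        · have := g5 hprev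
          omega
        · have ha : a₀ = i := by omega
          have hb : b₀ = j := by omega
          subst ha hb
          rw [ga, huj] at k6
          exact k6 hval hans
    · rintro u huj ⟨g1, g2, ga, g3, g4, g5⟩
      refine ⟨houter g1 (fun x h1 h2 => by simp [h1]) rfl,
        g2.congr (by simp) (fun x hx => by simp [show x ≠ 8 by omega]) rfl, ?_, by simpa using g4, fun h => ?_⟩
      · rw [State.reg_setReg, if_neg (by norm_num), add_mul, one_mul]; exact g3
      · rw [State.reg_setReg, if_neg (by norm_num)]
        exact g5 (by omega)
  · rintro t - ⟨h1, -, -, -, h5⟩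
    exact ⟨h1, h5 (by omega)⟩

/-- The running time of `maxSat`. -/
def maxSatCost (p : Prog) (R : ℕ) (C : Ctx) : ℕ := setupCost C + loopsCost p R C

theorem maxSat_spec (hR : p.sim.Touches fun x => 40 ≤ x ∧ x < 100 + R) {mem : ℕ → ℕ}
    (hC : C = Ctx.ofMem mem K q) (hs : C.SetupFits K q V) (hV : C.OuterFits V)
    (hp : p.ConstLe V) (hopt : C.IsOpt opt)
    (hzero : ∀ x, C.base ≤ x → mem x = 0)
    (hgood : ∃ a b, a ≤ C.H ∧ b ≤ C.H ∧ C.Valid a b ∧ (C.split a b).AllAnswered p) :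
    Triple V (.maxSat p R K q) ⟨fun _ => 0, mem⟩ (maxSatCost p R C) fun t =>
      t.reg v_m = mem 1 ∧ t.reg v_best = opt := by
  subst hC
  refine Triple.seq (Triple.mono (setup_spec (s := ⟨fun _ => 0, mem⟩) hs) le_rfl ?_)
  rintro t ⟨h1, h2, h3⟩
  refine Triple.mono (guesses_spec hR hV hp hopt h1 (h3 _ (by norm_num)) ⟨fun a => ?_, fun i hi => ?_⟩
    ((h3 _ (by norm_num)).le.trans (Nat.zero_le _)) hgood) le_rfl ?_
  -- Memory behind the formula is zero, so all stamps are zero, while the first call has number `1`.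
  · rw [h2]
    exact (hzero _ (by omega)).le.trans (Nat.zero_le _)
  · exact h3 _ (by omega)
  · exact fun u hu => ⟨hu.1.m, hu.2⟩

end

end FlowHardness

namespace FlowHardness

/-! ### Flows and cuts in unit-capacity networks -/

namespace STInst
variable {G : STInst} {s t : Fin G.n}

/-- Summing net outflow over `U` leaves only the contribution of `s`. Flow inside `U` cancels,
backward flow only lowers the sum, and each crossing edge carries at most one unit. -/
theorem IsFlow.value_le_cut {f : Fin G.n → Fin G.n → ℝ} (hf : G.IsFlow s t f) (U : Finset (Fin G.n))
    (hs : s ∈ U) (ht : t ∉ U) :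
    G.flowValue s f ≤ ((U ×ˢ Uᶜ).filter (· ∈ G.edges)).card := by
  have h1 : G.flowValue s f = ∑ u ∈ U, (∑ v, f u v - ∑ v, f v u) := by
    rw [Finset.sum_eq_single_of_mem s hs]
    · rfl
    · intro v hv hvs
      rw [hf.conservation v hvs fun h => ht (h ▸ hv), sub_self]
  have h2 : ∑ u ∈ U, (∑ v, f u v - ∑ v, f v u) =
      ∑ u ∈ U, ∑ v ∈ Uᶜ, f u v - ∑ u ∈ U, ∑ v ∈ Uᶜ, f v u := by
    have : ∀ g : Fin G.n → ℝ, ∑ v, g v = ∑ v ∈ U, g v + ∑ v ∈ Uᶜ, g v := fun g =>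
      (Finset.sum_add_sum_compl U g).symm
    simp only [this, Finset.sum_sub_distrib, Finset.sum_add_distrib]
    rw [Finset.sum_comm (s := U) (t := U)]
    ring
  rw [h1, h2]
  have h3 : 0 ≤ ∑ u ∈ U, ∑ v ∈ Uᶜ, f v u :=
    Finset.sum_nonneg fun u _ => Finset.sum_nonneg fun v _ => hf.nonneg _ _
  have h4 : ∑ u ∈ U, ∑ v ∈ Uᶜ, f u v ≤ ((U ×ˢ Uᶜ).filter (· ∈ G.edges)).card := by
    rw [← Finset.sum_product', Finset.card_filter, Nat.cast_sum]
    refine Finset.sum_le_sum fun e _ => ?_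
    split_ifs with h
    · simpa using hf.le_one e.1 e.2
    · simpa using (hf.support e.1 e.2 h).le
  linarith

/-- The flow with given amounts on a family of different edges. -/
def ofWeights {ι : Type*} (I : Finset ι) (src tgt : ι → Fin G.n) (w : ι → ℝ) (u v : Fin G.n) : ℝ :=
  ∑ i ∈ I, if src i = u ∧ tgt i = v then w i else 0

section
variable {ι : Type*} {I : Finset ι} {src tgt : ι → Fin G.n} {w : ι → ℝ}

theorem sum_ofWeights_left (v : Fin G.n) :
    ∑ u, G.ofWeights I src tgt w u v = ∑ i ∈ I, if tgt i = v then w i else 0 := by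
  simp only [ofWeights]
  rw [Finset.sum_comm]
  exact Finset.sum_congr rfl fun i _ => by simp [ite_and]

theorem sum_ofWeights_right (u : Fin G.n) :
    ∑ v, G.ofWeights I src tgt w u v = ∑ i ∈ I, if src i = u then w i else 0 := by
  simp only [ofWeights]
  rw [Finset.sum_comm]
  refine Finset.sum_congr rfl fun i _ => ?_
  by_cases h : src i = u <;> simp [h]

theorem isFlow_ofWeights (hw0 : ∀ i ∈ I, 0 ≤ w i) (hw1 : ∀ i ∈ I, w i ≤ 1)
    (hmem : ∀ i ∈ I, (src i, tgt i) ∈ G.edges)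
    (hinj : ∀ i ∈ I, ∀ j ∈ I, src i = src j → tgt i = tgt j → i = j)
    (hcons : ∀ v, v ≠ s → v ≠ t →
      (∑ i ∈ I, if tgt i = v then w i else 0) = ∑ i ∈ I, if src i = v then w i else 0) :
    G.IsFlow s t (G.ofWeights I src tgt w) where
  nonneg u v := Finset.sum_nonneg fun i hi => by split_ifs; exacts [hw0 i hi, le_rfl]
  le_one u v := by
    by_cases h : ∃ i ∈ I, src i = u ∧ tgt i = v
    · obtain ⟨i, hi, h1, h2⟩ := h
      rw [ofWeights, Finset.sum_eq_single_of_mem i hi, if_pos ⟨h1, h2⟩]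
      · exact hw1 i hi
      · exact fun j hj hji => if_neg fun h => hji (hinj j hj i hi (h.1.trans h1.symm) (h.2.trans h2.symm))
    · rw [ofWeights, Finset.sum_eq_zero fun i hi => if_neg fun hc => h ⟨i, hi, hc⟩]
      exact zero_le_one
  support u v h := Finset.sum_eq_zero fun i hi => if_neg fun (hc : src i = u ∧ tgt i = v) =>
    h (hc.1 ▸ hc.2 ▸ hmem i hi)
  conservation v hs ht := by rw [sum_ofWeights_left, sum_ofWeights_right, hcons v hs ht]

theorem flowValue_ofWeights : G.flowValue s (G.ofWeights I src tgt w) =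
    (∑ i ∈ I, if src i = s then w i else 0) - ∑ i ∈ I, if tgt i = s then w i else 0 := by
  rw [flowValue, sum_ofWeights_left, sum_ofWeights_right]

end

end STInst

theorem sum_range_mul {M : Type*} [AddCommMonoid M] (f : ℕ → M) (a b : ℕ) :
    ∑ x ∈ Finset.range (a * b), f x = ∑ i ∈ Finset.range a, ∑ j ∈ Finset.range b, f (i * b + j) := by
  induction a with
  | zero => simp
  | succ a ih => rw [Nat.succ_mul, Finset.sum_range_add, ih, Finset.sum_range_succ]

/-! ### The flow instance -/

namespace Ctx

/-- The sizes make sense; there are `M` middle parts. -/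
structure Sized (C : Ctx) (M : ℕ) : Prop where
  N_pos : 0 < C.N
  S_le : C.S ≤ C.N
  T_le : C.T ≤ C.N
  X_le : C.X ≤ C.N
  X_eq : C.X = M * C.m
  thr_lt : C.thr < C.m

variable {C : Ctx} {M : ℕ}

theorem Sized.div_lt (hC : C.Sized M) {x : ℕ} (hx : x < C.X) : x / C.m < M :=
  Nat.div_lt_of_lt_mul (by rw [mul_comm, ← hC.X_eq]; exact hx)

theorem Sized.edgeSrc_lt (hC : C.Sized M) {x y : ℕ} (hx : x < C.X) : C.edgeSrc x y < 8 * C.N := by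
  have h1 := hC.S_le; have h2 := hC.T_le; have h3 := hC.X_le
  have h4 := Nat.div_le_self x C.m
  unfold edgeSrc
  split_ifs <;> omega

theorem Sized.edgeTgt_lt (hC : C.Sized M) {x y : ℕ} (hx : x < C.X) : C.edgeTgt x y < 8 * C.N := by
  have h1 := hC.S_le; have h2 := hC.T_le; have h3 := hC.X_le
  have h4 := Nat.div_le_self x C.m
  unfold edgeTgt
  split_ifs <;> omega

/-- Every edge has an end in a range of slot nodes, which reveals `x`. The ranges of the two ends
tell the kind of row, and a source or sink end gives its index. The edge list must be free of
repetitions, so this covers the dummy edges too. -/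
theorem Sized.edge_inj (hC : C.Sized M) {x y x' y' : ℕ} (hx : x < C.X) (hx' : x' < C.X)
    (hy : y < C.S + 2 * C.T + 3) (hy' : y' < C.S + 2 * C.T + 3)
    (hs : C.edgeSrc x y = C.edgeSrc x' y') (ht : C.edgeTgt x y = C.edgeTgt x' y') :
    x = x' ∧ y = y' := by
  have h1 := hC.S_le; have h2 := hC.T_le; have h3 := hC.X_le
  have h4 := Nat.div_le_self x C.m
  have h5 := Nat.div_le_self x' C.m
  unfold edgeSrc at hs
  unfold edgeTgt at ht
  generalize x / C.m = d at *
  generalize x' / C.m = d' at *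
  split_ifs at hs <;> (first | omega | (split_ifs at ht <;> omega))

/-- The node with a given number. -/
def node (hN : 0 < C.N) (v : ℕ) : Fin (8 * C.N) := ⟨v % (8 * C.N), Nat.mod_lt _ (by omega)⟩

theorem node_val {hN : 0 < C.N} {v : ℕ} (hv : v < 8 * C.N) : (C.node hN v).val = v := Nat.mod_eq_of_lt hv

theorem node_inj {hN : 0 < C.N} {v w : ℕ} (hv : v < 8 * C.N) (hw : w < 8 * C.N)
    (h : C.node hN v = C.node hN w) : v = w := by
  rw [← node_val (hN := hN) hv, ← node_val (hN := hN) hw, h]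

theorem index_lt {e : ℕ} (he : e < C.numEdges) : e % C.X < C.X ∧ e / C.X < C.S + 2 * C.T + 3 := by
  have hX : 0 < C.X := Nat.pos_of_ne_zero fun h => by simp [numEdges, h] at he
  exact ⟨Nat.mod_lt _ hX, Nat.div_lt_of_lt_mul he⟩

/-- The flow instance. -/
def flowInst (hC : C.Sized M) : STInst where
  n := 8 * C.N
  edges := (List.range C.numEdges).map fun e =>
    (C.node hC.N_pos (C.edgeSrc (e % C.X) (e / C.X)), C.node hC.N_pos (C.edgeTgt (e % C.X) (e / C.X)))
  sources := (List.range C.S).map (C.node hC.N_pos)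
  sinks := (List.range C.T).map fun j => C.node hC.N_pos (C.N + j)
  edges_nodup := by
    refine List.Nodup.map_on (fun e he e' he' h => ?_) List.nodup_range
    rw [List.mem_range] at he he'
    obtain ⟨h1, h2⟩ := index_lt he
    obtain ⟨h1', h2'⟩ := index_lt he'
    rw [Prod.mk.injEq] at h
    obtain ⟨h3, h4⟩ := hC.edge_inj h1 h1' h2 h2'
      (node_inj (hC.edgeSrc_lt h1) (hC.edgeSrc_lt h1') h.1)
      (node_inj (hC.edgeTgt_lt h1) (hC.edgeTgt_lt h1') h.2)
    rw [← Nat.div_add_mod e C.X, h3, h4, Nat.div_add_mod]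
  sources_nodup := by
    refine List.Nodup.map_on (fun i hi j hj h => ?_) List.nodup_range
    have := hC.S_le
    rw [List.mem_range] at hi hj
    exact node_inj (by omega) (by omega) h
  sinks_nodup := by
    refine List.Nodup.map_on (fun i hi j hj h => ?_) List.nodup_range
    have := hC.T_le
    have := hC.N_pos
    rw [List.mem_range] at hi hj
    have := node_inj (by omega) (by omega) h
    omega

/-- The vertex with a given number. -/
def vertex (hC : C.Sized M) (v : ℕ) : Fin (flowInst hC).n := C.node hC.N_pos v

theorem vertex_val (hC : C.Sized M) {v : ℕ} (hv : v < 8 * C.N) : (vertex hC v).val = v := node_val hv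

theorem vertex_eq_iff (hC : C.Sized M) {v : ℕ} (hv : v < 8 * C.N) {w : Fin (flowInst hC).n} :
    vertex hC v = w ↔ v = w.val := by
  rw [Fin.ext_iff, vertex_val hC hv]

theorem mem_edges_flowInst (hC : C.Sized M) {e : Fin (flowInst hC).n × Fin (flowInst hC).n} :
    e ∈ (flowInst hC).edges ↔ ∃ x < C.X, ∃ y < C.S + 2 * C.T + 3,
      e = (vertex hC (C.edgeSrc x y), vertex hC (C.edgeTgt x y)) := by
  refine List.mem_map.trans ?_
  simp only [List.mem_range]
  constructor
  · rintro ⟨i, hi, rfl⟩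
    exact ⟨_, (index_lt hi).1, _, (index_lt hi).2, rfl⟩
  · rintro ⟨x, hx, y, hy, rfl⟩
    have hX : 0 < C.X := by omega
    refine ⟨C.X * y + x, ?_, ?_⟩
    · have : C.X * (y + 1) ≤ C.numEdges := Nat.mul_le_mul_left _ hy
      rw [Nat.mul_succ] at this
      omega
    · rw [Nat.mul_add_mod, Nat.mod_eq_of_lt hx, Nat.mul_add_div hX, Nat.div_eq_of_lt hx, add_zero]
      rfl

/-- The source side of a cut. -/
def CutSide (C : Ctx) (α β γ v : ℕ) : Prop :=
  v = α ∨ (C.N ≤ v ∧ v < 2 * C.N ∧ v ≠ C.N + β) ∨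
  (2 * C.N ≤ v ∧ v < 3 * C.N ∧ (v - 2 * C.N) / C.m = γ ∧ C.SourceUnsat α (v - 2 * C.N)) ∨
  (3 * C.N ≤ v ∧ v < 4 * C.N ∧ (v - 3 * C.N) / C.m = γ) ∨
  (6 * C.N ≤ v ∧ v < 7 * C.N ∧ (v - 6 * C.N) / C.m = γ) ∨ v = 7 * C.N + γ

/-- The cut keeps on the source side the block `γ` with its hub, together with everything that would
add needless crossings: the other sinks, which have no outgoing edges, and the dummy outlets of the
block. What leaves it are the edges from `α` to other blocks, the direct edges to `β`, and the
useful outlets of the hub. -/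
theorem crossing (hC : C.Sized M) {α β γ x y : ℕ} (hα : α < C.S) (hβ : β < C.T) (hγ : γ < M) (hx : x < C.X)
    (hy : y < C.S + 2 * C.T + 3)
    (hs : C.CutSide α β γ (C.edgeSrc x y)) (ht : ¬ C.CutSide α β γ (C.edgeTgt x y)) :
    (y = α ∧ x / C.m ≠ γ) ∨ (y = C.S + β ∧ x / C.m = γ ∧ C.SourceUnsat α x ∧ C.SinkUnsat β x) ∨
      (y = C.S + 2 * C.T + 2 ∧ x / C.m = γ ∧ C.thr < x % C.m) := by
  have h1 := hC.S_le; have h2 := hC.T_le; have h3 := hC.X_le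
  have h4 := hC.div_lt hx
  have hm : 0 < C.m := Nat.zero_lt_of_lt hC.thr_lt
  have h5 : M ≤ C.X := hC.X_eq ▸ Nat.le_mul_of_pos_right M hm
  have e2 : 2 * C.N + x - 2 * C.N = x := by omega
  have e3 : 3 * C.N + x - 3 * C.N = x := by omega
  have e6 : 6 * C.N + x - 6 * C.N = x := by omega
  have c2 : C.CutSide α β γ (2 * C.N + x) ↔ x / C.m = γ ∧ C.SourceUnsat α x := by
    unfold CutSide; rw [e2]
    constructor
    · rintro (h | h | h | h | h | h)
      all_goals first | exact h.2.2 | omega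
    · exact fun h => .inr (.inr (.inl ⟨by omega, by omega, h⟩))
  have c3 : C.CutSide α β γ (3 * C.N + x) ↔ x / C.m = γ := by
    unfold CutSide; rw [e3]; omega
  have c4 : ¬ C.CutSide α β γ (4 * C.N + x) := by
    unfold CutSide; omega
  have c5 : ¬ C.CutSide α β γ (5 * C.N + x) := by
    unfold CutSide; omega
  have c6 : C.CutSide α β γ (6 * C.N + x) ↔ x / C.m = γ := by
    unfold CutSide; rw [e6]; omega
  have c7 : ∀ d < C.N, C.CutSide α β γ (7 * C.N + d) ↔ d = γ := fun d hd => by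
    unfold CutSide; omega
  have c0 : ∀ d < C.N, C.CutSide α β γ d ↔ d = α := fun d hd => by
    unfold CutSide; omega
  have c1 : ∀ d < C.N, C.CutSide α β γ (C.N + d) ↔ d ≠ β := fun d hd => by
    unfold CutSide; omega
  have c7' := c7 (x / C.m) (by omega)
  unfold edgeSrc at hs
  unfold edgeTgt at ht
  by_cases y1 : y < C.S
  · rw [if_pos y1, c0 _ (by omega)] at hs
    rw [if_pos y1] at ht
    subst hs
    refine .inl ⟨rfl, fun h => ?_⟩
    split_ifs at ht with hP
    · exact ht (c2.2 ⟨h, hP⟩)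
    · exact ht (c3.2 h)
  rw [if_neg y1] at hs ht
  by_cases y2 : y < C.S + C.T
  · rw [if_pos y2] at hs ht
    rw [c1 _ (by omega), not_not] at ht
    split_ifs at hs with hQ
    · rw [ht] at hQ
      exact .inr (.inl ⟨by omega, (c2.1 hs).1, (c2.1 hs).2, hQ⟩)
    · exact absurd hs c4
  rw [if_neg y2] at hs ht
  by_cases y3 : y < C.S + 2 * C.T
  · rw [if_pos y3] at hs
    exact absurd hs c5
  rw [if_neg y3] at hs ht
  by_cases y4 : y < C.S + 2 * C.T + 1
  · rw [if_pos y4] at hs ht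
    exact absurd (c7'.2 (c2.1 hs).1) ht
  rw [if_neg y4] at hs ht
  by_cases y5 : y < C.S + 2 * C.T + 2
  · rw [if_pos y5] at hs ht
    exact absurd (c7'.2 (c3.1 hs)) ht
  rw [if_neg y5] at hs ht
  have hd := c7'.1 hs
  split_ifs at ht with hthr
  · exact .inr (.inr ⟨by omega, hd, hthr⟩)
  · exact absurd (c6.2 hd) ht

/-- The number of clauses that neither the source `α` with the middle part `γ` nor the sink `β`
satisfies. -/
def deficit (C : Ctx) (α β γ : ℕ) : ℕ :=
  ((Finset.range C.m).filter fun i =>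
    C.SourceUnsat α (γ * C.m + i) ∧ C.SinkUnsat β (γ * C.m + i)).card

theorem block_eq {γ : ℕ} (hγ : γ < M) (hC : C.Sized M) (Q : ℕ → Prop) [DecidablePred Q] :
    ((Finset.range C.X).filter fun x => x / C.m = γ ∧ Q x).card =
      ((Finset.range C.m).filter fun i => Q (γ * C.m + i)).card := by
  have hm : 0 < C.m := Nat.zero_lt_of_lt hC.thr_lt
  refine (Finset.card_bij (fun i _ => γ * C.m + i) ?_ ?_ ?_).symm
  · intro i hi
    rw [Finset.mem_filter, Finset.mem_range] at hi ⊢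
    have : (γ + 1) * C.m ≤ M * C.m := Nat.mul_le_mul_right _ hγ
    rw [Nat.succ_mul] at this
    refine ⟨by rw [hC.X_eq]; omega, ?_, hi.2⟩
    rw [mul_comm, Nat.mul_add_div hm, Nat.div_eq_of_lt hi.1, add_zero]
  · exact fun i _ j _ h => Nat.add_left_cancel h
  · intro x hx
    rw [Finset.mem_filter, Finset.mem_range] at hx
    obtain ⟨hx, rfl, hQ⟩ := hx
    refine ⟨x % C.m, ?_, Nat.div_add_mod' x C.m⟩
    rw [Finset.mem_filter, Finset.mem_range, Nat.div_add_mod']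
    exact ⟨Nat.mod_lt _ hm, hQ⟩

/-- The three kinds of crossing edges number `X - m`, the deficit, and `m - (thr + 1)`. With a
deficit of at most `thr` the total is below `X`. -/
theorem flow_lt_of_deficit_le (hC : C.Sized M) {α β γ : ℕ} (hα : α < C.S) (hβ : β < C.T) (hγ : γ < M)
    (h : C.deficit α β γ ≤ C.thr) {f}
    (hf : (flowInst hC).IsFlow (vertex hC α) (vertex hC (C.N + β)) f) :
    (flowInst hC).flowValue (vertex hC α) f < C.X := by
  classical
  have h1 := hC.S_le; have h2 := hC.T_le; have h3 := hC.X_le; have hthr := hC.thr_lt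
  have hN := hC.N_pos
  have hm : 0 < C.m := Nat.zero_lt_of_lt hC.thr_lt
  set U : Finset (Fin (flowInst hC).n) := Finset.univ.filter fun v => C.CutSide α β γ v.val with hU
  have hle := hf.value_le_cut U
    (by
      rw [hU, Finset.mem_filter, vertex_val hC (by omega)]
      exact ⟨Finset.mem_univ _, .inl rfl⟩)
    (by
      rw [hU, Finset.mem_filter, vertex_val hC (by omega), CutSide]
      omega)
  refine hle.trans_lt (Nat.cast_lt.2 ?_)
  set I : Finset (ℕ × ℕ) :=
    ((Finset.range C.X).filter fun x => ¬ x / C.m = γ).image (fun x => (x, α)) ∪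
    (((Finset.range C.X).filter fun x => x / C.m = γ ∧ (C.SourceUnsat α x ∧ C.SinkUnsat β x)).image
      (fun x => (x, C.S + β)) ∪
    ((Finset.range C.X).filter fun x => x / C.m = γ ∧ C.thr < x % C.m).image
      (fun x => (x, C.S + 2 * C.T + 2))) with hI
  have hsub : (U ×ˢ Uᶜ).filter (· ∈ (flowInst hC).edges) ⊆
      I.image fun i => (vertex hC (C.edgeSrc i.1 i.2), vertex hC (C.edgeTgt i.1 i.2)) := by
    rintro e he
    rw [Finset.mem_filter, Finset.mem_product, Finset.mem_compl, mem_edges_flowInst] at he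
    obtain ⟨⟨hs, ht⟩, x, hx, y, hy, rfl⟩ := he
    simp only [hU, Finset.mem_filter, Finset.mem_univ, true_and, vertex_val hC (hC.edgeSrc_lt hx),
      vertex_val hC (hC.edgeTgt_lt hx)] at hs ht
    refine Finset.mem_image.2 ⟨(x, y), ?_, rfl⟩
    have := crossing hC hα hβ hγ hx hy hs ht
    simp only [hI, Finset.mem_union, Finset.mem_image, Finset.mem_filter, Finset.mem_range, Prod.mk.injEq]
    rcases this with ⟨rfl, h'⟩ | ⟨rfl, h'⟩ | ⟨rfl, h'⟩
    · exact .inl ⟨x, ⟨hx, h'⟩, rfl, rfl⟩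
    · exact .inr (.inl ⟨x, ⟨hx, h'⟩, rfl, rfl⟩)
    · exact .inr (.inr ⟨x, ⟨hx, h'⟩, rfl, rfl⟩)
  refine ((Finset.card_le_card hsub).trans Finset.card_image_le).trans_lt ?_
  have hblock := block_eq hγ hC fun _ => True
  simp only [and_true, Finset.filter_true, Finset.card_range] at hblock
  have hcompl := Finset.card_filter_add_card_filter_not (s := Finset.range C.X) (fun x => x / C.m = γ)
  rw [hblock, Finset.card_range] at hcompl
  have hA2 := block_eq hγ hC fun x => C.SourceUnsat α x ∧ C.SinkUnsat β x
  have hA3 := block_eq hγ hC fun x => C.thr < x % C.m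
  have hA3' : ((Finset.range C.m).filter fun i => C.thr < (γ * C.m + i) % C.m).card = C.m - (C.thr + 1) := by
    rw [← Nat.card_Ico]
    congr 1
    ext i
    simp only [Finset.mem_filter, Finset.mem_range, Finset.mem_Ico]
    constructor
    · rintro ⟨hi, h⟩
      rw [Nat.mul_add_mod_of_lt hi] at h
      omega
    · rintro ⟨h, hi⟩
      rw [Nat.mul_add_mod_of_lt hi]
      omega
  have hc1 := Finset.card_image_le (s := (Finset.range C.X).filter fun x => ¬ x / C.m = γ) (f := fun x => (x, α))
  have hc2 := Finset.card_image_le (s := (Finset.range C.X).filter fun x =>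
    x / C.m = γ ∧ (C.SourceUnsat α x ∧ C.SinkUnsat β x)) (f := fun x => (x, C.S + β))
  have hc3 := Finset.card_image_le (s := (Finset.range C.X).filter fun x =>
    x / C.m = γ ∧ C.thr < x % C.m) (f := fun x => (x, C.S + 2 * C.T + 2))
  have hun := Finset.card_union_le _ _ |>.trans (Nat.add_le_add_left (Finset.card_union_le
    (((Finset.range C.X).filter fun x => x / C.m = γ ∧ (C.SourceUnsat α x ∧ C.SinkUnsat β x)).image
      (fun x => (x, C.S + β))) (((Finset.range C.X).filter fun x => x / C.m = γ ∧ C.thr < x % C.m).image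
      (fun x => (x, C.S + 2 * C.T + 2)))) (((Finset.range C.X).filter fun x => ¬ x / C.m = γ).image (fun x => (x, α))).card)
  rw [← hI] at hun
  unfold deficit at h
  omega

end Ctx
end FlowHardness

/-! ### A flow that saturates the source, and the value of the maximum flow. -/

namespace FlowHardness

namespace Ctx
variable {C : Ctx} {M : ℕ}

/-- The edges used by a flow from `α` to `β` that takes the short way in the given slots. -/
def used (C : Ctx) (α β : ℕ) (short : ℕ → Prop) [DecidablePred short] (x y : ℕ) : ℝ :=
  (if y = α then 1 else 0) + (if y = C.S + β ∧ short x then 1 else 0) +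
  (if y = C.S + 2 * C.T + (if C.SourceUnsat α x then 0 else 1) ∧ ¬ short x then 1 else 0) +
  (if y = C.S + 2 * C.T + 2 ∧ C.thr < x % C.m then 1 else 0) +
  (if y = C.S + C.T + β ∧ C.thr < x % C.m then 1 else 0)

variable {α β : ℕ} {short : ℕ → Prop} [DecidablePred short]

theorem used_nonneg (x y : ℕ) : 0 ≤ C.used α β short x y := by
  unfold used
  have : ∀ (P : Prop) [Decidable P], (0 : ℝ) ≤ if P then 1 else 0 := fun P _ => by split_ifs <;> norm_num
  have h1 := this (y = α)
  positivity

theorem used_le_one (hα : α < C.S) (hβ : β < C.T) (x y : ℕ) : C.used α β short x y ≤ 1 := by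
  unfold used
  split_ifs <;> first | (exfalso; omega) | norm_num

/-- With `F` the indicator that an end of the edge is a given node, this one identity yields both
the inflow and the outflow of every node. -/
theorem sum_used (hα : α < C.S) (hβ : β < C.T) (x : ℕ) (F : ℕ → ℝ) :
    ∑ y ∈ Finset.range (C.S + 2 * C.T + 3), C.used α β short x y * F y =
      F α + (if short x then F (C.S + β) else
        F (C.S + 2 * C.T + (if C.SourceUnsat α x then 0 else 1))) +
      if C.thr < x % C.m then F (C.S + 2 * C.T + 2) + F (C.S + C.T + β) else 0 := by
  have key : ∀ (z : ℕ) (P : Prop) [Decidable P], z < C.S + 2 * C.T + 3 →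
      ∑ y ∈ Finset.range (C.S + 2 * C.T + 3), (if y = z ∧ P then (1 : ℝ) else 0) * F y =
        if P then F z else 0 := fun z P _ hz => by
    rw [Finset.sum_eq_single_of_mem z (Finset.mem_range.2 hz)]
    · by_cases h : P <;> simp [h]
    · exact fun y _ hy => by rw [if_neg fun h => hy h.1, zero_mul]
  have key' := key α True (by omega)
  simp only [and_true, if_true] at key'
  unfold used
  simp only [add_mul, Finset.sum_add_distrib]
  rw [key', key _ _ (by omega), key _ _ (by split_ifs <;> omega), key _ _ (by omega), key _ _ (by omega)]
  split_ifs <;> ring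

/-- The start of the path for a slot. -/
def startNode (C : Ctx) (α x : ℕ) : ℕ := if C.SourceUnsat α x then 2 * C.N + x else 3 * C.N + x

theorem edge_start (hα : α < C.S) (x : ℕ) :
    C.edgeSrc x α = α ∧ C.edgeTgt x α = C.startNode α x := by
  simp [edgeSrc, edgeTgt, hα, startNode]

theorem edge_short (hβ : β < C.T) {x : ℕ} (hP : C.SourceUnsat α x) (hQ : C.SinkUnsat β x) :
    C.edgeSrc x (C.S + β) = C.startNode α x ∧ C.edgeTgt x (C.S + β) = C.N + β := by
  simp [edgeSrc, edgeTgt, hβ, startNode, hP, hQ]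

theorem edge_collect (x : ℕ) :
    C.edgeSrc x (C.S + 2 * C.T + (if C.SourceUnsat α x then 0 else 1)) = C.startNode α x ∧
    C.edgeTgt x (C.S + 2 * C.T + (if C.SourceUnsat α x then 0 else 1)) = 7 * C.N + x / C.m := by
  unfold edgeSrc edgeTgt startNode
  by_cases hP : C.SourceUnsat α x
  · simp only [hP, if_true]
    rw [if_neg (by omega), if_neg (by omega), if_neg (by omega), if_pos (by omega), if_neg (by omega),
      if_neg (by omega), if_neg (by omega), if_pos (by omega)]
    exact ⟨rfl, rfl⟩
  · simp only [hP, if_false]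
    rw [if_neg (by omega), if_neg (by omega), if_neg (by omega), if_neg (by omega), if_pos (by omega),
      if_neg (by omega), if_neg (by omega), if_neg (by omega), if_neg (by omega), if_pos (by omega)]
    exact ⟨rfl, rfl⟩

theorem edge_distribute {x : ℕ} (hx : C.thr < x % C.m) :
    C.edgeSrc x (C.S + 2 * C.T + 2) = 7 * C.N + x / C.m ∧
    C.edgeTgt x (C.S + 2 * C.T + 2) = 5 * C.N + x := by
  unfold edgeSrc edgeTgt
  rw [if_neg (by omega), if_neg (by omega), if_neg (by omega), if_neg (by omega), if_neg (by omega),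
    if_neg (by omega), if_neg (by omega), if_neg (by omega), if_neg (by omega), if_neg (by omega), if_pos hx]
  exact ⟨rfl, rfl⟩

theorem edge_finish (hβ : β < C.T) (x : ℕ) :
    C.edgeSrc x (C.S + C.T + β) = 5 * C.N + x ∧ C.edgeTgt x (C.S + C.T + β) = C.N + β := by
  unfold edgeSrc edgeTgt
  rw [if_neg (by omega), if_neg (by omega), if_pos (by omega), if_neg (by omega), if_neg (by omega),
    if_pos (by omega), Nat.add_sub_cancel_left]
  exact ⟨rfl, rfl⟩

/-- In every block of slots as many paths are collected as are distributed. -/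
theorem sum_collect_eq (hC : C.Sized M)
    (hcard : ∀ γ < M, ((Finset.range C.m).filter fun i => short (γ * C.m + i)).card = C.thr + 1)
    (F : ℕ → ℝ) :
    ∑ x ∈ Finset.range C.X, (if short x then 0 else F (x / C.m)) =
      ∑ x ∈ Finset.range C.X, if C.thr < x % C.m then F (x / C.m) else 0 := by
  have hm : 0 < C.m := Nat.zero_lt_of_lt hC.thr_lt
  rw [hC.X_eq, sum_range_mul, sum_range_mul]
  refine Finset.sum_congr rfl fun γ hγ => ?_
  rw [Finset.mem_range] at hγ
  have hdiv : ∀ i ∈ Finset.range C.m, (γ * C.m + i) / C.m = γ ∧ (γ * C.m + i) % C.m = i := fun i hi => by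
    rw [Finset.mem_range] at hi
    rw [Nat.mul_add_mod_of_lt hi, mul_comm, Nat.mul_add_div hm, Nat.div_eq_of_lt hi, add_zero]
    exact ⟨rfl, rfl⟩
  have h1 : ∑ i ∈ Finset.range C.m, (if short (γ * C.m + i) then 0 else F ((γ * C.m + i) / C.m)) =
      ((Finset.range C.m).filter fun i => ¬ short (γ * C.m + i)).card * F γ := by
    rw [← nsmul_eq_mul, ← Finset.sum_const, Finset.sum_filter]
    exact Finset.sum_congr rfl fun i hi => by rw [(hdiv i hi).1, ite_not]
  have h2 : ∑ i ∈ Finset.range C.m, (if C.thr < (γ * C.m + i) % C.m then F ((γ * C.m + i) / C.m) else 0) =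
      ((Finset.range C.m).filter fun i => C.thr < i).card * F γ := by
    rw [← nsmul_eq_mul, ← Finset.sum_const, Finset.sum_filter]
    exact Finset.sum_congr rfl fun i hi => by rw [(hdiv i hi).1, (hdiv i hi).2]
  have h3 := Finset.card_filter_add_card_filter_not (s := Finset.range C.m) (fun i => short (γ * C.m + i))
  have h4 : ((Finset.range C.m).filter fun i => C.thr < i).card = C.m - (C.thr + 1) := by
    rw [← Nat.card_Ico]
    congr 1
    ext i
    simp only [Finset.mem_filter, Finset.mem_range, Finset.mem_Ico]
    omega
  rw [hcard γ hγ, Finset.card_range] at h3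
  rw [h1, h2, h4]
  congr 2
  omega

/-- In each block the `thr + 1` short slots use direct edges to the sink. The other `m - (thr + 1)`
units enter the hub, which has exactly as many useful outlets. Only these numbers matter at the hub,
so no incoming slot has to be matched with an outgoing one. -/
theorem exists_flow (hC : C.Sized M) (hα : α < C.S) (hβ : β < C.T)
    (hshort : ∀ x, short x → C.SourceUnsat α x ∧ C.SinkUnsat β x)
    (hcard : ∀ γ < M, ((Finset.range C.m).filter fun i => short (γ * C.m + i)).card = C.thr + 1) :
    ∃ f, (flowInst hC).IsFlow (vertex hC α) (vertex hC (C.N + β)) f ∧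
      (flowInst hC).flowValue (vertex hC α) f = C.X := by
  have hS := hC.S_le; have hT := hC.T_le; have hX := hC.X_le; have hN := hC.N_pos
  set I := Finset.range C.X ×ˢ Finset.range (C.S + 2 * C.T + 3) with hI
  have hmem : ∀ i ∈ I, i.1 < C.X ∧ i.2 < C.S + 2 * C.T + 3 := fun i hi => by
    rw [hI, Finset.mem_product, Finset.mem_range, Finset.mem_range] at hi; exact hi
  have hv : ∀ v : ℕ, ∀ w : Fin (flowInst hC).n, v < 8 * C.N → (vertex hC v = w ↔ v = w.val) :=
    fun v w h => vertex_eq_iff hC h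
  have hin : ∀ v : Fin (flowInst hC).n,
      (∑ i ∈ I, if vertex hC (C.edgeTgt i.1 i.2) = v then C.used α β short i.1 i.2 else 0) =
        ∑ x ∈ Finset.range C.X, ((if C.startNode α x = v then (1 : ℝ) else 0) +
          (if short x then (if C.N + β = v then 1 else 0) else if 7 * C.N + x / C.m = v then 1 else 0) +
          if C.thr < x % C.m then (if 5 * C.N + x = v then 1 else 0) + (if C.N + β = v then 1 else 0) else 0) := by
    intro v
    rw [hI, Finset.sum_product]
    refine Finset.sum_congr rfl fun x hx => ?_
    rw [Finset.mem_range] at hx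
    have := sum_used (short := short) hα hβ x fun y => if C.edgeTgt x y = v then 1 else 0
    simp only [mul_ite, mul_one, mul_zero] at this
    simp only [hv _ _ (hC.edgeTgt_lt hx)]
    rw [this, (edge_start hα x).2, (edge_collect x).2, (edge_finish hβ x).2]
    congr 1
    · by_cases h : short x
      · simp only [h, if_true, (edge_short hβ (hshort x h).1 (hshort x h).2).2]
      · simp only [h, if_false]
    · by_cases h : C.thr < x % C.m
      · simp only [h, if_true, (edge_distribute h).2]
      · simp only [h, if_false]
  have hout : ∀ v : Fin (flowInst hC).n,
      (∑ i ∈ I, if vertex hC (C.edgeSrc i.1 i.2) = v then C.used α β short i.1 i.2 else 0) =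
        ∑ x ∈ Finset.range C.X, ((if α = v then (1 : ℝ) else 0) +
          (if C.startNode α x = v then 1 else 0) +
          if C.thr < x % C.m then (if 7 * C.N + x / C.m = v then 1 else 0) + (if 5 * C.N + x = v then 1 else 0) else 0) := by
    intro v
    rw [hI, Finset.sum_product]
    refine Finset.sum_congr rfl fun x hx => ?_
    rw [Finset.mem_range] at hx
    have := sum_used (short := short) hα hβ x fun y => if C.edgeSrc x y = v then 1 else 0
    simp only [mul_ite, mul_one, mul_zero] at this
    simp only [hv _ _ (hC.edgeSrc_lt hx)]
    rw [this, (edge_start hα x).1, (edge_collect x).1, (edge_finish hβ x).1]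
    congr 1
    · by_cases h : short x
      · simp only [h, if_true, (edge_short hβ (hshort x h).1 (hshort x h).2).1]
      · simp only [h, if_false]
    · by_cases h : C.thr < x % C.m
      · simp only [h, if_true, (edge_distribute h).1]
      · simp only [h, if_false]
  refine ⟨STInst.ofWeights I (fun i => vertex hC (C.edgeSrc i.1 i.2)) (fun i => vertex hC (C.edgeTgt i.1 i.2))
    (fun i => C.used α β short i.1 i.2), STInst.isFlow_ofWeights (fun i _ => used_nonneg _ _)
    (fun i _ => used_le_one hα hβ _ _) (fun i hi => ?_) (fun i hi j hj h1 h2 => ?_) (fun v hvs hvt => ?_), ?_⟩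
  · exact (mem_edges_flowInst hC).2 ⟨_, (hmem i hi).1, _, (hmem i hi).2, rfl⟩
  · obtain ⟨hi1, hi2⟩ := hmem i hi
    obtain ⟨hj1, hj2⟩ := hmem j hj
    rw [hv _ _ (hC.edgeSrc_lt hi1), vertex_val hC (hC.edgeSrc_lt hj1)] at h1
    rw [hv _ _ (hC.edgeTgt_lt hi1), vertex_val hC (hC.edgeTgt_lt hj1)] at h2
    exact Prod.ext_iff.2 (hC.edge_inj hi1 hj1 hi2 hj2 h1 h2)
  · have hvs' : ¬ α = v.val := fun h => hvs ((hv _ _ (by omega)).2 h).symm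
    have hvt' : ¬ C.N + β = v.val := fun h => hvt ((hv _ _ (by omega)).2 h).symm
    rw [hin, hout]
    simp only [hvs', hvt', if_false, add_zero, zero_add]
    -- At slot nodes inflow and outflow agree term by term; what remains is the balance at the hubs.
    have := sum_collect_eq hC hcard fun γ => if 7 * C.N + γ = v.val then 1 else 0
    simp only [ite_add_zero, Finset.sum_add_distrib]
    rw [this]
    ring
  · rw [STInst.flowValue_ofWeights, hin, hout, vertex_val hC (by omega)]
    have h1 : ∀ x, ¬ C.startNode α x = α := fun x => by unfold startNode; split_ifs <;> omega
    have h2 : ∀ x, ¬ 7 * C.N + x = α := fun x => by omega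
    have h3 : ∀ x, ¬ 5 * C.N + x = α := fun x => by omega
    have h4 : ¬ C.N + β = α := by omega
    simp [h1, h2, h3, h4]

/-- A cheap block yields the small cut. Without one, every block has enough doubly falsified clauses
for a flow of value `X`. -/
theorem maxFlow_lt_iff (hC : C.Sized M) (hα : α < C.S) (hβ : β < C.T) {z : ℕ}
    (hz : (flowInst hC).IsMaxFlowValue (vertex hC α) (vertex hC (C.N + β)) z) :
    z < C.X ↔ ∃ γ < M, C.deficit α β γ ≤ C.thr := by
  classical
  constructor
  · intro hlt
    by_contra! hcon
    -- A deficit above `thr` leaves room to select exactly `thr + 1` clauses that may use direct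
    -- edges.
    choose A hA hAc using fun γ : ℕ => fun h : γ < M => Finset.exists_subset_card_eq (Nat.succ_le_of_lt (hcon γ h))
    have hm : 0 < C.m := Nat.zero_lt_of_lt hC.thr_lt
    have hdiv : ∀ γ i, i < C.m → (γ * C.m + i) / C.m = γ ∧ (γ * C.m + i) % C.m = i := fun γ i hi => by
      rw [Nat.mul_add_mod_of_lt hi, mul_comm, Nat.mul_add_div hm, Nat.div_eq_of_lt hi, add_zero]
      exact ⟨rfl, rfl⟩
    obtain ⟨f, hf, hval⟩ := exists_flow (short := fun x => ∃ h : x / C.m < M, x % C.m ∈ A (x / C.m) h) hC hα hβ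
      (fun x ⟨h, hx⟩ => by
        have := (Finset.mem_filter.1 (hA _ h hx)).2
        rwa [Nat.div_add_mod'] at this) fun γ hγ => by
        rw [← Nat.succ_eq_add_one, ← hAc γ hγ]
        congr 1
        ext i
        rw [Finset.mem_filter, Finset.mem_range]
        constructor
        · rintro ⟨hi, h, hx⟩
          simp only [(hdiv γ i hi).1, (hdiv γ i hi).2] at hx
          exact hx
        · intro hi
          have hi' := Finset.mem_range.1 (Finset.mem_filter.1 (hA _ hγ hi)).1
          simp only [(hdiv γ i hi').1, (hdiv γ i hi').2]
          exact ⟨hi', hγ, hi⟩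
    have : (C.X : ℝ) ≤ z := hz.2 ⟨f, hf, hval.symm⟩
    exact absurd hlt (not_lt.2 (Nat.cast_le.1 this))
  · rintro ⟨γ, hγ, h⟩
    obtain ⟨f, hf, hval⟩ := hz.1
    have := flow_lt_of_deficit_le hC hα hβ hγ h hf
    rw [← hval] at this
    exact Nat.cast_lt.1 this

end Ctx
end FlowHardness

/-! ### The encoded instance, and reading off the answer table. -/

namespace FlowHardness

theorem getD_flatMap_pair {α : Type*} (l : List α) (f g : α → ℕ) (i : ℕ) :
    (l.flatMap fun e => [f e, g e]).getD i 0 =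
      if h : i / 2 < l.length then if i % 2 = 0 then f l[i / 2] else g l[i / 2] else 0 := by
  induction l generalizing i with
  | nil => simp
  | cons e l ih =>
    rw [List.flatMap_cons]
    match i with
    | 0 => simp
    | 1 => simp
    | i + 2 =>
      have h := ih i
      simp only [List.cons_append, List.nil_append, List.getD_cons_succ, h]
      have h1 : (i + 2) / 2 = i / 2 + 1 := by omega
      have h2 : (i + 2) % 2 = i % 2 := by omega
      simp only [h1, h2, List.length_cons, List.getElem_cons_succ, Nat.add_lt_add_iff_right]

namespace Ctx
variable {C : Ctx} {M : ℕ}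

theorem length_edges (hC : C.Sized M) : (flowInst hC).edges.length = C.numEdges := by
  simp [flowInst]

theorem length_sources (hC : C.Sized M) : (flowInst hC).sources.length = C.S := by
  simp [flowInst]

theorem length_sinks (hC : C.Sized M) : (flowInst hC).sinks.length = C.T := by
  simp [flowInst]

theorem get_sources (hC : C.Sized M) (i : Fin (flowInst hC).sources.length) :
    (flowInst hC).sources.get i = vertex hC i.val := by
  have hi : i.val < C.S := by rw [← length_sources hC]; exact i.isLt
  change ((List.range C.S).map (C.node hC.N_pos))[i.val]'(by simpa using hi) = _
  rw [List.getElem_map, List.getElem_range]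
  rfl

theorem get_sinks (hC : C.Sized M) (i : Fin (flowInst hC).sinks.length) :
    (flowInst hC).sinks.get i = vertex hC (C.N + i.val) := by
  have hi : i.val < C.T := by rw [← length_sinks hC]; exact i.isLt
  change ((List.range C.T).map fun j => C.node hC.N_pos (C.N + j))[i.val]'(by simpa using hi) = _
  rw [List.getElem_map, List.getElem_range]
  rfl

/-- This links the words computed on demand to the input that the assumed algorithm expects, so that
its guarantee applies to the simulated run. -/
theorem initState_flowInst (hC : C.Sized M) :
    initState (STMaxFlow.input (flowInst hC)) = ⟨fun _ => 0, C.word⟩ := by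
  have hS := hC.S_le; have hT := hC.T_le; have hN := hC.N_pos
  have h1 : (flowInst hC).sources.map (fun v => v.val) = List.range C.S := by
    refine List.ext_getElem (by simp [length_sources]) fun i h _ => ?_
    simp only [List.length_map, length_sources] at h
    have := congrArg Fin.val (get_sources hC ⟨i, by rw [length_sources]; exact h⟩)
    rw [vertex_val hC (show i < 8 * C.N by omega)] at this
    simpa using this
  have h2 : (flowInst hC).sinks.map (fun v => v.val) = (List.range C.T).map (C.N + ·) := by
    refine List.ext_getElem (by simp [length_sinks]) fun i h _ => ?_
    simp only [List.length_map, length_sinks] at h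
    have := congrArg Fin.val (get_sinks hC ⟨i, by rw [length_sinks]; exact h⟩)
    rw [vertex_val hC (show C.N + i < 8 * C.N by omega)] at this
    simpa using this
  unfold initState
  congr 1
  funext a
  change ([8 * C.N, _, _, _] ++ (flowInst hC).sources.map (fun v => v.val) ++
    (flowInst hC).sinks.map (fun v => v.val) ++
    (flowInst hC).edges.flatMap (fun e => [e.1.val, e.2.val])).getD a 0 = _
  rw [h1, h2, length_edges, length_sources, length_sinks, List.append_assoc, List.append_assoc]
  unfold word
  by_cases c1 : a < 4
  · rw [if_pos c1, List.getD_append _ _ _ _ (by simpa using c1)]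
    interval_cases a <;> rfl
  rw [if_neg c1, List.getD_append_right _ _ _ _ (by simp; omega)]
  simp only [List.length_cons, List.length_nil, Nat.zero_add, Nat.reduceAdd]
  generalize a - 4 = a
  by_cases c2 : a < C.S
  · rw [if_pos c2, List.getD_append _ _ _ _ (by simpa using c2)]
    simp [List.getD_eq_getElem?_getD, c2]
  rw [if_neg c2, List.getD_append_right _ _ _ _ (by simp; omega), List.length_range]
  generalize a - C.S = a
  by_cases c3 : a < C.T
  · rw [if_pos c3, List.getD_append _ _ _ _ (by simpa using c3)]
    simp [List.getD_eq_getElem?_getD, c3]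
  rw [if_neg c3, List.getD_append_right _ _ _ _ (by simp; omega), List.length_map, List.length_range]
  generalize a - C.T = a
  rw [getD_flatMap_pair]
  by_cases c4 : a < 2 * C.numEdges
  · have hlt : a / 2 < C.numEdges := by omega
    obtain ⟨i1, i2⟩ := index_lt hlt
    rw [if_pos c4, dif_pos (by rw [length_edges]; exact hlt)]
    have hget : ∀ h, (flowInst hC).edges[a / 2]'h =
        (vertex hC (C.edgeSrc (a / 2 % C.X) (a / 2 / C.X)), vertex hC (C.edgeTgt (a / 2 % C.X) (a / 2 / C.X))) := by
      intro h
      simp [flowInst, vertex]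
    simp only [hget, vertex_val hC (hC.edgeSrc_lt i1), vertex_val hC (hC.edgeTgt_lt i1)]
  · rw [if_neg c4, dif_neg (by rw [length_edges]; omega)]

/-- A correct run of the flow algorithm tells whether there is a source and a sink with a middle part
that leave few clauses unsatisfied. -/
theorem table_lt_iff (hC : C.Sized M) {o : State} (ho : STMaxFlow.Correct (flowInst hC) o) :
    (∃ i < C.S * C.T, o.mem (o.reg 0 + i) < C.X) ↔
      ∃ α < C.S, ∃ β < C.T, ∃ γ < M, C.deficit α β γ ≤ C.thr := by
  have hS := hC.S_le; have hT := hC.T_le; have hN := hC.N_pos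
  have key : ∀ α < C.S, ∀ β < C.T, o.mem (o.reg 0 + (α * C.T + β)) < C.X ↔
      ∃ γ < M, C.deficit α β γ ≤ C.thr := by
    intro α hα β hβ
    have := ho ⟨α, by rw [length_sources]; exact hα⟩ ⟨β, by rw [length_sinks]; exact hβ⟩
    simp only [get_sources, get_sinks, length_sinks] at this
    rw [← maxFlow_lt_iff hC hα hβ]
    have hz := this fun h => by
      rw [vertex_eq_iff hC (by omega), vertex_val hC (by omega)] at h
      omega
    rw [add_assoc] at hz
    exact hz
  constructor
  · rintro ⟨i, hi, h⟩
    have hT0 : 0 < C.T := Nat.pos_of_ne_zero fun h => by simp [h] at hi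
    have h1 : i / C.T < C.S := Nat.div_lt_of_lt_mul (by rwa [mul_comm])
    refine ⟨i / C.T, h1, i % C.T, Nat.mod_lt _ hT0, (key _ h1 _ (Nat.mod_lt _ hT0)).1 ?_⟩
    rwa [Nat.div_add_mod']
  · rintro ⟨α, hα, β, hβ, h⟩
    refine ⟨α * C.T + β, ?_, (key α hα β hβ).2 h⟩
    have : (α + 1) * C.T ≤ C.S * C.T := Nat.mul_le_mul_right _ hα
    rw [Nat.succ_mul] at this
    omega

end Ctx
end FlowHardness

namespace FlowHardness

/-! ### Assignments as numbers -/

theorem shiftRight_mod_two (w k : ℕ) : (w >>> k) % 2 = (w.testBit k).toNat := by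
  rw [Nat.shiftRight_eq_div_pow, Nat.toNat_testBit]

/-- All variables in the first `m` clauses are less than `n`. -/
def VarsLt (mem : ℕ → ℕ) (m n : ℕ) : Prop :=
  ∀ i < m, ∀ l < mem (clausePtr mem i), mem (clausePtr mem i + 1 + l) / 2 < n

theorem VarsLt.numUnsat_congr {mem : ℕ → ℕ} {m n w w' : ℕ} (h : VarsLt mem m n)
    (hw : ∀ k < n, w.testBit k = w'.testBit k) : numUnsat mem m w = numUnsat mem m w' := by
  unfold numUnsat
  congr 1
  refine Finset.filter_congr fun i hi => forall₂_congr fun l hl => ?_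
  rw [shiftRight_mod_two, shiftRight_mod_two, hw _ (h i (Finset.mem_range.1 hi) l hl)]

namespace Ctx
variable {C : Ctx} {a b j : ℕ}

theorem testBit_patch (hp : C.pow = 2 ^ j) (hf : C.fix < 2 ^ j) (w k : ℕ) :
    (C.patch w).testBit k = if k < j then C.fix.testBit k else w.testBit k := by
  rw [patch, hp, mul_comm, Nat.testBit_two_pow_mul_add _ hf]
  split_ifs with h
  · rfl
  · rw [Nat.testBit_div_two_pow, Nat.sub_add_cancel (not_lt.1 h)]

/-- A side inspects only its own variables, so bits belonging to the other side may be changed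
freely. A source can therefore be built with zero sink bits and a sink with zero source bits. -/
theorem unsat_congr {side w w' i : ℕ}
    (h : ∀ k, C.sinkVar k = side → w.testBit k = w'.testBit k) :
    C.Unsat side w i ↔ C.Unsat side w' i := by
  refine forall₂_congr fun l hl => not_congr (and_congr_right fun hs => ?_)
  rw [shiftRight_mod_two, shiftRight_mod_two, h _ hs]

theorem sinkVar_eq_one {k : ℕ} : C.sinkVar k = 1 ↔ C.a ≤ k ∧ k < C.a + C.b := by
  unfold sinkVar
  split_ifs with h <;> simp [h]

theorem sinkVar_eq_zero {k : ℕ} : C.sinkVar k = 0 ↔ ¬ (C.a ≤ k ∧ k < C.a + C.b) := by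
  unfold sinkVar
  split_ifs with h <;> simp [h]

/-- The assignment composed of its three parts. -/
def combine (C : Ctx) (α β γ : ℕ) : ℕ := 2 ^ C.a * (2 ^ C.b * γ + β) + α

theorem testBit_combine {α β : ℕ} (hα : α < 2 ^ C.a) (hβ : β < 2 ^ C.b) (γ k : ℕ) :
    (C.combine α β γ).testBit k = if k < C.a then α.testBit k else
      if k - C.a < C.b then β.testBit (k - C.a) else γ.testBit (k - C.a - C.b) := by
  rw [combine, Nat.testBit_two_pow_mul_add _ hα, Nat.testBit_two_pow_mul_add _ hβ]

/-- The numbers `α + γ * (S * T)` and `β * S` agree with the combined assignment on the variables of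
their own side, and patching overwrites the same bits in all of them. -/
theorem deficit_eq (hS : C.S = 2 ^ C.a) (hT : C.T = 2 ^ C.b) (hp : C.pow = 2 ^ j) (hf : C.fix < 2 ^ j)
    {α β : ℕ} (hα : α < C.S) (hβ : β < C.T) (γ : ℕ) :
    C.deficit α β γ = numUnsat C.mem C.m (C.patch (C.combine α β γ)) := by
  unfold deficit numUnsat
  congr 1
  refine Finset.filter_congr fun i hi => ?_
  rw [Finset.mem_range] at hi
  rw [hS] at hα
  rw [hT] at hβ
  have hdiv : (γ * C.m + i) / C.m = γ ∧ (γ * C.m + i) % C.m = i := by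
    rw [Nat.mul_add_mod_of_lt hi, mul_comm, Nat.mul_add_div (by omega), Nat.div_eq_of_lt hi, add_zero]
    exact ⟨rfl, rfl⟩
  rw [← Ctx.unsat_and_unsat, SourceUnsat, SinkUnsat, hdiv.1, hdiv.2]
  refine and_congr (unsat_congr fun k hk => ?_) (unsat_congr fun k hk => ?_)
  · rw [sinkVar_eq_zero] at hk
    rw [testBit_patch hp hf, testBit_patch hp hf, testBit_combine hα hβ,
      show α + γ * (C.S * C.T) = 2 ^ C.a * (2 ^ C.b * γ + 0) + α by rw [hS, hT]; ring,
      Nat.testBit_two_pow_mul_add _ hα, Nat.testBit_two_pow_mul_add _ (Nat.two_pow_pos _)]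
    split_ifs <;> first | rfl | omega
  · rw [sinkVar_eq_one] at hk
    rw [testBit_patch hp hf, testBit_patch hp hf, testBit_combine hα hβ,
      show β * C.S = 2 ^ C.a * (2 ^ C.b * 0 + β) + 0 by rw [hS]; ring,
      Nat.testBit_two_pow_mul_add _ (Nat.two_pow_pos _), Nat.testBit_two_pow_mul_add _ hβ]
    split_ifs <;> first | rfl | omega

/-- The triples `(α, β, γ)` cover all settings of the relevant bits. Patching restricts the question
to assignments that extend the fixed part. -/
theorem exists_deficit_iff (hS : C.S = 2 ^ C.a) (hT : C.T = 2 ^ C.b) (hp : C.pow = 2 ^ j)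
    (hf : C.fix < 2 ^ j) (hv : VarsLt C.mem C.m C.n) :
    (∃ α < C.S, ∃ β < C.T, ∃ γ < 2 ^ (C.n - (C.a + C.b)), C.deficit α β γ ≤ C.thr) ↔
      ∃ u, u % C.pow = C.fix ∧ numUnsat C.mem C.m u ≤ C.thr := by
  constructor
  · rintro ⟨α, hα, β, hβ, γ, -, h⟩
    rw [deficit_eq hS hT hp hf hα hβ] at h
    refine ⟨_, ?_, h⟩
    rw [patch, Nat.mul_add_mod', hp, Nat.mod_eq_of_lt hf]
  · rintro ⟨u, hu, h⟩
    -- `u` is cut into its lowest `a` bits, the next `b` bits and a rest. The rest is reduced to `n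
    -- - (a + b)` bits, because no clause mentions a variable beyond `n`.
    have hα : u % 2 ^ C.a < C.S := hS.symm ▸ Nat.mod_lt _ (Nat.two_pow_pos _)
    have hβ : u / 2 ^ C.a % 2 ^ C.b < C.T := hT.symm ▸ Nat.mod_lt _ (Nat.two_pow_pos _)
    refine ⟨_, hα, _, hβ, u / 2 ^ C.a / 2 ^ C.b % 2 ^ (C.n - (C.a + C.b)), Nat.mod_lt _ (Nat.two_pow_pos _), ?_⟩
    rw [deficit_eq hS hT hp hf hα hβ, hv.numUnsat_congr (w' := u) fun k hk => ?_]
    · exact h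
    · rw [testBit_patch hp hf, testBit_combine (hS ▸ hα) (hT ▸ hβ)]
      simp only [Nat.testBit_mod_two_pow, Nat.testBit_div_two_pow]
      rw [hp] at hu
      rw [← hu, Nat.testBit_mod_two_pow]
      split_ifs with h1 h2 h3
      · simp [h1]
      · simp [h2]
      · simp [h3, show k - C.a + C.a = k by omega]
      · rw [show k - C.a - C.b + C.b + C.a = k by omega]
        simp [show k - C.a - C.b < C.n - (C.a + C.b) by omega]

/-- A correct run of the flow algorithm answers the question. -/
theorem Answered.of_exec {p : Prog} (hC : C.Sized (2 ^ (C.n - (C.a + C.b))))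
    (hS : C.S = 2 ^ C.a) (hT : C.T = 2 ^ C.b) (hp : C.pow = 2 ^ j)
    (hf : C.fix < 2 ^ j) (hv : VarsLt C.mem C.m C.n) {B k : ℕ} {o : State}
    (he : Exec B p (initState (STMaxFlow.input (flowInst hC))) o k)
    (ho : STMaxFlow.Correct (flowInst hC) o) (hB : B ≤ C.cap) (hk : k < C.budget) :
    C.Answered p :=
  ⟨o, k, B, initState_flowInst hC ▸ he, hB, hk, by
    rw [table_lt_iff hC ho, exists_deficit_iff hS hT hp hf hv]⟩

end Ctx
end FlowHardness

namespace FlowHardness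

/-! ### Formulas in memory -/

theorem countP_eq_card_filter {α : Type*} (p : α → Bool) (l : List α) (P : ℕ → Prop) [DecidablePred P]
    (h : ∀ i (hi : i < l.length), P i ↔ p l[i] = true) :
    l.countP p = ((Finset.range l.length).filter P).card := by
  induction l using List.reverseRecOn with
  | nil => simp
  | append_singleton l x ih =>
    have hx := h l.length (by simp)
    simp only [List.getElem_append_right le_rfl, Nat.sub_self, List.getElem_cons_zero] at hx
    rw [List.countP_append, ih fun i hi => by
      rw [h i (by simp; omega), List.getElem_append_left hi], List.length_append, List.length_singleton,
      Finset.range_add_one, Finset.filter_insert]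
    by_cases hp : p x = true
    · rw [if_pos (hx.2 hp), Finset.card_insert_of_notMem (by simp), List.countP_singleton, if_pos hp]
    · rw [if_neg (fun h => hp (hx.1 h)), List.countP_singleton, if_neg hp, add_zero]

section
variable (n m : ℕ) (L : List (List ℕ))

/-- A list of clauses in memory. -/
def clauseWords : List ℕ := [n, m] ++ L.flatMap fun c => c.length :: c

theorem getD_clauseWords {i : ℕ} (hi : i < L.length) (x : ℕ) :
    (clauseWords n m L).getD (2 + ((L.take i).flatMap fun c => c.length :: c).length + x) 0 =
      ((L[i].length :: L[i]) ++ (L.drop (i + 1)).flatMap fun c => c.length :: c).getD x 0 := by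
  have h : clauseWords n m L = ([n, m] ++ (L.take i).flatMap fun c => c.length :: c) ++
      (L.drop i).flatMap fun c => c.length :: c := by
    rw [clauseWords, List.append_assoc, ← List.flatMap_append, List.take_append_drop]
  rw [h, List.getD_append_right _ _ _ _ (by simp; omega), List.drop_eq_getElem_cons hi, List.flatMap_cons]
  congr 1
  simp only [List.length_append, List.length_cons, List.length_nil]
  omega

theorem clausePtr_clauseWords {i : ℕ} (hi : i ≤ L.length) :
    clausePtr (fun a => (clauseWords n m L).getD a 0) i =
      2 + ((L.take i).flatMap fun c => c.length :: c).length := by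
  induction i with
  | zero => simp [clausePtr]
  | succ i ih =>
    have hi' : i < L.length := hi
    have h0 := getD_clauseWords n m L hi' 0
    rw [clausePtr, ih (by omega)]
    simp only [add_zero] at h0
    rw [h0, List.take_succ_eq_append_getElem hi', List.flatMap_append, List.length_append, List.flatMap_singleton]
    simp only [List.cons_append, List.getD_cons_zero, List.length_cons]
    omega

theorem mem_clausePtr_clauseWords {i : ℕ} (hi : i < L.length) :
    (clauseWords n m L).getD (clausePtr (fun a => (clauseWords n m L).getD a 0) i) 0 = L[i].length := by
  rw [clausePtr_clauseWords _ _ _ hi.le]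
  exact getD_clauseWords n m L hi 0

theorem mem_clausePtr_add_clauseWords {i l : ℕ} (hi : i < L.length) (hl : l < L[i].length) :
    (clauseWords n m L).getD (clausePtr (fun a => (clauseWords n m L).getD a 0) i + 1 + l) 0 = L[i][l] := by
  rw [clausePtr_clauseWords _ _ _ hi.le, add_assoc _ 1 l, getD_clauseWords n m L hi, add_comm 1 l,
    List.cons_append, List.getD_cons_succ, List.getD_append _ _ _ _ hl, List.getD_eq_getElem _ _ hl]

end

namespace CNF
variable (F : CNF)

/-- The codes of the literals. -/
def codes : List (List ℕ) := F.clauses.map fun c => c.map fun l => 2 * l.1.val + l.2.toNat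

/-- The memory at the start. -/
def mem (a : ℕ) : ℕ := F.encode.getD a 0

theorem encode_eq : F.encode = clauseWords F.numVars F.clauses.length F.codes := by
  simp [encode, clauseWords, codes, List.flatMap_map]

theorem mem_eq : F.mem = fun a => (clauseWords F.numVars F.clauses.length F.codes).getD a 0 := by
  funext a; rw [mem, encode_eq]

theorem clausePtr_length : clausePtr F.mem F.clauses.length = F.encode.length := by
  rw [mem_eq, clausePtr_clauseWords _ _ _ (by simp [codes]), encode_eq, clauseWords,
    List.take_of_length_le (by simp [codes])]
  simp
  omega

variable {F}

theorem mem_clausePtr {i : ℕ} (hi : i < F.clauses.length) :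
    F.mem (clausePtr F.mem i) = F.clauses[i].length := by
  have := mem_clausePtr_clauseWords F.numVars F.clauses.length F.codes (i := i) (by simpa [codes] using hi)
  rw [← mem_eq, ← encode_eq] at this
  refine this.trans ?_
  simp [codes]

theorem mem_clausePtr_add {i l : ℕ} (hi : i < F.clauses.length) (hl : l < F.clauses[i].length) :
    F.mem (clausePtr F.mem i + 1 + l) = 2 * F.clauses[i][l].1.val + F.clauses[i][l].2.toNat := by
  have := mem_clausePtr_add_clauseWords F.numVars F.clauses.length F.codes (i := i) (l := l)
    (by simpa [codes] using hi) (by simpa [codes] using hl)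
  rw [← mem_eq, ← encode_eq] at this
  refine this.trans ?_
  simp [codes]

theorem varsLt : VarsLt F.mem F.clauses.length F.numVars := fun i hi l hl => by
  rw [mem_clausePtr hi] at hl
  rw [mem_clausePtr_add hi hl]
  have := F.clauses[i][l].1.isLt
  have := Bool.toNat_lt F.clauses[i][l].2
  omega

theorem clauseUnsat_iff {w i : ℕ} (hi : i < F.clauses.length) {a : Fin F.numVars → Bool}
    (ha : ∀ v, a v = w.testBit v) : ClauseUnsat F.mem w i ↔ ¬ satisfies a F.clauses[i] = true := by
  unfold ClauseUnsat satisfies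
  rw [mem_clausePtr hi, List.any_eq_true]
  push Not
  have key : ∀ l (hl : l < F.clauses[i].length),
      ((w >>> (F.mem (clausePtr F.mem i + 1 + l) / 2)) % 2 ≠ F.mem (clausePtr F.mem i + 1 + l) % 2) ↔
        (a F.clauses[i][l].1 == F.clauses[i][l].2) ≠ true := fun l hl => by
    rw [mem_clausePtr_add hi hl, shiftRight_mod_two]
    have hb := Bool.toNat_lt F.clauses[i][l].2
    rw [show (2 * F.clauses[i][l].1.val + F.clauses[i][l].2.toNat) / 2 = F.clauses[i][l].1.val by omega,
      show (2 * F.clauses[i][l].1.val + F.clauses[i][l].2.toNat) % 2 = F.clauses[i][l].2.toNat by omega,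
      ← ha]
    cases a F.clauses[i][l].1 <;> cases F.clauses[i][l].2 <;> simp
  constructor
  · intro h x hx
    obtain ⟨l, hl, rfl⟩ := List.getElem_of_mem hx
    exact (key l hl).1 (h l hl)
  · exact fun h l hl => (key l hl).2 (h _ (List.getElem_mem hl))

theorem numSat_eq {w : ℕ} {a : Fin F.numVars → Bool} (ha : ∀ v, a v = w.testBit v) :
    F.numSat a = F.clauses.length - numUnsat F.mem F.clauses.length w := by
  have h := Finset.card_filter_add_card_filter_not (s := Finset.range F.clauses.length) (ClauseUnsat F.mem w)
  rw [Finset.card_range] at h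
  rw [numSat, countP_eq_card_filter _ _ (fun i => ¬ ClauseUnsat F.mem w i) fun i hi => by
    rw [clauseUnsat_iff hi ha, not_not], numUnsat]
  omega

theorem exists_testBit {n : ℕ} (a : Fin n → Bool) : ∃ w : ℕ, ∀ v, a v = w.testBit v :=
  ⟨Nat.ofBits a, fun v => (Nat.testBit_ofBits_lt a v v.isLt).symm⟩

theorem exists_isGreatest (F : CNF) : ∃ opt, IsGreatest (Set.range F.numSat) opt := by
  obtain ⟨a, ha⟩ := Finite.exists_max F.numSat
  exact ⟨_, ⟨a, rfl⟩, by rintro _ ⟨b, rfl⟩; exact ha b⟩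

theorem isOpt {opt : ℕ} (h : IsGreatest (Set.range F.numSat) opt) (K q : ℕ) :
    (Ctx.ofMem F.mem K q).IsOpt opt where
  le w := by
    refine le_of_eq_of_le ?_ (h.2 ⟨fun v => w.testBit v, rfl⟩)
    exact (numSat_eq fun _ => rfl).symm
  exists_eq := by
    obtain ⟨a, ha⟩ := h.1
    obtain ⟨w, hw⟩ := exists_testBit a
    exact ⟨w, ha ▸ (numSat_eq hw).symm⟩
  mod w := varsLt.numUnsat_congr fun k hk => by
    rw [Nat.testBit_mod_two_pow, decide_eq_true (show k < (Ctx.ofMem F.mem K q).n from hk), Bool.true_and]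

/-- A clause without repeated literals has at most `2 n` of them. This bounds the length of the
encoding in terms of `n` and `m`, the only quantities in the time bounds. -/
theorem clause_length_le (F : CNF) {c} (hc : c ∈ F.clauses) : c.length ≤ 2 * F.numVars := by
  refine (F.clauses_nodup c hc).length_le_card.trans_eq ?_
  simp [mul_comm]

theorem length_encode_le (F : CNF) : F.encode.length ≤ 2 + F.clauses.length * (2 * F.numVars + 1) := by
  rw [encode, List.length_append, List.length_flatMap]
  refine Nat.add_le_add_left ?_ 2
  refine (List.sum_le_card_nsmul _ (2 * F.numVars + 1) ?_).trans_eq (by simp)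
  intro x hx
  obtain ⟨c, hc, rfl⟩ := List.mem_map.1 hx
  simpa using F.clause_length_le hc

theorem mem_le (F : CNF) (x : ℕ) : F.mem x ≤ 2 * F.numVars + F.clauses.length := by
  rw [mem, List.getD_eq_getElem?_getD]
  rcases h : F.encode[x]? with _ | y
  · simp
  · have hy := List.mem_of_getElem? h
    simp only [encode, List.mem_append, List.mem_cons, List.not_mem_nil, or_false, List.mem_flatMap,
      List.mem_map] at hy
    simp only [Option.getD_some]
    rcases hy with (rfl | rfl) | ⟨c, hc, rfl | ⟨l, -, rfl⟩⟩
    · omega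
    · omega
    · have := F.clause_length_le hc
      omega
    · have := l.1.isLt
      have := Bool.toNat_lt l.2
      omega

theorem mem_eq_zero (F : CNF) {x : ℕ} (hx : F.encode.length ≤ x) : F.mem x = 0 := by
  rw [mem, List.getD_eq_getElem?_getD, List.getElem?_eq_none hx]
  rfl

end CNF
end FlowHardness

namespace FlowHardness

/-! ### The right guess -/

/-- The function `l + ⌊c₁ l⌋ + ⌊c₂ l⌋` grows by at most three when `l` grows by one, so the first
`l` that reaches `D` overshoots by at most two. -/
theorem exists_split {c₁ c₂ : ℝ} (h₁ : c₁ ∈ Set.Icc (0 : ℝ) 1) (h₂ : c₂ ∈ Set.Icc (0 : ℝ) 1) (D : ℕ) :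
    ∃ l a b : ℕ, a = ⌊c₁ * l⌋₊ ∧ b = ⌊c₂ * l⌋₊ ∧ D ≤ l + a + b ∧ l + a + b ≤ D + 2 := by
  let f : ℕ → ℕ := fun l => l + ⌊c₁ * l⌋₊ + ⌊c₂ * l⌋₊
  have hstep : ∀ c ∈ Set.Icc (0 : ℝ) 1, ∀ l : ℕ, ⌊c * (l + 1 : ℕ)⌋₊ ≤ ⌊c * l⌋₊ + 1 := by
    intro c hc l
    have h0 : 0 ≤ c * l := mul_nonneg hc.1 (Nat.cast_nonneg _)
    rw [← Nat.floor_add_one h0]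
    refine Nat.floor_mono ?_
    push_cast
    have := hc.2
    linarith
  have hex : ∃ l, D ≤ f l := ⟨D, by simp only [f]; omega⟩
  classical
  refine ⟨Nat.find hex, _, _, rfl, rfl, Nat.find_spec hex, ?_⟩
  rcases h : Nat.find hex with _ | l
  · simp
  · have hlt : ¬ D ≤ f l := Nat.find_min hex (by omega)
    have := hstep c₁ h₁ l
    have := hstep c₂ h₂ l
    simp only [f] at hlt
    omega

/-- The exponents satisfy `0 ≤ c (L + 3) - ⌊c l⌋ ≤ 5 c + 1 ≤ 6`, so the sizes agree up to `64 = 2 ^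
6` and no logarithmic factor is needed. -/
theorem withinPolylog_floor {c : ℝ} (hc : c ∈ Set.Icc (0 : ℝ) 1) {l L : ℕ} (h1 : l ≤ L) (h2 : L ≤ l + 2) :
    WithinPolylog 64 0 (((8 * 2 ^ L : ℕ) : ℝ) ^ c) ((2 ^ ⌊c * l⌋₊ : ℕ) : ℝ) := by
  have e1 : (((8 * 2 ^ L : ℕ) : ℝ) ^ c) = (2 : ℝ) ^ (c * (L + 3 : ℝ)) := by
    rw [mul_comm c, Real.rpow_mul (by norm_num)]
    congr 1
    rw [Real.rpow_add (by norm_num), Real.rpow_natCast]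
    push_cast
    norm_num
    ring
  have e2 : ((2 ^ ⌊c * l⌋₊ : ℕ) : ℝ) = (2 : ℝ) ^ (⌊c * l⌋₊ : ℝ) := by
    rw [Real.rpow_natCast]; push_cast; rfl
  have h0 : 0 ≤ c * l := mul_nonneg hc.1 (Nat.cast_nonneg _)
  have hf1 := Nat.floor_le h0
  have hf2 := Nat.lt_floor_add_one (c * l)
  have h1' : (l : ℝ) ≤ L := Nat.cast_le.2 h1
  have h2' : (L : ℝ) ≤ l + 2 := by exact_mod_cast h2
  have e3 : ((64 : ℕ) : ℝ) = (2 : ℝ) ^ (6 : ℝ) := by norm_num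
  unfold WithinPolylog
  rw [e1, e2, pow_zero, mul_one, e3, ← Real.rpow_add (by norm_num), ← Real.rpow_add (by norm_num)]
  have hc1 := hc.2
  have hc0 := hc.1
  constructor
  · refine Real.rpow_le_rpow_of_exponent_le (by norm_num) ?_
    nlinarith
  · refine Real.rpow_le_rpow_of_exponent_le (by norm_num) ?_
    nlinarith

/-- What the algorithm for flows is assumed to do. -/
def FlowBound (p : Prog) (K : ℕ) (ε c₁ c₂ : ℝ) : Prop :=
  ∀ G : STInst, (1 ≤ G.n ∧
      WithinPolylog 64 0 ((G.n : ℝ) ^ c₁) (G.sources.length : ℝ) ∧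
      WithinPolylog 64 0 ((G.n : ℝ) ^ c₂) (G.sinks.length : ℝ) ∧
      G.edges.length ≤ 64 * ((G.sources.length + G.sinks.length) * G.n)) →
    ∃ (B k : ℕ) (t : State), (B : ℝ) ≤ K * (((G.n + G.edges.length : ℕ) : ℝ) +
        ((G.sources.length : ℝ) * (G.sinks.length : ℝ) * (G.n : ℝ)) ^ (1 - ε)) ^ K ∧
      (k : ℝ) ≤ K * ((G.sources.length : ℝ) * (G.sinks.length : ℝ) * (G.n : ℝ)) ^ (1 - ε) ∧
      Exec B p (initState (STMaxFlow.input G)) t k ∧ STMaxFlow.Correct G t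

/-- Replacing `ε` by `1 / q` and rounding the saving down to `W / q` makes the time limit a power of
two that the program can compute. -/
theorem rpow_time_le {ε : ℝ} {q : ℕ} (hq : 0 < q) (hε : 1 / (q : ℝ) ≤ ε) (W : ℕ) :
    ((2 ^ W : ℕ) : ℝ) ^ (1 - ε) ≤ ((2 ^ (W - W / q) : ℕ) : ℝ) := by
  have hq' : (0 : ℝ) < q := Nat.cast_pos.2 hq
  have e1 : ((2 ^ (W - W / q) : ℕ) : ℝ) = (2 : ℝ) ^ ((W - W / q : ℕ) : ℝ) := by
    rw [Real.rpow_natCast]; push_cast; rfl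
  have e2 : ((2 ^ W : ℕ) : ℝ) = (2 : ℝ) ^ (W : ℝ) := by
    rw [Real.rpow_natCast]; push_cast; rfl
  rw [e1, e2, ← Real.rpow_mul (by norm_num)]
  refine Real.rpow_le_rpow_of_exponent_le (by norm_num) ?_
  rw [Nat.cast_sub (Nat.div_le_self _ _)]
  have h1 : ((W / q : ℕ) : ℝ) ≤ W / q := Nat.cast_div_le
  have h2 : (W : ℝ) / q ≤ W * ε := by
    rw [div_eq_mul_one_div]
    exact mul_le_mul_of_nonneg_left hε (Nat.cast_nonneg _)
  nlinarith

theorem flow_size_le {x E S T w y : ℕ} (hS : S ≤ x) (hT : T ≤ x) (hE : E ≤ 6 * (x * (S + T)))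
    (hw : 8 * x ≤ w) (hy : y ≤ w) (h2 : 2 ≤ w) : 8 * x + E + y ≤ w * w * 2 := by
  have h3 : x * (S + T) ≤ x * (2 * x) := Nat.mul_le_mul_left _ (by omega)
  have h4 : (8 * x) * (8 * x) ≤ w * w := Nat.mul_le_mul hw hw
  have h5 : 2 * w ≤ w * w := Nat.mul_le_mul_right _ h2
  have e3 : x * (2 * x) = 2 * (x * x) := by ring
  have e4 : (8 * x) * (8 * x) = 64 * (x * x) := by ring
  omega

/-- The pair is `(⌊c₁ l⌋, ⌊c₂ l⌋)` with `l` from `exists_split`. Its instances meet the assumed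
restrictions with the constants `64` and `0` for every threshold and every fixed part. -/
theorem exists_valid_allAnswered {p : Prog} {K q : ℕ} {ε c₁ c₂ : ℝ} (hp : FlowBound p K ε c₁ c₂)
    (hq : 0 < q) (hε : 1 / (q : ℝ) ≤ ε) (h₁ : c₁ ∈ Set.Icc (0 : ℝ) 1) (h₂ : c₂ ∈ Set.Icc (0 : ℝ) 1)
    {mem : ℕ → ℕ} (hv : VarsLt mem (mem 1) (mem 0)) :
    ∃ a b, a ≤ (Ctx.ofMem mem (K + 1) q).H ∧ b ≤ (Ctx.ofMem mem (K + 1) q).H ∧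
      (Ctx.ofMem mem (K + 1) q).Valid a b ∧ ((Ctx.ofMem mem (K + 1) q).split a b).AllAnswered p := by
  set C := Ctx.ofMem mem (K + 1) q with hCdef
  set μ := Nat.clog 2 (mem 1) with hμ
  have hH : C.H = mem 0 + 3 * μ + 2 := rfl
  have hn : C.n = mem 0 := rfl
  obtain ⟨l, a, b, ha, hb, hD1, hD2⟩ := exists_split h₁ h₂ (mem 0 + 3 * μ)
  have hfl : ∀ c ∈ Set.Icc (0 : ℝ) 1, ⌊c * l⌋₊ ≤ l := fun c hc => by
    refine Nat.floor_le_of_le ?_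
    exact mul_le_of_le_one_left (Nat.cast_nonneg _) hc.2
  have hal : a ≤ l := ha ▸ hfl _ h₁
  have hbl : b ≤ l := hb ▸ hfl _ h₂
  have hval : C.Valid a b := ⟨by omega, by omega, by omega⟩
  refine ⟨a, b, by omega, by omega, hval, ?_⟩
  intro thr hthr j hj fix hfix
  obtain ⟨L, hL⟩ : ∃ L, L = C.H - (a + b) := ⟨_, rfl⟩
  set C' := (C.split a b).upd thr (2 ^ j) fix 0 with hC'
  have eS : C'.S = 2 ^ a := rfl
  have eT : C'.T = 2 ^ b := rfl
  have eN : C'.N = 2 ^ L := by rw [hL]; rfl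
  have eX : C'.X = 2 ^ (mem 0 - (a + b)) * mem 1 := rfl
  have hm : mem 1 ≤ 2 ^ μ := Nat.le_pow_clog (by norm_num) _
  -- If `a + b` exceeds the number of variables, one needs `μ ≤ L`. This is why `H` contains `3 μ`:
  -- from `a, b ≤ l` and `l + a + b ≥ 3 μ` it follows that `μ ≤ l ≤ L`.
  have hXN : C'.X ≤ C'.N := by
    rw [eX, eN]
    refine (Nat.mul_le_mul_left _ hm).trans ?_
    rw [← pow_add]
    exact Nat.pow_le_pow_right (by norm_num) (by omega)
  have hsz : C'.Sized (2 ^ (C'.n - (C'.a + C'.b))) := by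
    refine ⟨?_, ?_, ?_, hXN, rfl, hthr⟩
    · rw [eN]; exact Nat.two_pow_pos _
    · rw [eS, eN]; exact Nat.pow_le_pow_right (by norm_num) (by omega)
    · rw [eT, eN]; exact Nat.pow_le_pow_right (by norm_num) (by omega)
  have lS := Ctx.length_sources hsz
  have lT := Ctx.length_sinks hsz
  have lE := Ctx.length_edges hsz
  have ln : (Ctx.flowInst hsz).n = 8 * 2 ^ L := by rw [← eN]; rfl
  have hSpos : 1 ≤ C'.S := by rw [eS]; exact Nat.one_le_two_pow
  have hTpos : 1 ≤ C'.T := by rw [eT]; exact Nat.one_le_two_pow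
  have hLl : l ≤ L ∧ L ≤ l + 2 := by omega
  -- The product of the sizes does not depend on the split, which is what makes the bound uniform in
  -- `c₁` and `c₂`.
  have hlarge : (Ctx.flowInst hsz).sources.length * (Ctx.flowInst hsz).sinks.length * (Ctx.flowInst hsz).n =
      2 ^ (C.H + 3) := by
    rw [lS, lT, ln, eS, eT, show C.H + 3 = a + b + (3 + L) by omega, pow_add, pow_add, pow_add]
    norm_num
  have hnum : C'.numEdges ≤ 6 * (C'.N * (C'.S + C'.T)) := by
    have : C'.numEdges ≤ C'.N * (6 * (C'.S + C'.T)) := Nat.mul_le_mul hXN (by omega)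
    linarith
  obtain ⟨B, k, o, hB, hk, he, ho⟩ := hp (Ctx.flowInst hsz) (by
    rw [lS, lT, lE, ln]
    refine ⟨?_, ?_, ?_, ?_⟩
    · have := Nat.two_pow_pos L; omega
    · rw [eS, ha]; exact withinPolylog_floor h₁ hLl.1 hLl.2
    · rw [eT, hb]; exact withinPolylog_floor h₂ hLl.1 hLl.2
    · rw [eN] at hnum
      linarith)
  rw [← Nat.cast_mul, ← Nat.cast_mul, hlarge] at hB hk
  have htime := rpow_time_le hq hε (C.H + 3)
  set W := C.H + 3 with hW
  have hkW : k ≤ K * 2 ^ (W - W / q) := by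
    have : (k : ℝ) ≤ ((K * 2 ^ (W - W / q) : ℕ) : ℝ) := by
      rw [Nat.cast_mul]
      exact hk.trans (mul_le_mul_of_nonneg_left htime (Nat.cast_nonneg _))
    exact Nat.cast_le.1 this
  have hsize : (Ctx.flowInst hsz).n + (Ctx.flowInst hsz).edges.length + 2 ^ (W - W / q) ≤ 2 ^ (2 * W + 1) := by
    have h2L : 2 ^ L ≤ 2 ^ C.H := Nat.pow_le_pow_right (by norm_num) (by omega)
    have h1 : 8 * 2 ^ L ≤ 2 ^ W := by rw [hW, pow_add]; omega
    have hS := hsz.S_le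
    have hT := hsz.T_le
    rw [eN] at hS hT hnum
    rw [lE, ln, pow_succ, two_mul W, pow_add]
    exact flow_size_le hS hT hnum h1 (Nat.pow_le_pow_right (by norm_num) (Nat.sub_le _ _))
      (Nat.le_self_pow (by omega) 2)
  -- With `K ≤ 2 ^ K` the assumed word bound is at most `2 ^ (K (2 W + 2))`, and `2 W + 2 = 2 H +
  -- 8`; this is the origin of the exponent in `cap`.
  have hBcap : B ≤ C.cap := by
    have h1 : (B : ℝ) ≤ ((K * (2 ^ (2 * W + 1)) ^ K : ℕ) : ℝ) := by
      have h3 := Nat.cast_le (α := ℝ).2 hsize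
      rw [Nat.cast_add] at h3
      refine hB.trans ?_
      rw [Nat.cast_mul, Nat.cast_pow (2 ^ (2 * W + 1)) K]
      refine mul_le_mul_of_nonneg_left (pow_le_pow_left₀ ?_ ?_ K) (Nat.cast_nonneg K)
      · exact add_nonneg (Nat.cast_nonneg _) (Real.rpow_nonneg (Nat.cast_nonneg _) _)
      · exact (add_le_add le_rfl htime).trans h3
    refine (Nat.cast_le.1 h1).trans ?_
    have h2 : K ≤ 2 ^ K := Nat.lt_two_pow_self.le
    refine (Nat.mul_le_mul_right _ h2).trans ?_
    rw [← pow_mul, ← pow_add]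
    refine Nat.pow_le_pow_right (by norm_num) ?_
    change _ ≤ (K + 1) * (2 * C.H + 8)
    have e : K + (2 * W + 1) * K = K * (2 * C.H + 8) := by rw [hW]; ring
    rw [e]
    exact Nat.mul_le_mul_right _ (by omega)
  refine Ctx.Answered.of_exec (j := j) hsz rfl rfl rfl hfix hv he ho hBcap ?_
  change k < (K + 1) * 2 ^ (W - W / q) + 1
  have : K * 2 ^ (W - W / q) ≤ (K + 1) * 2 ^ (W - W / q) := Nat.mul_le_mul_right _ (by omega)
  omega

end FlowHardness

namespace FlowHardness

/-! ### Bounds for the running time and for the words -/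

section
variable {p : Prog} {R : ℕ} {C : Ctx}

/-- This turns the cost of a loop around a body of cost at most `c * E` into a constant times a
product, so nested loops can be estimated one layer at a time. -/
theorem mul_add_add_le {k N x r s c E : ℕ} (hk : k ≤ N) (hN : 1 ≤ N) (hE : 1 ≤ E) (hx : x ≤ c * E) :
    k * (x + r) + s ≤ (c + r + s) * (N * E) := by
  have h1 : k * (x + r) ≤ N * (c * E + r * E) :=
    Nat.mul_le_mul hk (Nat.add_le_add hx (Nat.le_mul_of_pos_right r hE))
  have h2 : s ≤ s * (N * E) := Nat.le_mul_of_pos_right s (Nat.mul_pos hN hE)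
  calc k * (x + r) + s ≤ N * (c * E + r * E) + s * (N * E) := Nat.add_le_add h1 h2
    _ = (c + r + s) * (N * E) := by ring

theorem decideCost_le {D : ℕ} (hD : ∀ L, p.simCost L ≤ D * (L + 1)) :
    decideCost p R C ≤ (2 * R + D + 540) * ((C.base + 1) * (C.budget + 1)) := by
  have hE : 1 ≤ (C.base + 1) * (C.budget + 1) := Nat.mul_pos (Nat.succ_pos _) (Nat.succ_pos _)
  have h1 : p.simCost C.base * (C.budget + 1) ≤ D * (C.base + 1) * (C.budget + 1) :=
    Nat.mul_le_mul_right _ (hD _)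
  have h2 : C.budget * (100 * (C.base + 1) + 392 + 8) ≤ (C.budget + 1) * (500 * (C.base + 1)) :=
    Nat.mul_le_mul (Nat.le_succ _) (by omega)
  have h3 : 2 * R ≤ 2 * R * ((C.base + 1) * (C.budget + 1)) := Nat.le_mul_of_pos_right _ hE
  have h4 : 40 ≤ 40 * ((C.base + 1) * (C.budget + 1)) := Nat.le_mul_of_pos_right _ hE
  calc decideCost p R C ≤ 2 * R * ((C.base + 1) * (C.budget + 1)) + D * (C.base + 1) * (C.budget + 1) +
        (C.budget + 1) * (500 * (C.base + 1)) + 40 * ((C.base + 1) * (C.budget + 1)) :=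
      Nat.add_le_add (Nat.add_le_add (Nat.add_le_add h3 h1) h2) h4
    _ = _ := by ring

/-- The factors `C.H + 1` come from the two loops over `a` and `b`, one factor `C.m + 1` from the
thresholds and the other from counting clauses, `C.n + 1` from the bits, and the last two from one
simulated call. -/
theorem maxSatCost_le {D : ℕ} (hD : ∀ L, p.simCost L ≤ D * (L + 1)) :
    maxSatCost p R C ≤ (2 * R + D + 1200) * ((C.H + 1) * ((C.H + 1) * ((C.m + 1) * ((C.m + 1) *
      ((C.n + 1) * ((C.base + 1) * (C.budget + 1))))))) := by
  have hd := decideCost_le (R := R) (C := C) hD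
  generalize hc : 2 * R + D + 540 = c at hd
  obtain ⟨E, hEdef⟩ : ∃ E, E = (C.base + 1) * (C.budget + 1) := ⟨_, rfl⟩
  have hE : 1 ≤ E := hEdef ▸ Nat.mul_pos (Nat.succ_pos _) (Nat.succ_pos _)
  have hβ : 200 * (C.base + 1) ≤ 200 * E :=
    Nat.mul_le_mul_left _ (hEdef ▸ Nat.le_mul_of_pos_right _ (Nat.succ_pos _))
  rw [← hEdef] at hd ⊢
  have hsearch : searchCost p R C ≤ (c + 50) * ((C.n + 1) * E) :=
    (mul_add_add_le (r := 30) (s := 20) (Nat.le_succ C.n) (Nat.succ_pos _) hE hd).trans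
      (Nat.mul_le_mul_right _ (by omega))
  obtain ⟨F, hF⟩ : ∃ F, F = (C.n + 1) * E := ⟨_, rfl⟩
  have hEF : E ≤ F := hF ▸ Nat.le_mul_of_pos_left _ (Nat.succ_pos _)
  rw [← hF] at hsearch ⊢
  obtain ⟨G, hG⟩ : ∃ G, G = (C.m + 1) * F := ⟨_, rfl⟩
  have hFG : F ≤ G := hG ▸ Nat.le_mul_of_pos_left _ (Nat.succ_pos _)
  have heval : C.m * (200 * (C.base + 1) + 40 + 8) + 40 ≤ 288 * G := by
    have := mul_add_add_le (r := 48) (s := 40) (Nat.le_succ C.m) (Nat.succ_pos _) hE hβ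
    refine this.trans (Nat.mul_le_mul_left 288 ?_)
    rw [hG]
    exact Nat.mul_le_mul_left _ hEF
  rw [← hG]
  have hthr : thresholdsCost p R C ≤ (c + 352) * ((C.m + 1) * G) := by
    have hx : searchCost p R C + (C.m * (200 * (C.base + 1) + 40 + 8) + 40) ≤ (c + 338) * G := by
      have : (c + 50) * F ≤ (c + 50) * G := Nat.mul_le_mul_left _ hFG
      have e : (c + 338) * G = (c + 50) * G + 288 * G := by ring
      omega
    refine (mul_add_add_le (r := 8) (s := 6) (Nat.le_succ C.m) (Nat.succ_pos _) (hE.trans (hEF.trans hFG)) hx).trans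
      (Nat.mul_le_mul_right _ (by omega))
  obtain ⟨I, hI⟩ : ∃ I, I = (C.m + 1) * G := ⟨_, rfl⟩
  have hGI : G ≤ I := hI ▸ Nat.le_mul_of_pos_left _ (Nat.succ_pos _)
  have hI1 : 1 ≤ I := hE.trans (hEF.trans (hFG.trans hGI))
  rw [← hI] at hthr ⊢
  have hguess : guessCost p R C ≤ (c + 412) * I := by
    have e : (c + 412) * I = (c + 352) * I + 60 * I := by ring
    unfold guessCost
    omega
  have hin : (C.H + 1) * (guessCost p R C + 8) + 6 ≤ (c + 426) * ((C.H + 1) * I) :=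
    (mul_add_add_le (r := 8) (s := 6) le_rfl (Nat.succ_pos _) hI1 hguess).trans
      (Nat.mul_le_mul_right _ (by omega))
  have hJ1 : 1 ≤ (C.H + 1) * I := Nat.mul_pos (Nat.succ_pos _) hI1
  have hloops : loopsCost p R C ≤ (c + 440) * ((C.H + 1) * ((C.H + 1) * I)) :=
    (mul_add_add_le (r := 8) (s := 6) le_rfl (Nat.succ_pos _) hJ1 hin).trans
      (Nat.mul_le_mul_right _ (by omega))
  have hsetup : setupCost C ≤ 132 * ((C.H + 1) * ((C.H + 1) * I)) := by
    have h1 : C.m + 1 ≤ (C.H + 1) * ((C.H + 1) * I) := by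
      have : C.m + 1 ≤ I := hI ▸ Nat.le_mul_of_pos_right _ (hE.trans (hEF.trans hFG))
      exact this.trans ((Nat.le_mul_of_pos_left _ (Nat.succ_pos _)).trans
        (Nat.le_mul_of_pos_left _ (Nat.succ_pos _)))
    have h2 : C.H + 1 ≤ (C.H + 1) * ((C.H + 1) * I) := Nat.le_mul_of_pos_right _ hJ1
    unfold setupCost
    omega
  have e : (2 * R + D + 1200) * ((C.H + 1) * ((C.H + 1) * I)) =
      (c + 440) * ((C.H + 1) * ((C.H + 1) * I)) + 132 * ((C.H + 1) * ((C.H + 1) * I)) +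
        88 * ((C.H + 1) * ((C.H + 1) * I)) := by rw [← hc]; ring
  unfold maxSatCost
  omega

end

theorem two_pow_clog_le (m : ℕ) : 2 ^ Nat.clog 2 m ≤ 2 * (m + 1) := by
  rcases h : Nat.clog 2 m with _ | μ
  · simp; omega
  · have : 2 ^ μ < m := (Nat.lt_clog_iff_pow_lt (by norm_num)).1 (by omega)
    rw [pow_succ]
    omega

theorem clog_le_self (m : ℕ) : Nat.clog 2 m ≤ m := Nat.clog_le_of_le_pow Nat.lt_two_pow_self.le

namespace CNF
variable (F : CNF) (K q : ℕ)

/-- The parameters of the algorithm for a formula. -/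
abbrev ctx : Ctx := Ctx.ofMem F.mem K q

theorem ctx_m : (F.ctx K q).m = F.clauses.length := rfl
theorem ctx_n : (F.ctx K q).n = F.numVars := rfl
theorem ctx_base : (F.ctx K q).base = F.encode.length := F.clausePtr_length
theorem ctx_H : (F.ctx K q).H = F.numVars + 3 * Nat.clog 2 F.clauses.length + 2 := rfl

/-- A bound for all numbers that occur. -/
def maxWord (Z : ℕ) : ℕ := 4 * ((F.ctx K q).cap * (F.ctx K q).cap) * Z

variable {F K q}

/-- All parameters of the instances are estimated through `P = 2 ^ H`. The gap between `P` and `cap`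
leaves room for products of up to four such numbers below `cap * cap`. -/
theorem ctx_sizes (hK : 1 ≤ K) :
    let P := 2 ^ (F.ctx K q).H
    F.numVars ≤ P ∧ F.clauses.length ≤ P ∧ (F.ctx K q).H + 1 ≤ P ∧ 2 ^ F.numVars ≤ P ∧
      2 ^ F.numVars * F.clauses.length ≤ P ∧ 256 * (P * P) ≤ (F.ctx K q).cap ∧ 1 ≤ P := by
  have hm : F.clauses.length ≤ 2 ^ Nat.clog 2 F.clauses.length := Nat.le_pow_clog (by norm_num) _
  have hH := F.ctx_H K q
  have hmono : ∀ i ≤ (F.ctx K q).H, 2 ^ i ≤ 2 ^ (F.ctx K q).H := fun i hi =>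
    Nat.pow_le_pow_right (by norm_num) hi
  have hnm : 2 ^ F.numVars * F.clauses.length ≤ 2 ^ (F.ctx K q).H := by
    refine (Nat.mul_le_mul_left _ hm).trans ?_
    rw [← pow_add]
    exact hmono _ (by omega)
  refine ⟨Nat.lt_two_pow_self.le.trans (hmono _ (by omega)), hm.trans (hmono _ (by omega)),
    Nat.lt_two_pow_self, hmono _ (by omega), hnm, ?_, Nat.one_le_two_pow⟩
  change _ ≤ 2 ^ (K * (2 * (F.ctx K q).H + 8))
  calc 256 * (2 ^ (F.ctx K q).H * 2 ^ (F.ctx K q).H) = 2 ^ (2 * (F.ctx K q).H + 8) := by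
        rw [pow_add, two_mul, pow_add]; ring
    _ ≤ _ := Nat.pow_le_pow_right (by norm_num) (Nat.le_mul_of_pos_left _ hK)

/-- Products of at most four numbers bounded by `P` are small. -/
theorem powers_le {P c : ℕ} (hP : 1 ≤ P) (hc : 256 * (P * P) ≤ c) :
    P ≤ P * P ∧ P * P ≤ P * (P * P) ∧ P * (P * P) ≤ P * (P * (P * P)) ∧
      256 * (P * (P * (P * P))) ≤ c * c ∧ c ≤ c * c := by
  have hc1 : 1 ≤ c := by have := Nat.mul_pos hP hP; omega
  refine ⟨Nat.le_mul_of_pos_left _ hP, Nat.le_mul_of_pos_left _ hP, Nat.le_mul_of_pos_left _ hP, ?_,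
    Nat.le_mul_of_pos_left _ hc1⟩
  have := Nat.mul_le_mul hc hc
  have e : 256 * (P * P) * (256 * (P * P)) = 65536 * (P * (P * (P * P))) := by ring
  omega

theorem le_maxWord {Z x : ℕ} (hZ : 1 ≤ Z) (hx : x ≤ 4 * ((F.ctx K q).cap * (F.ctx K q).cap)) :
    x ≤ F.maxWord K q Z := hx.trans (Nat.le_mul_of_pos_right _ hZ)

theorem outerFits (hK : 1 ≤ K) (hq : 3 ≤ q) {Z : ℕ} (hZ : 1 ≤ Z) :
    (F.ctx K q).OuterFits (F.maxWord K q Z) := by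
  obtain ⟨h1, h2, h3, h4, h5, h6, h7⟩ := ctx_sizes (F := F) (q := q) hK
  obtain ⟨p1, p2, p3, p4, p5⟩ := powers_le h7 h6
  obtain ⟨P, hP⟩ : ∃ P, 2 ^ (F.ctx K q).H = P := ⟨_, rfl⟩
  simp only [hP] at h1 h2 h3 h4 h5 h6 h7 p1 p2 p3 p4
  have hmono : ∀ i ≤ (F.ctx K q).H, 2 ^ i ≤ P := fun i hi => hP ▸ Nat.pow_le_pow_right (by norm_num) hi
  have hX : ∀ a b, 2 ^ (F.numVars - (a + b)) * F.clauses.length ≤ P := fun a b =>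
    (Nat.mul_le_mul_right _ (Nat.pow_le_pow_right (by norm_num) (Nat.sub_le _ _))).trans h5
  refine ⟨rfl, fun a b hval => ?_, le_maxWord hZ ?_, fun a b _ => le_maxWord hZ ((hX a b).trans (by omega)),
    by rw [ctx_H, ctx_n]; omega, le_maxWord hZ ?_⟩
  · have hab : a + b ≤ (F.ctx K q).H := hval.1
    have hS := hmono a (by omega)
    have hT := hmono b (by omega)
    have hN := hmono ((F.ctx K q).H - (a + b)) (Nat.sub_le _ _)
    have hST : 2 ^ a * 2 ^ b ≤ P := by rw [← pow_add]; exact hmono _ hab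
    have hXab := hX a b
    refine ⟨fun thr hthr j hj fix hfix call => ⟨⟨rfl, fun hX0 => ?_, le_maxWord hZ ?_, le_maxWord hZ ?_,
      le_maxWord hZ ?_⟩, rfl, le_maxWord hZ ?_⟩, le_maxWord hZ ?_, le_maxWord hZ ?_, ?_⟩
    · exact Nat.pos_of_mul_pos_left hX0
    · change 8 * 2 ^ ((F.ctx K q).H - (a + b)) + 2 ^ (F.numVars - (a + b)) * F.clauses.length + 2 ^ b ≤ _
      omega
    · change 2 * (2 ^ (F.numVars - (a + b)) * F.clauses.length * (2 ^ a + 2 * 2 ^ b + 3)) ≤ _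
      have := Nat.mul_le_mul hXab (show 2 ^ a + 2 * 2 ^ b + 3 ≤ 6 * P by omega)
      have e : P * (6 * P) = 6 * (P * P) := by ring
      omega
    · change 2 ^ a + 2 ^ (F.numVars - (a + b)) * F.clauses.length * (2 ^ a * 2 ^ b) + 2 ^ b * 2 ^ a + fix ≤ _
      have t1 := Nat.mul_le_mul hXab hST
      have t2 : 2 ^ b * 2 ^ a ≤ P := by rw [mul_comm]; exact hST
      have t3 : fix ≤ P := (hfix.le.trans (Nat.pow_le_pow_right (by norm_num) hj)).trans h4
      omega
    · change 2 * (F.ctx K q).cap * (F.ctx K q).cap + (F.ctx K q).capLog + 1 ≤ _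
      have : (F.ctx K q).capLog < (F.ctx K q).cap := Nat.lt_two_pow_self
      rw [mul_assoc]
      omega
    · change 2 ^ F.numVars ≤ _
      omega
    · change (F.ctx K q).cap + 2 ^ a * 2 ^ b ≤ _
      omega
    · change 2 ^ a * 2 ^ b ≤ K * 2 ^ ((F.ctx K q).H + 3 - ((F.ctx K q).H + 3) / q) + 1
      have ha := hval.2.1
      have hb := hval.2.2
      -- Validity gives `2 a + b ≤ H` and `a + 2 b ≤ H`, hence `3 (a + b) ≤ 2 H`. For `q ≥ 3` the
      -- budget keeps at least two thirds of the exponent `H + 3`, so scanning the table fits into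
      -- it.
      have hdiv : ((F.ctx K q).H + 3) / q ≤ ((F.ctx K q).H + 3) / 3 := Nat.div_le_div_left hq (by norm_num)
      have : 2 ^ a * 2 ^ b ≤ 2 ^ ((F.ctx K q).H + 3 - ((F.ctx K q).H + 3) / q) := by
        rw [← pow_add]
        exact Nat.pow_le_pow_right (by norm_num) (by omega)
      exact (this.trans (Nat.le_mul_of_pos_left _ hK)).trans (Nat.le_succ _)
  · rw [hP]; omega
  · rw [ctx_m, ctx_n]
    have := Nat.mul_le_mul h3 (Nat.mul_le_mul h3 (Nat.mul_le_mul h2 h1))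
    omega

theorem setupFits (hK : 1 ≤ K) {Z : ℕ} (hKZ : K ≤ Z) (hqZ : q ≤ Z) :
    (F.ctx K q).SetupFits K q (F.maxWord K q Z) := by
  obtain ⟨h1, h2, h3, h4, h5, h6, h7⟩ := ctx_sizes (F := F) (q := q) hK
  obtain ⟨p1, p2, p3, p4, p5⟩ := powers_le h7 h6
  have hZ : 1 ≤ Z := hK.trans hKZ
  have hcc : 1 ≤ 4 * ((F.ctx K q).cap * (F.ctx K q).cap) := by omega
  refine ⟨le_maxWord hZ ?_, le_maxWord hZ ?_, le_maxWord hZ (by omega), ?_,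
    hKZ.trans (Nat.le_mul_of_pos_left _ hcc), hqZ.trans (Nat.le_mul_of_pos_left _ hcc)⟩
  · rw [ctx_base]
    refine F.length_encode_le.trans ?_
    have := Nat.mul_le_mul h2 (show 2 * F.numVars + 1 ≤ 3 * 2 ^ (F.ctx K q).H by omega)
    have e : 2 ^ (F.ctx K q).H * (3 * 2 ^ (F.ctx K q).H) = 3 * (2 ^ (F.ctx K q).H * 2 ^ (F.ctx K q).H) := by ring
    omega
  · rw [pow_add]
    omega
  · change K * 2 ^ ((F.ctx K q).H + 3 - ((F.ctx K q).H + 3) / q) + 1 ≤ _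
    have t1 : 2 ^ ((F.ctx K q).H + 3 - ((F.ctx K q).H + 3) / q) ≤ 2 ^ ((F.ctx K q).H + 3) :=
      Nat.pow_le_pow_right (by norm_num) (Nat.sub_le _ _)
    have t2 : 2 ^ ((F.ctx K q).H + 3 - ((F.ctx K q).H + 3) / q) + 1 ≤ 4 * ((F.ctx K q).cap * (F.ctx K q).cap) := by
      rw [pow_add] at t1
      omega
    have t3 := Nat.mul_le_mul t2 hKZ
    rw [add_mul, mul_comm _ K] at t3
    unfold maxWord
    omega

end CNF

end FlowHardness

namespace FlowHardness

/-! ### The algorithm for MAX-CNF-SAT -/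

/-- Rounding the quotient loses less than one in the exponent; with the summand `5` this gives the
factor `64 = 2 ^ 6`. The savings on `3 μ + 5` are given away. -/
theorem cast_budget_le {q : ℕ} (hq : 0 < q) (n μ : ℕ) :
    ((2 ^ (n + 3 * μ + 5 - (n + 3 * μ + 5) / q) : ℕ) : ℝ) ≤
      (2 : ℝ) ^ ((1 - 1 / (q : ℝ)) * n) * (64 * (2 ^ μ) ^ 3) := by
  have hq' : (0 : ℝ) < q := Nat.cast_pos.2 hq
  have hinv : 0 ≤ 1 / (q : ℝ) := by positivity
  have e1 : (64 * (2 ^ μ) ^ 3 : ℝ) = (2 : ℝ) ^ (3 * (μ : ℝ) + 6) := by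
    rw [Real.rpow_add (by norm_num), mul_comm (3 : ℝ), Real.rpow_mul (by norm_num), Real.rpow_natCast]
    norm_num
    ring
  rw [e1, ← Real.rpow_add (by norm_num), Nat.cast_pow, ← Real.rpow_natCast, Nat.cast_ofNat]
  refine Real.rpow_le_rpow_of_exponent_le (by norm_num) ?_
  rw [Nat.cast_sub (Nat.div_le_self _ _)]
  have h1 : ((n + 3 * μ + 5 : ℕ) : ℝ) / q < ((n + 3 * μ + 5) / q : ℕ) + 1 := by
    rw [div_lt_iff₀ hq']
    have := Nat.lt_mul_div_succ (n + 3 * μ + 5) hq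
    rw [mul_comm q] at this
    exact_mod_cast this
  have h2 : 0 ≤ (3 * (μ : ℝ) + 5) * (1 / (q : ℝ)) := by positivity
  rw [div_eq_mul_one_div] at h1
  push_cast at h1 ⊢
  linarith

namespace CNF
variable (F : CNF) (K q : ℕ)

/-- `2 ^ H` is at most a constant times the cube of `2 ^ n * (m + 1)`, and `cap` is polynomial in `2
^ H`. All words thus have length `O(n + log m)`, as the machine model requires. -/
theorem wordBound_maxWord_le (Z : ℕ) : wordBound (F.maxWord K q Z) ≤
    (4 * Z) ^ 32 * (2 ^ 18) ^ (64 * K) * (2 ^ F.numVars * (F.clauses.length + 1)) ^ (384 * K) := by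
  have hy : 2 ^ (F.ctx K q).H ≤ 32 * (2 ^ F.numVars * (F.clauses.length + 1)) ^ 3 := by
    have h1 : (2 ^ Nat.clog 2 F.clauses.length) ^ 3 ≤ (2 * (F.clauses.length + 1)) ^ 3 :=
      Nat.pow_le_pow_left (two_pow_clog_le _) 3
    have h2 : 2 ^ F.numVars ≤ (2 ^ F.numVars) ^ 3 := Nat.le_self_pow (by norm_num) _
    calc 2 ^ (F.ctx K q).H = 4 * (2 ^ F.numVars * (2 ^ Nat.clog 2 F.clauses.length) ^ 3) := by
          rw [ctx_H, pow_add, pow_add, mul_comm 3, pow_mul]; ring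
      _ ≤ 4 * ((2 ^ F.numVars) ^ 3 * (2 * (F.clauses.length + 1)) ^ 3) :=
        Nat.mul_le_mul_left _ (Nat.mul_le_mul h2 h1)
      _ = _ := by ring
  generalize 2 ^ F.numVars * (F.clauses.length + 1) = y at hy ⊢
  have hcap : (F.ctx K q).cap ≤ (2 ^ 18 * y ^ 6) ^ K := by
    change 2 ^ (K * (2 * (F.ctx K q).H + 8)) ≤ _
    rw [mul_comm K, pow_mul]
    refine Nat.pow_le_pow_left ?_ K
    calc 2 ^ (2 * (F.ctx K q).H + 8) = 256 * (2 ^ (F.ctx K q).H) ^ 2 := by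
          rw [pow_add, mul_comm 2, pow_mul]; ring
      _ ≤ 256 * (32 * y ^ 3) ^ 2 := Nat.mul_le_mul_left _ (Nat.pow_le_pow_left hy 2)
      _ = _ := by ring
  calc wordBound (F.maxWord K q Z) = (4 * ((F.ctx K q).cap * (F.ctx K q).cap) * Z) ^ 32 := rfl
    _ ≤ (4 * ((2 ^ 18 * y ^ 6) ^ K * (2 ^ 18 * y ^ 6) ^ K) * Z) ^ 32 :=
      Nat.pow_le_pow_left (Nat.mul_le_mul_right _ (Nat.mul_le_mul_left _ (Nat.mul_le_mul hcap hcap))) _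
    _ = _ := by
      rw [← pow_add, mul_right_comm, mul_pow, ← pow_mul, show (K + K) * 32 = 64 * K by ring,
        mul_pow (2 ^ 18) (y ^ 6), ← pow_mul y, show 6 * (64 * K) = 384 * K by ring, mul_assoc]

theorem sizes_le :
    (F.ctx K q).H + 1 ≤ 3 * ((F.numVars + 1) * (F.clauses.length + 1)) ∧
      F.clauses.length + 1 ≤ (F.numVars + 1) * (F.clauses.length + 1) ∧
      F.numVars + 1 ≤ (F.numVars + 1) * (F.clauses.length + 1) ∧
      (F.ctx K q).base + 1 ≤ 3 * ((F.numVars + 1) * (F.clauses.length + 1)) := by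
  have h1 := clog_le_self F.clauses.length
  have h2 := F.length_encode_le
  rw [ctx_H, ctx_base]
  have e : (F.numVars + 1) * (F.clauses.length + 1) =
      F.clauses.length * F.numVars + F.numVars + F.clauses.length + 1 := by ring
  have e' : F.clauses.length * (2 * F.numVars + 1) = 2 * (F.clauses.length * F.numVars) + F.clauses.length := by
    ring
  rw [e]
  rw [e'] at h2
  generalize F.clauses.length * F.numVars = z at h2 ⊢
  omega

/-- Of the ninth power, six factors come from the loops and the simulation overhead, and three from
the summand `3 μ` in the exponent of the budget. -/
theorem cast_maxSatCost_le {p : Prog} {R D : ℕ} (hD : ∀ L, p.simCost L ≤ D * (L + 1)) (hq : 0 < q) :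
    ((maxSatCost p R (F.ctx K q) : ℕ) : ℝ) ≤ (((2 * R + D + 1200) * 27 * (512 * (K + 2)) : ℕ) : ℝ) *
      ((2 : ℝ) ^ ((1 - 1 / (q : ℝ)) * F.numVars) *
        (((F.numVars : ℝ) + 1) * ((F.clauses.length : ℝ) + 1)) ^ 9) := by
  obtain ⟨h1, h2, h3, h4⟩ := F.sizes_le K q
  have hcost := maxSatCost_le (R := R) (C := F.ctx K q) hD
  rw [ctx_m, ctx_n] at hcost
  obtain ⟨Y, hY⟩ : ∃ Y, Y = (F.numVars + 1) * (F.clauses.length + 1) := ⟨_, rfl⟩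
  rw [← hY] at h1 h2 h3 h4
  have hcost' : maxSatCost p R (F.ctx K q) ≤
      (2 * R + D + 1200) * 27 * (Y ^ 6 * ((F.ctx K q).budget + 1)) := by
    refine hcost.trans ?_
    calc _ ≤ (2 * R + D + 1200) * (3 * Y * (3 * Y * (Y * (Y * (Y * (3 * Y * ((F.ctx K q).budget + 1))))))) :=
          Nat.mul_le_mul_left _ (Nat.mul_le_mul h1 (Nat.mul_le_mul h1 (Nat.mul_le_mul h2
            (Nat.mul_le_mul h2 (Nat.mul_le_mul h3 (Nat.mul_le_mul_right _ h4))))))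
      _ = _ := by ring
  have hYr : (((F.numVars : ℝ) + 1) * ((F.clauses.length : ℝ) + 1)) = (Y : ℝ) := by
    rw [hY]; push_cast; ring
  rw [hYr]
  have hbudget : (((F.ctx K q).budget + 1 : ℕ) : ℝ) ≤
      (512 * ((K : ℝ) + 2)) * ((2 : ℝ) ^ ((1 - 1 / (q : ℝ)) * F.numVars) * (Y : ℝ) ^ 3) := by
    have hb : (F.ctx K q).budget + 1 ≤ (K + 2) *
        2 ^ (F.numVars + 3 * Nat.clog 2 F.clauses.length + 5 -
          (F.numVars + 3 * Nat.clog 2 F.clauses.length + 5) / q) := by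
      change K * 2 ^ (F.numVars + 3 * Nat.clog 2 F.clauses.length + 5 -
          (F.numVars + 3 * Nat.clog 2 F.clauses.length + 5) / q) + 1 + 1 ≤ _
      have : 1 ≤ 2 ^ (F.numVars + 3 * Nat.clog 2 F.clauses.length + 5 -
          (F.numVars + 3 * Nat.clog 2 F.clauses.length + 5) / q) := Nat.one_le_two_pow
      rw [add_mul]
      omega
    have hμ : ((2 : ℝ) ^ Nat.clog 2 F.clauses.length) ^ 3 ≤ (2 * (Y : ℝ)) ^ 3 := by
      have : 2 ^ Nat.clog 2 F.clauses.length ≤ 2 * Y := (two_pow_clog_le _).trans (Nat.mul_le_mul_left _ h2)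
      exact pow_le_pow_left₀ (by positivity) (by exact_mod_cast this) 3
    calc (((F.ctx K q).budget + 1 : ℕ) : ℝ) ≤ ((K + 2 : ℕ) : ℝ) *
          ((2 ^ (F.numVars + 3 * Nat.clog 2 F.clauses.length + 5 -
          (F.numVars + 3 * Nat.clog 2 F.clauses.length + 5) / q) : ℕ) : ℝ) := by exact_mod_cast hb
      _ ≤ ((K + 2 : ℕ) : ℝ) * ((2 : ℝ) ^ ((1 - 1 / (q : ℝ)) * F.numVars) * (64 * (2 * (Y : ℝ)) ^ 3)) :=
        mul_le_mul_of_nonneg_left ((cast_budget_le hq _ _).trans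
          (mul_le_mul_of_nonneg_left (mul_le_mul_of_nonneg_left hμ (by norm_num)) (by positivity)))
          (Nat.cast_nonneg _)
      _ = _ := by push_cast; ring
  calc ((maxSatCost p R (F.ctx K q) : ℕ) : ℝ)
      ≤ (((2 * R + D + 1200) * 27 * (Y ^ 6 * ((F.ctx K q).budget + 1)) : ℕ) : ℝ) := Nat.cast_le.2 hcost'
    _ = ((2 * R + D + 1200) * 27 : ℕ) * ((Y : ℝ) ^ 6 * (((F.ctx K q).budget + 1 : ℕ) : ℝ)) := by
      rw [Nat.cast_mul _ (Y ^ 6 * _), Nat.cast_mul (Y ^ 6), Nat.cast_pow]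
    _ ≤ ((2 * R + D + 1200) * 27 : ℕ) * ((Y : ℝ) ^ 6 * ((512 * ((K : ℝ) + 2)) *
          ((2 : ℝ) ^ ((1 - 1 / (q : ℝ)) * F.numVars) * (Y : ℝ) ^ 3))) :=
      mul_le_mul_of_nonneg_left (mul_le_mul_of_nonneg_left hbudget (by positivity)) (Nat.cast_nonneg _)
    _ = _ := by
      push_cast
      ring

end CNF

/-- A fast algorithm for flows gives a program that computes the maximum number of satisfiable
clauses; it leaves this number and the number of clauses in registers. -/
theorem exists_maxSat_prog {p : Prog} {K q : ℕ} {ε c₁ c₂ : ℝ} (hp : FlowBound p K ε c₁ c₂) (hq : 3 ≤ q)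
    (hε : 1 / (q : ℝ) ≤ ε) (h₁ : c₁ ∈ Set.Icc (0 : ℝ) 1) (h₂ : c₂ ∈ Set.Icc (0 : ℝ) 1) :
    ∃ (Q : Prog) (c : ℕ), 1 ≤ c ∧ ∀ F : CNF, ∃ (k : ℕ) (t : State),
      Exec (c * (2 ^ F.numVars * (F.clauses.length + 1)) ^ c) Q (initState F.encode) t k ∧
      (k : ℝ) ≤ c * ((2 : ℝ) ^ ((1 - 1 / (q : ℝ)) * F.numVars) *
        (((F.numVars : ℝ) + 1) * ((F.clauses.length : ℝ) + 1)) ^ 9) ∧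
      IsGreatest (Set.range F.numSat) (t.reg 0) ∧ t.reg 2 = F.clauses.length := by
  obtain ⟨D, hD⟩ := p.exists_simCost_le
  obtain ⟨W, hW⟩ := p.exists_constLe
  obtain ⟨R, hR⟩ := Prog.exists_touches_sim p
  -- `Z` dominates every constant that occurs literally: those of the simulated program, `K + 1`,
  -- `q`, and the `8` required by `Bounded`.
  obtain ⟨Z, hZ⟩ : ∃ Z, Z = K + 1 + q + W + 8 := ⟨_, rfl⟩
  refine ⟨.maxSat p R (K + 1) q, (4 * Z) ^ 32 * (2 ^ 18) ^ (64 * (K + 1)) + 384 * (K + 1) +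
    (2 * R + D + 1200) * 27 * (512 * (K + 1 + 2)), by omega, fun F => ?_⟩
  obtain ⟨opt, hopt⟩ := F.exists_isGreatest
  obtain ⟨h1, h2, h3, h4, h5, h6, h7⟩ := CNF.ctx_sizes (F := F) (K := K + 1) (q := q) (Nat.le_add_left _ _)
  have hZV : Z ≤ F.maxWord (K + 1) q Z :=
    Nat.le_mul_of_pos_left _ (by have := Nat.mul_pos h7 h7; have := Nat.le_mul_self (F.ctx (K + 1) q).cap; omega)
  have hmem : ∀ x, F.mem x ≤ F.maxWord (K + 1) q Z := fun x => by
    refine (F.mem_le x).trans (CNF.le_maxWord (by omega) ?_)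
    obtain ⟨p1, p2, p3, p4, p5⟩ := CNF.powers_le h7 h6
    omega
  have hgood := exists_valid_allAnswered (mem := F.mem) hp (by omega : 0 < q) hε h₁ h₂ F.varsLt
  have hspec := maxSat_spec (hR R le_rfl) rfl (CNF.setupFits (F := F) (Nat.le_add_left 1 K)
      (show K + 1 ≤ Z by omega) (show q ≤ Z by omega))
    (CNF.outerFits (Nat.le_add_left 1 K) hq (by omega)) (hW _ (by omega)) (F.isOpt hopt _ _)
    (fun x hx => F.mem_eq_zero (by rwa [CNF.ctx_base] at hx)) hgood
  obtain ⟨t, hrun, -, hm, hbest⟩ := hspec ⟨by omega, fun _ => Nat.zero_le _, hmem⟩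
  obtain ⟨σ, k, hk, hview, hexec⟩ := hrun (initState F.encode) rfl
  subst hview
  have hyp : 1 ≤ 2 ^ F.numVars * (F.clauses.length + 1) := Nat.mul_pos (Nat.two_pow_pos _) (Nat.succ_pos _)
  refine ⟨k, σ, hexec.mono ((F.wordBound_maxWord_le _ _ _).trans ?_), ?_, ?_, hm⟩
  · exact Nat.mul_le_mul (by omega) (Nat.pow_le_pow_right hyp (by omega))
  · refine (Nat.cast_le.2 hk).trans ((F.cast_maxSatCost_le (K + 1) q hD (by omega)).trans ?_)
    exact mul_le_mul_of_nonneg_right (Nat.cast_le.2 (Nat.le_add_left _ _)) (by positivity)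
  · have : σ.reg 0 = opt := hbest
    rwa [this]

end FlowHardness

namespace FlowHardness

/-! ### Consequences for satisfiability problems -/

/-- A polynomial divided by an exponential tends to zero and is therefore bounded over all of `ℕ`.
-/
theorem exists_pow_le_rpow (d : ℕ) {δ : ℝ} (hδ : 0 < δ) :
    ∃ C : ℕ, ∀ n : ℕ, ((n : ℝ) + 1) ^ d ≤ C * (2 : ℝ) ^ (δ * n) := by
  have hr : 1 < (2 : ℝ) ^ δ := Real.one_lt_rpow (by norm_num) hδ
  obtain ⟨M, hM⟩ := (tendsto_pow_const_div_const_pow_of_one_lt d hr).bddAbove_range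
  obtain ⟨C, hC⟩ := exists_nat_ge (M * (2 : ℝ) ^ δ)
  refine ⟨C, fun n => ?_⟩
  have h : (((n + 1 : ℕ) : ℝ)) ^ d / ((2 : ℝ) ^ δ) ^ (n + 1) ≤ M := hM ⟨n + 1, rfl⟩
  rw [div_le_iff₀ (by positivity), pow_succ', ← mul_assoc] at h
  push_cast at h
  rw [Real.rpow_mul (by norm_num), Real.rpow_natCast]
  exact h.trans (mul_le_mul_of_nonneg_right hC (by positivity))

/-- As `T` is at least `2 ^ (n / 2)`, the number `2 ^ n` is at most `T ^ 2`. Words of length `O(n +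
log m)` are therefore allowed on a machine with time bound `T`; this uses `δ ≤ 1 / 2` in the
applications. -/
theorem cast_word_le {n m c K : ℕ} {T : ℝ} (hT : (2 : ℝ) ^ ((1 / 2 : ℝ) * n) ≤ T) (hK : 3 * c ≤ K) :
    ((c * (2 ^ n * (m + 1)) ^ c : ℕ) : ℝ) ≤ K * (((n + m : ℕ) : ℝ) + T) ^ K := by
  have h1 : 1 ≤ (2 : ℝ) ^ ((1 / 2 : ℝ) * n) := Real.one_le_rpow (by norm_num) (by positivity)
  have hn : (0 : ℝ) ≤ n := Nat.cast_nonneg n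
  have hm : (0 : ℝ) ≤ m := Nat.cast_nonneg m
  have e : (2 : ℝ) ^ n = ((2 : ℝ) ^ ((1 / 2 : ℝ) * n)) ^ 2 := by
    rw [← Real.rpow_natCast ((2 : ℝ) ^ _), ← Real.rpow_mul (by norm_num), ← Real.rpow_natCast]
    congr 1
    push_cast
    ring
  push_cast
  have hX : (2 : ℝ) ^ n * (m + 1) ≤ (n + m + T) ^ 3 := by
    rw [e, pow_succ _ 2]
    exact mul_le_mul (pow_le_pow_left₀ (by linarith) (by linarith) 2) (by linarith) (by linarith)
      (by positivity)
  have hc : (c : ℝ) ≤ K := Nat.cast_le.2 (by omega)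
  refine mul_le_mul hc ?_ (by positivity) (Nat.cast_nonneg _)
  calc ((2 : ℝ) ^ n * (m + 1)) ^ c ≤ ((n + m + T) ^ 3) ^ c := pow_le_pow_left₀ (by positivity) hX c
    _ = (n + m + T) ^ (3 * c) := (pow_mul _ _ _).symm
    _ ≤ _ := pow_le_pow_right₀ (by linarith) hK

theorem CNF.numSat_le (F : CNF) (a : Fin F.numVars → Bool) : F.numSat a ≤ F.clauses.length :=
  List.countP_le_length

theorem CNF.exists_satisfies_iff {F : CNF} {opt : ℕ} (h : IsGreatest (Set.range F.numSat) opt) :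
    (∃ a : Fin F.numVars → Bool, ∀ c ∈ F.clauses, satisfies a c = true) ↔ F.clauses.length ≤ opt := by
  constructor
  · rintro ⟨a, ha⟩
    exact (List.countP_eq_length.2 ha).symm.le.trans (h.2 ⟨a, rfl⟩)
  · intro hle
    obtain ⟨a, rfl⟩ := h.1
    exact ⟨a, List.countP_eq_length.1 ((F.numSat_le a).antisymm hle)⟩

section
variable {p : Prog} {K q : ℕ} {ε c₁ c₂ : ℝ}

theorem rpow_half_le {δ : ℝ} (hδ : δ ≤ 1 / 2) (n : ℕ) :
    (2 : ℝ) ^ ((1 / 2 : ℝ) * n) ≤ (2 : ℝ) ^ ((1 - δ) * n) :=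
  Real.rpow_le_rpow_of_exponent_le (by norm_num)
    (mul_le_mul_of_nonneg_right (by linarith) (Nat.cast_nonneg n))

theorem rpow_split (δ : ℝ) (n : ℕ) :
    (2 : ℝ) ^ ((1 - 2 * δ) * n) * (2 : ℝ) ^ (δ * n) = (2 : ℝ) ^ ((1 - δ) * n) := by
  rw [← Real.rpow_add (by norm_num)]
  congr 1
  ring

/-- With `m ≤ A n` the polynomial factor has degree `18` in `n` and is absorbed by `2 ^ (δ n)`, half
of the saving `1 / q = 2 δ`. The constant `A` affects only the implied constant, not `δ`. -/
theorem FlowBound.maxCNFSATFast (hp : FlowBound p K ε c₁ c₂) (hq : 3 ≤ q) (hε : 1 / (q : ℝ) ≤ ε)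
    (h₁ : c₁ ∈ Set.Icc (0 : ℝ) 1) (h₂ : c₂ ∈ Set.Icc (0 : ℝ) 1) {δ : ℝ} (hδ : 0 < δ)
    (hδ2 : δ ≤ 1 / 2) (hδq : 2 * δ = 1 / (q : ℝ)) : MaxCNFSATFast δ := by
  intro A
  obtain ⟨Q, c, -, hQ⟩ := exists_maxSat_prog hp hq hε h₁ h₂
  obtain ⟨C, hC⟩ := exists_pow_le_rpow 18 hδ
  refine ⟨Q, 3 * c + c * ((A + 1) ^ 9 * C), fun F hF => ?_⟩
  obtain ⟨k, t, he, hk, hopt, -⟩ := hQ F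
  refine ⟨_, k, t, cast_word_le (rpow_half_le hδ2 F.numVars) (Nat.le_add_right _ _), ?_, he, hopt⟩
  have hm : (F.clauses.length : ℝ) + 1 ≤ (A + 1) * ((F.numVars : ℝ) + 1) := by
    have h : (F.clauses.length : ℝ) ≤ A * F.numVars := by
      have h' : F.clauses.length ≤ A * F.numVars := hF
      exact_mod_cast h'
    have : (0 : ℝ) ≤ A := Nat.cast_nonneg A
    have : (0 : ℝ) ≤ F.numVars := Nat.cast_nonneg _
    linarith
  have hY : (((F.numVars : ℝ) + 1) * ((F.clauses.length : ℝ) + 1)) ^ 9 ≤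
      (A + 1) ^ 9 * (C * (2 : ℝ) ^ (δ * F.numVars)) :=
    calc _ ≤ (((F.numVars : ℝ) + 1) * ((A + 1) * ((F.numVars : ℝ) + 1))) ^ 9 :=
          pow_le_pow_left₀ (by positivity) (mul_le_mul_of_nonneg_left hm (by positivity)) 9
      _ = (A + 1) ^ 9 * ((F.numVars : ℝ) + 1) ^ 18 := by ring
      _ ≤ _ := mul_le_mul_of_nonneg_left (hC _) (by positivity)
  rw [← hδq] at hk
  have hT : (0 : ℝ) ≤ (2 : ℝ) ^ ((1 - δ) * (F.numVars : ℝ)) := by positivity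
  calc (k : ℝ) ≤ c * ((2 : ℝ) ^ ((1 - 2 * δ) * F.numVars) *
        ((A + 1) ^ 9 * (C * (2 : ℝ) ^ (δ * F.numVars)))) :=
        hk.trans (mul_le_mul_of_nonneg_left (mul_le_mul_of_nonneg_left hY (by positivity))
          (Nat.cast_nonneg _))
    _ = c * ((A + 1) ^ 9 * C) * (2 : ℝ) ^ ((1 - δ) * (F.numVars : ℝ)) := by
      rw [← rpow_split δ F.numVars]; ring
    _ ≤ _ := by
      refine mul_le_mul_of_nonneg_right ?_ hT
      push_cast
      linarith [(Nat.cast_nonneg c : (0 : ℝ) ≤ c)]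

/-- The factor in `n` is absorbed as before, while the ninth power of `m + 1` is permitted by SETH.
No sparsification is needed, as the algorithm accepts any number of clauses. -/
theorem FlowBound.not_seth (hp : FlowBound p K ε c₁ c₂) (hq : 3 ≤ q) (hε : 1 / (q : ℝ) ≤ ε)
    (h₁ : c₁ ∈ Set.Icc (0 : ℝ) 1) (h₂ : c₂ ∈ Set.Icc (0 : ℝ) 1) {δ : ℝ} (hδ : 0 < δ)
    (hδ2 : δ ≤ 1 / 2) (hδq : 2 * δ = 1 / (q : ℝ)) : ¬ SETH := by
  intro hS
  -- The clause width is discarded because the algorithm works for all widths.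
  obtain ⟨_, -, hno⟩ := hS δ hδ
  refine hno 9 ?_
  obtain ⟨Q, c, hc, hQ⟩ := exists_maxSat_prog hp hq hε h₁ h₂
  obtain ⟨C, hC⟩ := exists_pow_le_rpow 9 hδ
  -- Register `2` holds `m` and register `0` the optimum; their truncated difference vanishes
  -- exactly for satisfiable formulas.
  refine ⟨.seq Q (.seq (.op .sub 1 2 0) (.cond 1 (.const 0 0) (.const 0 1))), 3 * c + (c * C + 3),
    fun F _ => ?_⟩
  obtain ⟨k, t, he, hk, hopt, hm⟩ := hQ F
  set B := c * (2 ^ F.numVars * (F.clauses.length + 1)) ^ c with hB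
  have hmB : F.clauses.length + 1 ≤ B :=
    calc F.clauses.length + 1 ≤ 2 ^ F.numVars * (F.clauses.length + 1) :=
          Nat.le_mul_of_pos_left _ (Nat.two_pow_pos _)
      _ ≤ (2 ^ F.numVars * (F.clauses.length + 1)) ^ c := Nat.le_self_pow (by omega) _
      _ ≤ B := Nat.le_mul_of_pos_left _ hc
  have hsub : Exec B (.op .sub 1 2 0) t (t.setReg 1 (t.reg 2 - t.reg 0)) 1 :=
    .op .sub 1 2 0 t ((Nat.sub_le _ _).trans (by omega))
  have htest : ∃ u, Exec B (.cond 1 (.const 0 0) (.const 0 1)) (t.setReg 1 (t.reg 2 - t.reg 0)) u (1 + 1) ∧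
      (u.reg 0 ≠ 0 ↔ F.clauses.length ≤ t.reg 0) := by
    by_cases h : F.clauses.length ≤ t.reg 0
    · refine ⟨_, .cond_false (by simp [State.setReg]; omega) (.const 0 1 _ (by omega)), ?_⟩
      simp [State.setReg, h]
    · refine ⟨_, .cond_true (by simp [State.setReg]; omega) (.const 0 0 _ (by omega)), ?_⟩
      simp [State.setReg, h]
  obtain ⟨u, hu, hans⟩ := htest
  have hone : (1 : ℝ) ≤ ((F.clauses.length : ℝ) + 1) ^ 9 :=
    one_le_pow₀ (by linarith [(Nat.cast_nonneg F.clauses.length : (0 : ℝ) ≤ F.clauses.length)])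
  have hhalf := rpow_half_le hδ2 F.numVars
  have hpow : (2 : ℝ) ^ ((1 - δ) * (F.numVars : ℝ)) ≤
      (2 : ℝ) ^ ((1 - δ) * (F.numVars : ℝ)) * ((F.clauses.length : ℝ) + 1) ^ 9 :=
    le_mul_of_one_le_right (by positivity) hone
  refine ⟨B, k + (1 + (1 + 1)), u, cast_word_le (hhalf.trans hpow) (Nat.le_add_right _ _), ?_,
    he.seq (hsub.seq hu), hans.trans (CNF.exists_satisfies_iff hopt).symm⟩
  have hT : (1 : ℝ) ≤ (2 : ℝ) ^ ((1 - δ) * (F.numVars : ℝ)) * ((F.clauses.length : ℝ) + 1) ^ 9 :=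
    (Real.one_le_rpow (by norm_num) (by positivity)).trans (hhalf.trans hpow)
  have hk' : (k : ℝ) ≤ c * C *
      ((2 : ℝ) ^ ((1 - δ) * (F.numVars : ℝ)) * ((F.clauses.length : ℝ) + 1) ^ 9) := by
    rw [← hδq, mul_pow] at hk
    refine hk.trans ?_
    calc _ ≤ c * ((2 : ℝ) ^ ((1 - 2 * δ) * F.numVars) * ((C * (2 : ℝ) ^ (δ * F.numVars)) *
          ((F.clauses.length : ℝ) + 1) ^ 9)) :=
          mul_le_mul_of_nonneg_left (mul_le_mul_of_nonneg_left
            (mul_le_mul_of_nonneg_right (hC _) (by positivity)) (by positivity)) (Nat.cast_nonneg _)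
      _ = _ := by rw [← rpow_split δ F.numVars]; ring
  have h3c : (0 : ℝ) ≤ 3 * c * ((2 : ℝ) ^ ((1 - δ) * (F.numVars : ℝ)) * ((F.clauses.length : ℝ) + 1) ^ 9) := by
    positivity
  push_cast
  linarith

end

end FlowHardness

theorem theorem4 (ε : ℝ) (hε : 0 < ε) :
    ∃ δ : ℝ, 0 < δ ∧
      ∀ c₁ : ℝ, c₁ ∈ Set.Icc (0 : ℝ) 1 → ∀ c₂ : ℝ, c₂ ∈ Set.Icc (0 : ℝ) 1 →
        FlowHardness.STMaxFlowFast ε c₁ c₂ →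
          FlowHardness.MaxCNFSATFast δ ∧ ¬ FlowHardness.SETH := by
  obtain ⟨r, hr⟩ := exists_nat_ge (1 / ε)
  -- The lower bound `3` is what scanning the answer table within the budget requires. `q`, and with
  -- it `δ = 1 / (2 q)`, depends on `ε` alone.
  obtain ⟨q, hq⟩ : ∃ q, q = max 3 r := ⟨_, rfl⟩
  have hq3 : 3 ≤ q := hq ▸ le_max_left _ _
  have hq3' : (3 : ℝ) ≤ q := by exact_mod_cast hq3
  have hqε : 1 / (q : ℝ) ≤ ε := by
    have hrq : (r : ℝ) ≤ q := Nat.cast_le.2 (hq ▸ le_max_right _ _)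
    exact (one_div_le (by linarith) hε).2 (hr.trans hrq)
  have hδ : 0 < 1 / (2 * (q : ℝ)) := by positivity
  have hδ2 : 1 / (2 * (q : ℝ)) ≤ 1 / 2 := one_div_le_one_div_of_le (by norm_num) (by linarith)
  have hδq : 2 * (1 / (2 * (q : ℝ))) = 1 / (q : ℝ) := by
    have : (q : ℝ) ≠ 0 := by linarith
    field_simp
  refine ⟨1 / (2 * (q : ℝ)), hδ, fun c₁ h₁ c₂ h₂ h => ?_⟩
  -- All instances of the reduction satisfy the size restrictions with the factor `64` and no
  -- logarithms.
  obtain ⟨p, K, hp⟩ := h 64 0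
  have hp' : FlowHardness.FlowBound p K ε c₁ c₂ := hp
  exact ⟨hp'.maxCNFSATFast hq3 hqε h₁ h₂ hδ hδ2 hδq, hp'.not_seth hq3 hqε h₁ h₂ hδ hδ2 hδq⟩
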